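/- Let $d\ge 1$, and let $\hbar=1/(2\pi N)$ with $N\in\{1,2,3,\dots\}$; limits $\hbar\downarrow0$ are limits $N\to\infty$. For $x=(x_q,x_p)$, $y=(y_q,y_p)$ in $\mathbb R^{2d}$ put $\omega(x,y)=x_q\cdot y_p-x_p\cdot y_q$. For $\xi=(\xi_q,\xi_p)\in\mathbb R^{2d}$ let $U_\hbar(\xi)$ be the operator $$U_\hbar(\xi)\psi(q)=\psi(q-\xi_q)\,\exp\Big(\tfrac i\hbar\big(\xi_p\cdot q-\tfrac12\xi_q\cdot\xi_p\big)\Big)$$ on Schwartz functions, extended by duality to $\mathcal S'(\mathbb R^d)$. For $\kappa=(\kappa_q,\kappa_p)\in[0,2\pi)^{2d}$, which may depend on $\hbar$, let $$\mathcal H_\hbar(\kappa)=\{\psi\in\mathcal S'(\mathbb R^d):\ U_\hbar(n)\psi=e^{i\omega(\kappa,n)+i\,n_q\cdot n_p/(2\hbar)}\psi\ \text{ for all } n=(n_q,n_p)\in\mathbb Z^{2d}\},$$ which has dimension $N^d$, with the scalar product (antilinear in the first argument) for which the basis $$\psi^\kappa_r=N^{-d/2}\sum_{k\in\mathbb Z^d}e^{i\kappa_p\cdot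 k}\,\delta_{k+\frac rN+\frac{\kappa_q}{2\pi N}},\qquad r\in\{0,\dots,N-1\}^d,$$ is orthonormal. Let $\mathbb T^{2d}=(\mathbb R/\mathbb Z)^{2d}$. For $f\in C^\infty(\mathbb T^{2d})$ let $$Op^W(f)=\sum_{n\in\mathbb Z^{2d}}\Big(\int_{\mathbb T^{2d}}e^{2\pi i\,\omega(n,x)}f(x)\,dx\Big)\,U_\hbar(n/N)$$ be its Weyl quantization on $\mathcal H_\hbar(\kappa)$. Let $\eta_\hbar(q)=(\pi\hbar)^{-d/4}e^{-|q|^2/(2\hbar)}$ and, for $a\in\mathbb R^{2d}$, let $$\eta^a_{\hbar,\kappa}=\Big(\sum_{n_p\in\mathbb Z^d}e^{-i\kappa_q\cdot n_p}U_\hbar(0,n_p)\Big)\Big(\sum_{n_q\in\mathbb Z^d}e^{i\kappa_p\cdot n_q}U_\hbar(n_q,0)\Big)U_\hbar(a)\eta_\hbar\in\mathcal H_\hbar(\kappa)$$ be the coherent states on the torus. Let $\Psi_\hbar\in\mathcal H_\hbar(\kappa)$ be a family of vectors, one for each $\hbar=1/(2\pi N)$. Consider the property (A) $\langle\Psi_\hbar,Op^W(f)\Psi_\hbar\rangle_{\mathcal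 H_\hbar(\kappa)}\to f(0)$ as $\hbar\downarrow0$, for all $f\in C^\infty(\mathbb T^{2d})$, and, for a family of functions $\chi_\hbar$ on $\mathbb T^{2d}$, the property (B) $\displaystyle\Big\|\Psi_\hbar-(2\pi\hbar)^{-d}\int_{\mathbb T^{2d}}\chi_\hbar(a)\,\langle\eta^a_{\hbar,\kappa},\Psi_\hbar\rangle_{\mathcal H_\hbar(\kappa)}\,\eta^a_{\hbar,\kappa}\,da\Big\|_{\mathcal H_\hbar(\kappa)}\to0$ as $\hbar\downarrow0$. 1. If (A) holds, then there are positive numbers $r_\hbar\to0$ and functions $\chi_\hbar\in C^\infty(\mathbb T^{2d})$ with $0\le\chi_\hbar\le1$, supported in the ball of radius $r_\hbar$ centred at $0$ in $\mathbb T^{2d}$, such that (B) holds. 2. Conversely, if (B) holds for some positive numbers $r_\hbar\to0$ and some functions $\chi_\hbar\in C^\infty(\mathbb T^{2d})$ with $0\le\chi_\hbar\le1$, supported in the ball of radius $r_\hbar$ centred at $0$ in $\mathbb T^{2d}$, and if moreover $\|\Psi_\hbar\|_{\mathcal H_\hbar(\kappa)}\to1$, then (A) holds. -/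

import Mathlib

open MeasureTheory Filter Topology SchwartzMap
open scoped ContDiff

noncomputable section

namespace TorusQuantum

/-! ### Temperate growth of the exponentials that occur below -/

lemma hasDerivAt_cexp_mul (c : ℂ) (s : ℝ) :
    HasDerivAt (fun s : ℝ => Complex.exp (c * s)) (c * Complex.exp (c * s)) s := by
  have h1 : HasDerivAt (fun s : ℝ => c * (s : ℂ)) c s := by
    simpa using (Complex.ofRealCLM.hasDerivAt (x := s)).const_mul c
  simpa [mul_comm] using h1.cexp

lemma iteratedDeriv_cexp_mul (c : ℂ) (n : ℕ) :
    iteratedDeriv n (fun s : ℝ => Complex.exp (c * s))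
      = fun s : ℝ => c ^ n * Complex.exp (c * s) := by
  induction n with
  | zero => simp
  | succ n ih =>
    rw [iteratedDeriv_succ, ih]
    funext s
    rw [((hasDerivAt_cexp_mul c s).const_mul (c ^ n)).deriv]
    ring

lemma hasTemperateGrowth_cexp {E : Type*} [NormedAddCommGroup E] [NormedSpace ℝ E]
    (c : ℂ) {f : E → ℝ} (hf : f.HasTemperateGrowth) (hc : ∀ x, c.re * f x ≤ 0) :
    (fun x => Complex.exp (c * f x)).HasTemperateGrowth := by
  have hopen : IsOpen {s : ℝ | c.re * s < 1} :=
    isOpen_lt (by fun_prop) continuous_const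
  have hsm : ContDiff ℝ ∞ (fun s : ℝ => Complex.exp (c * s)) :=
    (contDiff_const.mul Complex.ofRealCLM.contDiff).cexp
  refine Function.HasTemperateGrowth.comp' (g := fun s : ℝ => Complex.exp (c * s))
    (t := {s : ℝ | c.re * s < 1}) ?_ hopen.uniqueDiffOn hsm.contDiffOn ?_ hf
  · rintro _ ⟨x, rfl⟩
    exact lt_of_le_of_lt (hc x) one_pos
  · intro M
    refine ⟨0, (1 + ‖c‖) ^ M * Real.exp 1, by positivity, fun n hn s hs => ?_⟩
    rw [norm_iteratedFDerivWithin_eq_norm_iteratedDerivWithin,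
      iteratedDerivWithin_eq_iteratedDeriv hopen.uniqueDiffOn
        (hsm.contDiffAt.of_le (mod_cast le_top)) hs, iteratedDeriv_cexp_mul, norm_mul, norm_pow,
      Complex.norm_exp]
    have h1 : ‖c‖ ^ n ≤ (1 + ‖c‖) ^ M :=
      (pow_le_pow_left₀ (norm_nonneg c) (by linarith) n).trans
        (pow_le_pow_right₀ (by linarith [norm_nonneg c]) hn)
    have h2 : (c * (s : ℂ)).re = c.re * s := by simp
    have h3 : Real.exp (c * (s : ℂ)).re ≤ Real.exp 1 := by
      rw [h2]; exact Real.exp_le_exp.mpr (le_of_lt hs)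
    simpa using mul_le_mul h1 h3 (Real.exp_nonneg _) (by positivity)

/-! ### Configuration space, phase space, Planck's constant -/

/-- The configuration space `ℝ^d`. -/
abbrev Config (d : ℕ) := EuclideanSpace ℝ (Fin d)

/-- The phase space `ℝ^{2d}`, whose points are written `x = (q, p)`. -/
abbrev Phase (d : ℕ) := Config d × Config d

/-- An integer vector as a point of `ℝ^d`. -/
def intVec {d : ℕ} (n : Fin d → ℤ) : Config d := WithLp.toLp 2 fun j => (n j : ℝ)

/-- A point of the lattice `ℤ^{2d}` in phase space. -/
def intPhase {d : ℕ} (n : (Fin d → ℤ) × (Fin d → ℤ)) : Phase d := (intVec n.1, intVec n.2)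

/-- The symplectic form `ω(x, y) = x_q · y_p - x_p · y_q`. -/
def symp {d : ℕ} (x y : Phase d) : ℝ := inner ℝ x.1 y.2 - inner ℝ x.2 y.1

/-- `ħ = 1 / (2 π N)`. -/
def hbar (N : ℕ+) : ℝ := 1 / (2 * Real.pi * (N : ℝ))

lemma hbar_pos (N : ℕ+) : 0 < hbar N := by
  have : (0 : ℝ) < (N : ℝ) := by exact_mod_cast N.pos
  have := Real.pi_pos
  unfold hbar; positivity

/-! ### Phase space translations -/

/-- The phase `exp ((i/ħ) (ξ_p · q - ξ_q · ξ_p / 2))`. -/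
def phaseFactor {d : ℕ} (h : ℝ) (ξ : Phase d) (q : Config d) : ℂ :=
  Complex.exp (Complex.I * ((inner ℝ ξ.2 q - inner ℝ ξ.1 ξ.2 / 2) / h : ℝ))

lemma hasTemperateGrowth_phaseFactor {d : ℕ} (h : ℝ) (ξ : Phase d) :
    (phaseFactor h ξ).HasTemperateGrowth := by
  refine hasTemperateGrowth_cexp Complex.I (E := Config d)
    (f := fun q => (inner ℝ ξ.2 q - inner ℝ ξ.1 ξ.2 / 2) / h) ?_ (by simp)
  simp only [div_eq_mul_inv]
  fun_prop

/-- `U_ħ(ξ)` on Schwartz functions: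
`(U_ħ(ξ) ψ)(q) = ψ (q - ξ_q) exp ((i/ħ) (ξ_p · q - ξ_q · ξ_p / 2))`. -/
def translS {d : ℕ} (h : ℝ) (ξ : Phase d) : 𝓢(Config d, ℂ) →L[ℂ] 𝓢(Config d, ℂ) :=
  SchwartzMap.smulLeftCLM ℂ (phaseFactor h ξ) ∘L SchwartzMap.compSubConstCLM ℂ ξ.1

lemma translS_apply {d : ℕ} (h : ℝ) (ξ : Phase d) (ψ : 𝓢(Config d, ℂ)) (q : Config d) :
    translS h ξ ψ q = phaseFactor h ξ q * ψ (q - ξ.1) := by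
  simp [translS, SchwartzMap.smulLeftCLM_apply_apply (hasTemperateGrowth_phaseFactor h ξ)]

/-- `U_ħ(ξ)` on tempered distributions, as the transpose of `U_ħ(-ξ_q, ξ_p)` on Schwartz functions
(for the bilinear pairing `∫ ψ φ`). -/
def transl {d : ℕ} (h : ℝ) (ξ : Phase d) : 𝓢'(Config d, ℂ) →L[ℂ] 𝓢'(Config d, ℂ) :=
  PointwiseConvergenceCLM.precomp _ (translS h (-ξ.1, ξ.2))

lemma transl_apply {d : ℕ} (h : ℝ) (ξ : Phase d) (T : 𝓢'(Config d, ℂ)) (φ : 𝓢(Config d, ℂ)) :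
    transl h ξ T φ = T (translS h (-ξ.1, ξ.2) φ) := rfl

/-- On tempered distributions that come from Schwartz functions, the two definitions agree. -/
lemma transl_coe {d : ℕ} (h : ℝ) (ξ : Phase d) (ψ : 𝓢(Config d, ℂ)) :
    transl h ξ (ψ : 𝓢'(Config d, ℂ)) = (translS h ξ ψ : 𝓢'(Config d, ℂ)) := by
  ext φ
  rw [transl_apply, SchwartzMap.coe_apply, SchwartzMap.coe_apply,
    ← integral_sub_right_eq_self _ ξ.1]
  refine integral_congr_ae (Eventually.of_forall fun q => ?_)
  simp only [translS_apply, smul_eq_mul, sub_neg_eq_add, sub_add_cancel]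
  have : phaseFactor h (-ξ.1, ξ.2) (q - ξ.1) = phaseFactor h ξ q := by
    simp only [phaseFactor, inner_sub_right, inner_neg_left, real_inner_comm ξ.2 ξ.1]
    congr 3
    ring
  rw [this]
  ring

/-! ### The Hilbert spaces of the torus -/

/-- `𝓗_ħ(κ)`: the tempered distributions `T` with
`U_ħ(n) T = exp (i ω(κ, n) + i n_q · n_p / (2 ħ)) T` for all `n ∈ ℤ^{2d}`. -/
def hilb {d : ℕ} (N : ℕ+) (κ : Phase d) : Submodule ℂ 𝓢'(Config d, ℂ) where
  carrier := {T | ∀ n : (Fin d → ℤ) × (Fin d → ℤ), transl (hbar N) (intPhase n) T =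
    Complex.exp (Complex.I *
      (symp κ (intPhase n) + inner ℝ (intVec n.1) (intVec n.2) / (2 * hbar N) : ℝ)) • T}
  add_mem' {S T} hS hT n := by rw [map_add, hS n, hT n, smul_add]
  zero_mem' n := by rw [map_zero, smul_zero]
  smul_mem' c T hT n := by rw [map_smul, hT n, smul_comm]

/-- The basis of `𝓗_ħ(κ)`, indexed by `r ∈ {0, …, N - 1}^d`:
`ψ_r^κ = N^{-d/2} ∑_{k ∈ ℤ^d} exp (i κ_p · k) δ_{k + r/N + κ_q/(2πN)}`
(the series converges in the space of tempered distributions). -/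
def basisVec {d : ℕ} (N : ℕ+) (κ : Phase d) (r : Fin d → Fin (N : ℕ)) : 𝓢'(Config d, ℂ) :=
  ((((N : ℝ) ^ (-(d : ℝ) / 2) : ℝ)) : ℂ) • ∑' k : Fin d → ℤ,
    Complex.exp (Complex.I * (inner ℝ κ.2 (intVec k) : ℝ)) •
      TemperedDistribution.delta
        (intVec k + (N : ℝ)⁻¹ • intVec (fun j => ((r j : ℕ) : ℤ))
          + (2 * Real.pi * (N : ℝ))⁻¹ • κ.1)

/-- The coordinates of an element of `𝓗_ħ(κ)` in the basis `ψ_r^κ`: a right inverse of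
`c ↦ ∑ r, c r • ψ_r^κ`. -/
def coords {d : ℕ} (N : ℕ+) (κ : Phase d) (T : 𝓢'(Config d, ℂ)) :
    EuclideanSpace ℂ (Fin d → Fin (N : ℕ)) :=
  Function.invFun
    (fun c : EuclideanSpace ℂ (Fin d → Fin (N : ℕ)) => ∑ r, c r • basisVec N κ r) T

/-- The scalar product of `𝓗_ħ(κ)` that makes the basis `ψ_r^κ` orthonormal
(antilinear in the first argument). -/
def hInner {d : ℕ} (N : ℕ+) (κ : Phase d) (S T : 𝓢'(Config d, ℂ)) : ℂ :=
  inner ℂ (coords N κ S) (coords N κ T)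

/-- The norm of `𝓗_ħ(κ)`. -/
def hNorm {d : ℕ} (N : ℕ+) (κ : Phase d) (T : 𝓢'(Config d, ℂ)) : ℝ := ‖coords N κ T‖

/-! ### Functions on the torus and their Weyl quantization -/

/-- `f ∈ C^∞(𝕋^{2d})`, as a smooth `ℤ^{2d}`-periodic function on `ℝ^{2d}`. -/
def TorusSmooth {d : ℕ} {F : Type*} [NormedAddCommGroup F] [NormedSpace ℝ F]
    (f : Phase d → F) : Prop :=
  ContDiff ℝ ∞ f ∧ ∀ (x : Phase d) (n : (Fin d → ℤ) × (Fin d → ℤ)), f (x + intPhase n) = f x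

/-- The fundamental domain `[0,1)^{2d}` of the torus. -/
def cube (d : ℕ) : Set (Phase d) :=
  {x | ∀ j, x.1 j ∈ Set.Ico (0 : ℝ) 1 ∧ x.2 j ∈ Set.Ico (0 : ℝ) 1}

/-- The symplectic Fourier transform on the torus, `ξ ↦ ∫_{𝕋^{2d}} exp (i ω(ξ, x)) f(x) dx`. -/
def sympFourier {d : ℕ} (f : Phase d → ℂ) (ξ : Phase d) : ℂ :=
  ∫ x in cube d, Complex.exp (Complex.I * (symp ξ x : ℝ)) * f x

/-- The Weyl quantization of `f ∈ C^∞(𝕋^{2d})`,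
`Op^W(f) T = ∑_{n ∈ ℤ^{2d}} (𝓕 f)(2 π n) U_ħ(ħ 2 π n) T`; here `ħ 2 π n = n / N`. -/
def opW {d : ℕ} (N : ℕ+) (f : Phase d → ℂ) (T : 𝓢'(Config d, ℂ)) : 𝓢'(Config d, ℂ) :=
  ∑' n : (Fin d → ℤ) × (Fin d → ℤ),
    sympFourier f ((2 * Real.pi) • intPhase n) •
      transl (hbar N) (hbar N • ((2 * Real.pi) • intPhase n)) T

/-! ### Coherent states -/

/-- The Gaussian `η_ħ(q) = (π ħ)^{-d/4} exp (-|q|² / (2 ħ))`, i.e. `ħ^{-d/4} η(q / ħ^{1/2})` with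
`η(q) = π^{-d/4} exp (-|q|² / 2)`. -/
def gaussian (d : ℕ) (N : ℕ+) (q : Config d) : ℂ :=
  (((Real.pi * hbar N) ^ (-(d : ℝ) / 4) * Real.exp (-‖q‖ ^ 2 / (2 * hbar N)) : ℝ) : ℂ)

lemma hasTemperateGrowth_gaussian (d : ℕ) (N : ℕ+) : (gaussian d N).HasTemperateGrowth := by
  have h1 : (fun q : Config d => ‖q‖ ^ 2).HasTemperateGrowth :=
    Function.hasTemperateGrowth_norm_sq (Config d)
  have h2 := hasTemperateGrowth_cexp (((-(1 / (2 * hbar N)) : ℝ)) : ℂ) h1 (fun x => by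
    have := hbar_pos N
    rw [Complex.ofReal_re]
    exact mul_nonpos_of_nonpos_of_nonneg (by simp [this.le]) (by positivity))
  have h3 := (Function.HasTemperateGrowth.const (E := Config d)
    ((((Real.pi * hbar N) ^ (-(d : ℝ) / 4) : ℝ)) : ℂ)).mul h2
  have h4 : gaussian d N = (fun _ => ((((Real.pi * hbar N) ^ (-(d : ℝ) / 4) : ℝ)) : ℂ)) *
      fun q : Config d =>
        Complex.exp (((-(1 / (2 * hbar N)) : ℝ) : ℂ) * ((‖q‖ ^ 2 : ℝ) : ℂ)) := by
    funext q
    simp only [gaussian, Pi.mul_apply, Complex.ofReal_mul, Complex.ofReal_exp]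
    congr 2
    push_cast
    ring
  rw [h4]
  exact h3

/-- `η_ħ` as a tempered distribution. -/
def gaussianDist (d : ℕ) (N : ℕ+) : 𝓢'(Config d, ℂ) :=
  (hasTemperateGrowth_gaussian d N).toTemperedDistribution volume

/-- `S_ħ(κ) = (∑_{n_p} exp (-i κ_q · n_p) U_ħ(0, n_p)) (∑_{n_q} exp (i κ_p · n_q) U_ħ(n_q, 0))`,
the sums being over `ℤ^d`; the series converge on Schwartz functions, in the space of tempered
distributions. -/
def project {d : ℕ} (N : ℕ+) (κ : Phase d) (T : 𝓢'(Config d, ℂ)) : 𝓢'(Config d, ℂ) :=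
  ∑' n : Fin d → ℤ, Complex.exp (-Complex.I * (inner ℝ κ.1 (intVec n) : ℝ)) •
    transl (hbar N) (0, intVec n)
      (∑' m : Fin d → ℤ, Complex.exp (Complex.I * (inner ℝ κ.2 (intVec m) : ℝ)) •
        transl (hbar N) (intVec m, 0) T)

/-- The coherent state `η^a_{ħ,κ} = S_ħ(κ) U_ħ(a) η_ħ` on the torus. -/
def coherent {d : ℕ} (N : ℕ+) (κ : Phase d) (a : Phase d) : 𝓢'(Config d, ℂ) :=
  project N κ (transl (hbar N) a (gaussianDist d N))

/-- The coordinates, in the orthonormal basis `ψ_r^κ`, of the restricted superposition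
`(2 π ħ)^{-d} ∫_{𝕋^{2d}} χ(a) ⟨η^a_{ħ,κ}, T⟩ η^a_{ħ,κ} da`. -/
def superposition {d : ℕ} (N : ℕ+) (κ : Phase d) (χ : Phase d → ℝ) (T : 𝓢'(Config d, ℂ)) :
    EuclideanSpace ℂ (Fin d → Fin (N : ℕ)) :=
  ((2 * Real.pi * hbar N) ^ d)⁻¹ • ∫ a in cube d,
    ((χ a : ℂ) * hInner N κ (coherent N κ a) T) • coords N κ (coherent N κ a)

/-! ### The two properties -/

/-- `⟨Ψ_ħ, Op^W(f) Ψ_ħ⟩ → f(0)` for all `f ∈ C^∞(𝕋^{2d})`. -/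
def ConcentratesAtZero {d : ℕ} (κ : ℕ+ → Phase d) (Ψ : ℕ+ → 𝓢'(Config d, ℂ)) : Prop :=
  ∀ f : Phase d → ℂ, TorusSmooth f →
    Tendsto (fun N => hInner N (κ N) (Ψ N) (opW N f (Ψ N))) atTop (𝓝 (f 0))

/-- `r_ħ → 0` are positive numbers, and `χ_ħ ∈ C^∞(𝕋^{2d})`, `0 ≤ χ_ħ ≤ 1`, is supported in the
ball of radius `r_ħ` of the torus (for the Euclidean distance) centred at `0`. -/
structure IsCutoffFamily {d : ℕ} (r : ℕ+ → ℝ) (χ : ℕ+ → Phase d → ℝ) : Prop where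
  pos : ∀ N, 0 < r N
  tendsto : Tendsto r atTop (𝓝 0)
  smooth : ∀ N, TorusSmooth (χ N)
  nonneg : ∀ N a, 0 ≤ χ N a
  le_one : ∀ N a, χ N a ≤ 1
  support : ∀ N a, χ N a ≠ 0 → ∃ n : (Fin d → ℤ) × (Fin d → ℤ),
    ‖a.1 - intVec n.1‖ ^ 2 + ‖a.2 - intVec n.2‖ ^ 2 ≤ r N ^ 2

/-- `‖Ψ_ħ - (2 π ħ)^{-d} ∫ χ_ħ(a) ⟨η^a_{ħ,κ}, Ψ_ħ⟩ η^a_{ħ,κ} da‖ → 0`. -/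
def ApproxBySuperposition {d : ℕ} (κ : ℕ+ → Phase d) (Ψ : ℕ+ → 𝓢'(Config d, ℂ))
    (χ : ℕ+ → Phase d → ℝ) : Prop :=
  Tendsto (fun N => ‖coords N (κ N) (Ψ N) - superposition N (κ N) (χ N) (Ψ N)‖) atTop (𝓝 0)

end TorusQuantum

end

open TorusQuantum

/-! Everything is read off the Husimi density `husimi`, a ↦ N^d |⟨η^a, c⟩|², of the coordinate
vector c of Ψ. It is a nonnegative function on the torus, and two facts about it suffice.

Anti-Wick identity (`integral_char_mul_normSq_overlap`, `integral_char_mul_husimi`): integrating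
exp(-2πi ω(n, a)) against the Husimi density gives exp(-π|n|²/(2N)) ⟨c, U(n/N) c⟩. Integration over
the momentum a_p leaves only pairs of nodes that differ by n_q. Quasi-periodicity then unfolds the
integral over a_q in the unit cube to a Gaussian integral over ℝ^d. For n = 0 the total mass is
‖c‖², and polarization turns this into the resolution of the identity `superpose_one`. Summation
against the Fourier coefficients of f shows that the Weyl expectation of f and ∫ f · husimi differ
by at most ‖c‖² `quantError f N`, which tends to 0 for bounded families. So (A) says that ∫ f ·
husimi → f(0).

Error estimates: by the resolution of the identity, u = c - `superpose` χ c is the superposition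
with weight 1 - χ. Hence ‖u‖² ≤ ∫ (1 - χ)² husimi (`norm_sub_superpose_sq_le`) and ∫ (1 - χ) husimi
≤ ‖c‖ ‖u‖ (`integral_one_sub_mul_husimi_le`).

For part 1, test (A) with (1 - χ)² for fixed cutoffs χ with χ(0) = 1: the error tends to 0 for each
of them, and a diagonal choice lets the radius shrink. For part 2, the second estimate shows that
the Husimi mass outside the shrinking balls vanishes while the total mass tends to 1, so continuity
of f at 0 finishes.

The remaining work carries the distributional definitions over to coordinates. A combination of the
basis vectors is a sum of Dirac masses at the points `node` with quasi-periodic weights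
(`synth_apply`). On these weights U(n/N) is a shift times a phase (`transl_synth`), and Poisson
summation evaluates the projector defining the coherent states (`project_coe`). Fourier expansion
shows that every element of the Hilbert space is such a combination (`exists_eq_synth`). -/

noncomputable section

namespace TorusQuantum

/-! ### Lattice sums of Schwartz functions -/

section Lattice

variable {ι : Type*}

/-- An integer vector as a point of `ℝ^ι`. -/
def latVec (n : ι → ℤ) : EuclideanSpace ℝ ι := WithLp.toLp 2 fun j => (n j : ℝ)

@[simp] lemma latVec_apply (n : ι → ℤ) (j : ι) : latVec n j = n j := rfl

lemma latVec_add (m n : ι → ℤ) : latVec (m + n) = latVec m + latVec n := by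
  ext j; simp

lemma latVec_neg (m : ι → ℤ) : latVec (-m) = -latVec m := by
  ext j; simp

lemma latVec_sub (m n : ι → ℤ) : latVec (m - n) = latVec m - latVec n := by
  ext j; simp

@[simp] lemma latVec_zero : latVec (0 : ι → ℤ) = 0 := by
  ext j; simp

lemma latVec_injective : Function.Injective (latVec (ι := ι)) := by
  intro m n h
  funext j
  have := congrArg (fun v => v j) h
  simpa using this

variable [Fintype ι]

/-- The decay weight `(1 + |n|)^{-M}` on the lattice. -/
def weight (M : ℕ) (n : ι → ℤ) : ℝ := ((1 + ‖latVec n‖) ^ M)⁻¹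

lemma weight_nonneg (M : ℕ) (n : ι → ℤ) : 0 ≤ weight M n := by
  unfold weight; positivity

variable (ι) in
-- Inverse powers of the norm beyond the rank are summable over a ℤ-lattice, here the span of the
-- standard basis.
lemma exists_summable_weight : ∃ M, Summable (weight (ι := ι) M) := by
  classical
  let b := (EuclideanSpace.basisFun ι ℝ).toBasis
  let L := Submodule.span ℤ (Set.range b)
  have hmem (n : ι → ℤ) : latVec n ∈ L := by
    have : latVec n = ∑ i, n i • b i := by
      ext j
      simp [b, Finset.sum_apply, Pi.single_apply]
    rw [this]
    exact Submodule.sum_mem _ fun i _ => Submodule.smul_mem _ _ (Submodule.subset_span ⟨i, rfl⟩)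
  let M := Module.finrank ℤ L + 1
  have h1 := ZLattice.summable_norm_pow_inv L M (Nat.lt_succ_self _)
  have hinj : Function.Injective fun n : ι → ℤ => (⟨latVec n, hmem n⟩ : L) := by
    intro m n h
    exact latVec_injective (congrArg Subtype.val h)
  have h2 := h1.comp_injective hinj
  -- At the origin the comparison term is 0 (inverse of 0) while the weight is 1, so the bound is
  -- claimed only off a finite set.
  refine ⟨M, h2.of_norm_bounded_eventually ?_⟩
  refine (Set.finite_singleton (0 : ι → ℤ)).subset fun n hn => ?_
  by_contra hne
  apply hn
  have hpos : 0 < ‖latVec n‖ := by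
    rw [norm_pos_iff]
    intro h
    exact hne (latVec_injective (h.trans latVec_zero.symm))
  change ‖weight M n‖ ≤ _
  rw [Real.norm_of_nonneg (weight_nonneg _ _)]
  simp only [weight, Function.comp_apply, inv_pow]
  gcongr
  · simp

/-- Peetre's inequality for the decay weight. -/
lemma inv_le_mul_weight (M : ℕ) (n : ι → ℤ) (x : EuclideanSpace ℝ ι) :
    ((1 + ‖latVec n + x‖) ^ M)⁻¹ ≤ (1 + ‖x‖) ^ M * weight M n := by
  have h : 1 + ‖latVec n‖ ≤ (1 + ‖x‖) * (1 + ‖latVec n + x‖) := by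
    have : ‖latVec n‖ ≤ ‖latVec n + x‖ + ‖x‖ := by
      simpa using norm_sub_le (latVec n + x) x
    nlinarith [norm_nonneg x, norm_nonneg (latVec n + x)]
  unfold weight
  rw [inv_le_iff_one_le_mul₀ (by positivity), mul_right_comm, ← mul_pow]
  rw [← div_eq_mul_inv, one_le_div (by positivity)]
  gcongr

end Lattice

/-! ### Decay of Schwartz functions and convergent series in the Schwartz space -/

section Decay

variable {E : Type*} [NormedAddCommGroup E] [NormedSpace ℝ E]

/-- Uniform decay of the derivatives up to order `n` of a Schwartz function. -/
lemma exists_decay (φ : 𝓢(E, ℂ)) (M n : ℕ) :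
    ∃ A, 0 ≤ A ∧ ∀ i ≤ n, ∀ x, ‖iteratedFDeriv ℝ i φ x‖ ≤ A * ((1 + ‖x‖) ^ M)⁻¹ := by
  refine ⟨2 ^ M * (Finset.Iic (M, n)).sup (schwartzSeminormFamily ℂ E ℂ) φ, by positivity,
    fun i hi x => ?_⟩
  rw [← div_eq_mul_inv, le_div_iff₀ (by positivity), mul_comm]
  exact one_add_le_sup_seminorm_apply (𝕜 := ℂ) (m := (M, n)) le_rfl hi φ x

/-- The constant is a fixed continuous seminorm of φ, as is needed to bound distributions uniformly
in the test function. -/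
lemma norm_le_sup_seminorm_mul (φ : 𝓢(E, ℂ)) (M : ℕ) (x : E) :
    ‖φ x‖ ≤ 2 ^ M * (Finset.Iic (M, 0)).sup (schwartzSeminormFamily ℂ E ℂ) φ *
      ((1 + ‖x‖) ^ M)⁻¹ := by
  rw [← div_eq_mul_inv, le_div_iff₀ (by positivity), mul_comm]
  have := one_add_le_sup_seminorm_apply (𝕜 := ℂ) (m := (M, 0)) le_rfl le_rfl φ x
  rwa [norm_iteratedFDeriv_zero] at this

/-- A series of Schwartz functions whose seminorms are summable converges in `𝓢`. -/
lemma exists_hasSum_schwartz {α : Type*} (f : α → 𝓢(E, ℂ))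
    (hf : ∀ k n, Summable fun i => SchwartzMap.seminorm ℂ k n (f i)) :
    ∃ G : 𝓢(E, ℂ), HasSum f G ∧ ∀ x, HasSum (fun i => f i x) (G x) := by
  have hbd (k n : ℕ) (i : α) (x : E) :
      ‖x‖ ^ k * ‖iteratedFDeriv ℝ n (f i) x‖ ≤ SchwartzMap.seminorm ℂ k n (f i) :=
    SchwartzMap.le_seminorm ℂ k n (f i) x
  have hsm (i : α) : ContDiff ℝ ∞ (f i) := (f i).smooth'
  have hv : ∀ k : ℕ, (k : ℕ∞) ≤ (⊤ : ℕ∞) →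
      Summable fun i => SchwartzMap.seminorm ℂ 0 k (f i) := fun k _ => hf 0 k
  have h'f : ∀ (k : ℕ) (i : α) (x : E), (k : ℕ∞) ≤ (⊤ : ℕ∞) →
      ‖iteratedFDeriv ℝ k (f i) x‖ ≤ SchwartzMap.seminorm ℂ 0 k (f i) := by
    intro k i x _
    simpa using hbd 0 k i x
  have hder (n : ℕ) (x : E) := iteratedFDeriv_tsum_apply hsm hv h'f (k := n) (mod_cast le_top) x
  have hsumder (n : ℕ) (x : E) : Summable fun i => iteratedFDeriv ℝ n (f i) x :=
    Summable.of_norm_bounded (hf 0 n) fun i => h'f n i x (mod_cast le_top)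
  let G : 𝓢(E, ℂ) :=
    { toFun := fun x => ∑' i, f i x
      smooth' := contDiff_tsum hsm hv h'f
      decay' := by
        intro k n
        refine ⟨∑' i, SchwartzMap.seminorm ℂ k n (f i), fun x => ?_⟩
        rw [hder n x]
        have h1 : ‖∑' i, iteratedFDeriv ℝ n (f i) x‖ ≤ ∑' i, ‖iteratedFDeriv ℝ n (f i) x‖ :=
          norm_tsum_le_tsum_norm (Summable.of_nonneg_of_le (fun _ => norm_nonneg _)
            (fun i => h'f n i x (mod_cast le_top)) (hf 0 n))
        calc _ ≤ ‖x‖ ^ k * ∑' i, ‖iteratedFDeriv ℝ n (f i) x‖ := by gcongr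
          _ = ∑' i, ‖x‖ ^ k * ‖iteratedFDeriv ℝ n (f i) x‖ := by rw [tsum_mul_left]
          _ ≤ _ := by
            refine Summable.tsum_le_tsum (fun i => hbd k n i x) ?_ (hf k n)
            exact Summable.of_nonneg_of_le (fun _ => by positivity) (fun i => hbd k n i x)
              (hf k n) }
  have hG (x : E) : G x = ∑' i, f i x := rfl
  have hpt (x : E) : HasSum (fun i => f i x) (G x) := by
    rw [hG]
    refine (Summable.of_norm_bounded (hf 0 0) fun i => ?_).hasSum
    simpa using hbd 0 0 i x
  refine ⟨G, ?_, hpt⟩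
  have hws := schwartz_withSeminorms ℂ E ℂ
  rw [HasSum, SummationFilter.unconditional_filter, hws.tendsto_nhds]
  -- Derivatives pass through the sum, so the (k, n) seminorm of the remainder is at most the tail
  -- of the series of seminorms.
  rintro ⟨k, n⟩ ε hε
  have htail : Tendsto (fun s : Finset α => ∑' i : { x // x ∉ s },
      SchwartzMap.seminorm ℂ k n (f i)) atTop (𝓝 0) :=
    tendsto_tsum_compl_atTop_zero fun i => SchwartzMap.seminorm ℂ k n (f i)
  filter_upwards [htail.eventually (gt_mem_nhds hε)] with s hs
  refine lt_of_le_of_lt ?_ hs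
  change SchwartzMap.seminorm ℂ k n _ ≤ _
  rw [map_sub_rev]
  refine SchwartzMap.seminorm_le_bound ℂ k n _ (tsum_nonneg fun _ => apply_nonneg _ _)
    fun x => ?_
  have h1 : iteratedFDeriv ℝ n (⇑(G - ∑ i ∈ s, f i)) x =
      ∑' i : { x // x ∉ s }, iteratedFDeriv ℝ n (f i) x := by
    have hfun : (⇑(G - ∑ i ∈ s, f i) : E → ℂ) = fun x => G x - (∑ i ∈ s, f i x) := by
      funext y; simp
    rw [hfun]
    have e1 : iteratedFDeriv ℝ n (fun x => G x - ∑ i ∈ s, f i x) x =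
        iteratedFDeriv ℝ n G x - iteratedFDeriv ℝ n (fun x => ∑ i ∈ s, f i x) x := by
      have := iteratedFDeriv_sub_apply (𝕜 := ℝ) (i := n) (x := x) (f := G)
        (g := fun x => ∑ i ∈ s, f i x) (G.smooth n).contDiffAt
        (ContDiff.sum fun i _ => (f i).smooth n).contDiffAt
      exact this
    have e2 : iteratedFDeriv ℝ n (fun x => ∑ i ∈ s, f i x) x =
        ∑ i ∈ s, iteratedFDeriv ℝ n (f i) x := by
      exact iteratedFDeriv_fun_sum_apply fun i _ => ((f i).smooth n).contDiffAt
    have e3 : iteratedFDeriv ℝ n G x = ∑' i, iteratedFDeriv ℝ n (f i) x := hder n x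
    rw [e1, e2, e3, ← (hsumder n x).sum_add_tsum_compl (s := s), add_sub_cancel_left]
    rfl
  rw [h1]
  have hsub (g : α → ℝ) (hg : Summable g) : Summable fun i : { x // x ∉ s } => g i :=
    hg.subtype _
  have h2 : ‖∑' i : { x // x ∉ s }, iteratedFDeriv ℝ n (f i) x‖ ≤
      ∑' i : { x // x ∉ s }, ‖iteratedFDeriv ℝ n (f i) x‖ :=
    norm_tsum_le_tsum_norm (hsub _ (Summable.of_nonneg_of_le (fun _ => norm_nonneg _)
            (fun i => h'f n i x (mod_cast le_top)) (hf 0 n)))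
  calc _ ≤ ‖x‖ ^ k * ∑' i : { x // x ∉ s }, ‖iteratedFDeriv ℝ n (f i) x‖ := by gcongr
    _ = ∑' i : { x // x ∉ s }, ‖x‖ ^ k * ‖iteratedFDeriv ℝ n (f i) x‖ := by rw [tsum_mul_left]
    _ ≤ ∑' i : { x // x ∉ s }, SchwartzMap.seminorm ℂ k n (f i) := by
      have hk := hsub (fun i => SchwartzMap.seminorm ℂ k n (f i)) (hf k n)
      refine Summable.tsum_le_tsum (fun i => hbd k n i x) ?_ hk
      exact Summable.of_nonneg_of_le (fun _ => by positivity) (fun i => hbd k n i x) hk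

end Decay

/-! ### Products with lattice translates -/

section Products

/-- The pointwise product of Schwartz functions. -/
def mulS {E : Type*} [NormedAddCommGroup E] [NormedSpace ℝ E] (θ φ : 𝓢(E, ℂ)) : 𝓢(E, ℂ) :=
  SchwartzMap.smulLeftCLM ℂ θ φ

lemma mulS_apply {E : Type*} [NormedAddCommGroup E] [NormedSpace ℝ E] (θ φ : 𝓢(E, ℂ)) (x : E) :
    mulS θ φ x = θ x * φ x := by
  simp [mulS, SchwartzMap.smulLeftCLM_apply_apply θ.hasTemperateGrowth]

variable {ι : Type*} [Fintype ι]

/-- Multiplying `φ` by the lattice translates of `θ` gives a convergent series in `𝓢`. -/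
lemma exists_hasSum_translates (θ φ : 𝓢(EuclideanSpace ℝ ι, ℂ)) (u : (ι → ℤ) → ℂ)
    (hu : ∀ m, ‖u m‖ ≤ 1) :
    ∃ G : 𝓢(EuclideanSpace ℝ ι, ℂ),
      HasSum (fun m => u m • mulS (SchwartzMap.compSubConstCLM ℂ (latVec m) θ) φ) G ∧
      ∀ x, HasSum (fun m => u m * (θ (x - latVec m) * φ x)) (G x) := by
  obtain ⟨M, hM⟩ := exists_summable_weight ι
  have key : ∀ k n, Summable fun m => SchwartzMap.seminorm ℂ k n
      (u m • mulS (SchwartzMap.compSubConstCLM ℂ (latVec m) θ) φ) := by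
    intro k n
    obtain ⟨A, hA, hθ⟩ := exists_decay θ M n
    -- Peetre's inequality trades the decay of the translate of θ for `weight M m` at the cost of (1
    -- + |x|)^M; order M + k for φ pays for this and for the factor |x|^k.
    obtain ⟨B, hB, hφ⟩ := exists_decay φ (M + k) n
    refine Summable.of_nonneg_of_le (fun _ => apply_nonneg _ _) (fun m => ?_)
      (hM.mul_left (∑ i ∈ Finset.range (n + 1), (n.choose i : ℝ) * (A * B)))
    rw [map_smul_eq_mul]
    refine (mul_le_of_le_one_left (apply_nonneg _ _) (hu m)).trans ?_
    refine SchwartzMap.seminorm_le_bound ℂ k n _ ?_ fun x => ?_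
    · have := weight_nonneg M m
      positivity
    have hfun : (⇑(mulS (SchwartzMap.compSubConstCLM ℂ (latVec m) θ) φ) :
        EuclideanSpace ℝ ι → ℂ) = fun x => θ (x - latVec m) * φ x := by
      funext y; simp [mulS_apply]
    rw [hfun]
    have hmul := norm_iteratedFDeriv_mul_le (𝕜 := ℝ) (n := n) (N := n)
      (f := fun x => θ (x - latVec m)) (g := φ)
      ((θ.smooth n).comp (contDiff_id.sub contDiff_const)) (φ.smooth n) x le_rfl
    refine (mul_le_mul_of_nonneg_left hmul (by positivity)).trans ?_
    rw [Finset.mul_sum, Finset.sum_mul]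
    refine Finset.sum_le_sum fun i hi => ?_
    have hi' : i ≤ n := Nat.lt_succ_iff.mp (Finset.mem_range.mp hi)
    have e1 : iteratedFDeriv ℝ i (fun x => θ (x - latVec m)) x =
        iteratedFDeriv ℝ i θ (x - latVec m) := iteratedFDeriv_comp_sub i (latVec m) x
    rw [e1]
    have h1 := hθ i hi' (x - latVec m)
    have h2 := hφ (n - i) (Nat.sub_le _ _) x
    have h3 : ((1 + ‖x - latVec m‖) ^ M)⁻¹ ≤ (1 + ‖x‖) ^ M * weight M m := by
      have := inv_le_mul_weight M m (-x)
      rwa [norm_neg, ← sub_eq_add_neg, norm_sub_rev] at this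
    have h4 : ‖x‖ ^ k ≤ (1 + ‖x‖) ^ k := by gcongr; linarith [norm_nonneg x]
    have hw := weight_nonneg M m
    calc ‖x‖ ^ k * (↑(n.choose i) * ‖iteratedFDeriv ℝ i (⇑θ) (x - latVec m)‖ *
            ‖iteratedFDeriv ℝ (n - i) (⇑φ) x‖)
        ≤ (1 + ‖x‖) ^ k * (↑(n.choose i) * (A * ((1 + ‖x‖) ^ M * weight M m)) *
            (B * ((1 + ‖x‖) ^ (M + k))⁻¹)) := by
          gcongr
          exact h1.trans (by gcongr)
      _ = ↑(n.choose i) * (A * B) * weight M m := by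
          have : (1 + ‖x‖) ≠ 0 := by positivity
          rw [pow_add]
          field_simp
  obtain ⟨G, hG, hG'⟩ := exists_hasSum_schwartz _ key
  refine ⟨G, hG, fun x => ?_⟩
  simpa [mulS_apply] using hG' x

end Products

/-! ### Series of tempered distributions -/

section Distributions

variable {E : Type*} [NormedAddCommGroup E] [NormedSpace ℝ E]

lemma hasSum_tempered {α : Type*} {f : α → 𝓢'(E, ℂ)} {S : 𝓢'(E, ℂ)} :
    HasSum f S ↔ ∀ φ, HasSum (fun i => f i φ) (S φ) := by
  simp only [HasSum, PointwiseConvergenceCLM.tendsto_iff_forall_tendsto]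
  refine forall_congr' fun φ => ?_
  have : (fun s : Finset α => (∑ i ∈ s, f i) φ) = fun s => ∑ i ∈ s, f i φ := by
    funext s
    exact map_sum (PointwiseConvergenceCLM.evalCLM (RingHom.id ℂ) ℂ φ) f s
  rw [this]

/-- A pointwise sum of tempered distributions, with summable bounds by a fixed seminorm, is a
tempered distribution. -/
lemma exists_tempered_of_bound {α : Type*} (f : α → 𝓢'(E, ℂ)) (w : α → ℝ) (hw : Summable w)
    (s : Finset (ℕ × ℕ))
    (hf : ∀ i φ, ‖f i φ‖ ≤ w i * s.sup (schwartzSeminormFamily ℂ E ℂ) φ) :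
    ∃ S : 𝓢'(E, ℂ), HasSum f S := by
  have hs (φ : 𝓢(E, ℂ)) : Summable fun i => f i φ :=
    Summable.of_norm_bounded (hw.mul_right _) fun i => hf i φ
  have hs' (φ : 𝓢(E, ℂ)) : Summable fun i => ‖f i φ‖ :=
    Summable.of_nonneg_of_le (fun _ => norm_nonneg _) (fun i => hf i φ) (hw.mul_right _)
  -- The norms of the `w i` are summed because the constant must be nonnegative and `w` has no
  -- assumed sign.
  have hb (φ : 𝓢(E, ℂ)) : ‖∑' i, f i φ‖ ≤
      (∑' i, ‖w i‖) * s.sup (schwartzSeminormFamily ℂ E ℂ) φ := by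
    rw [← tsum_mul_right]
    refine (norm_tsum_le_tsum_norm (hs' φ)).trans
      (Summable.tsum_le_tsum (fun i => (hf i φ).trans ?_) (hs' φ) (hw.norm.mul_right _))
    gcongr
    exact Real.le_norm_self _
  let S : 𝓢(E, ℂ) →L[ℂ] ℂ := SchwartzMap.mkCLMtoNormedSpace (fun φ => ∑' i, f i φ)
    (fun φ ψ => by
      rw [← (hs φ).tsum_add (hs ψ)]
      exact tsum_congr fun i => map_add _ _ _)
    (fun a φ => by
      rw [RingHom.id_apply, smul_eq_mul, ← tsum_mul_left]
      exact tsum_congr fun i => map_smul _ _ _)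
    ⟨s, _, tsum_nonneg fun _ => norm_nonneg _, hb⟩
  exact ⟨S, hasSum_tempered.mpr fun φ => (hs φ).hasSum⟩

end Distributions

/-! ### The character `t ↦ exp (2 π i t)` -/

/-- `ec t = exp (2 π i t)`. -/
def ec (t : ℝ) : ℂ := Complex.exp (((2 * Real.pi * t : ℝ) : ℂ) * Complex.I)

lemma ec_add (s t : ℝ) : ec (s + t) = ec s * ec t := by
  rw [ec, ec, ec, ← Complex.exp_add]; congr 1; push_cast; ring

@[simp] lemma ec_zero : ec 0 = 1 := by simp [ec]

@[simp] lemma norm_ec (t : ℝ) : ‖ec t‖ = 1 := Complex.norm_exp_ofReal_mul_I _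

lemma ec_neg (t : ℝ) : ec (-t) = (ec t)⁻¹ := by
  rw [ec, ec, ← Complex.exp_neg]; congr 1; push_cast; ring

lemma ec_sub (s t : ℝ) : ec (s - t) = ec s * ec (-t) := by rw [sub_eq_add_neg, ec_add]

lemma ec_ne_zero (t : ℝ) : ec t ≠ 0 := Complex.exp_ne_zero _

lemma conj_ec (t : ℝ) : (starRingEnd ℂ) (ec t) = ec (-t) := by
  rw [ec, ec, ← Complex.exp_conj]; congr 1; simp [-Complex.ofReal_mul]

@[simp] lemma ec_intCast (n : ℤ) : ec n = 1 := by
  rw [ec, Complex.exp_eq_one_iff]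
  exact ⟨n, by push_cast; ring⟩

lemma ec_eq_of_sub_int {s t : ℝ} (n : ℤ) (h : s = t + n) : ec s = ec t := by
  rw [h, ec_add, ec_intCast, mul_one]

@[fun_prop] lemma continuous_ec : Continuous ec := by unfold ec; fun_prop

lemma ec_eq_fourierChar (t : ℝ) : ec t = (Real.fourierChar t : ℂ) := by
  rw [ec, Real.fourierChar_apply]

lemma ec_sum {α : Type*} (s : Finset α) (f : α → ℝ) : ec (∑ i ∈ s, f i) = ∏ i ∈ s, ec (f i) := by
  classical
  induction s using Finset.induction_on with
  | empty => simp
  | insert a s ha ih => rw [Finset.sum_insert ha, Finset.prod_insert ha, ec_add, ih]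

/-! ### Fourier series of periodic functions on `ℝ^ι` -/

section Periodic

variable {ι : Type*} [Fintype ι]

lemma inner_latVec (n : ι → ℤ) (x : EuclideanSpace ℝ ι) :
    inner ℝ (latVec n) x = ∑ i, (n i : ℝ) * x i := by
  simp [PiLp.inner_apply, mul_comm]

lemma ec_inner_add_latVec (n m : ι → ℤ) (x : EuclideanSpace ℝ ι) :
    ec (inner ℝ (latVec n) (x + latVec m)) = ec (inner ℝ (latVec n) x) := by
  refine ec_eq_of_sub_int (∑ i, n i * m i) ?_
  rw [inner_add_right, inner_latVec n (latVec m)]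
  push_cast
  rfl

variable (ι) in
/-- The unit cube `[0,1)^ι`. -/
def unitCube : Set (EuclideanSpace ℝ ι) := {x | ∀ j, x j ∈ Set.Ico (0 : ℝ) 1}

lemma measurableSet_unitCube : MeasurableSet (unitCube ι) := by
  have : unitCube ι = ⋂ j, (fun x : EuclideanSpace ℝ ι => x j) ⁻¹' Set.Ico (0 : ℝ) 1 := by
    ext x; simp [unitCube]
  rw [this]
  exact MeasurableSet.iInter fun j => measurableSet_Ico.preimage (by fun_prop)

lemma norm_le_of_mem_unitCube {x : EuclideanSpace ℝ ι} (hx : x ∈ unitCube ι) :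
    ‖x‖ ≤ √(Fintype.card ι) := by
  rw [EuclideanSpace.norm_eq]
  refine Real.sqrt_le_sqrt ?_
  calc ∑ i, ‖x i‖ ^ 2 ≤ ∑ _i : ι, (1 : ℝ) := Finset.sum_le_sum fun i _ => by
        rw [Real.norm_of_nonneg (hx i).1]
        exact pow_le_one₀ (hx i).1 (hx i).2.le
    _ = _ := by simp

lemma unitCube_eq_preimage :
    unitCube ι = (MeasurableEquiv.toLp 2 (ι → ℝ)).symm ⁻¹' Set.univ.pi fun _ => Set.Ico 0 1 := by
  ext x; simp [unitCube]

lemma setIntegral_unitCube {F : Type*} [NormedAddCommGroup F] [NormedSpace ℝ F]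
    (f : EuclideanSpace ℝ ι → F) :
    ∫ x in unitCube ι, f x = ∫ x in Set.univ.pi (fun _ : ι => Set.Ico (0 : ℝ) 1),
      f (WithLp.toLp 2 x) := by
  rw [unitCube_eq_preimage, ← (PiLp.volume_preserving_ofLp ι).setIntegral_preimage_emb
    (MeasurableEquiv.toLp 2 (ι → ℝ)).symm.measurableEmbedding]
  rfl

lemma volume_unitCube : volume (unitCube ι) = 1 := by
  rw [unitCube_eq_preimage]
  have := (PiLp.volume_preserving_ofLp ι).measure_preimage
    (MeasurableSet.univ_pi fun _ : ι => measurableSet_Ico (a := (0 : ℝ)) (b := 1)).nullMeasurableSet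
  refine (this.trans ?_)
  simp [volume_pi_pi]

instance : IsProbabilityMeasure ((volume : Measure (EuclideanSpace ℝ ι)).restrict (unitCube ι)) :=
  ⟨by rw [Measure.restrict_apply_univ, volume_unitCube]⟩

/-- Passes to the half-open boxes on which integrals over `UnitAddTorus` are expressed; the two
cubes differ by a null set. -/
lemma setIntegral_unitCube_Ioc {F : Type*} [NormedAddCommGroup F] [NormedSpace ℝ F]
    (f : EuclideanSpace ℝ ι → F) :
    ∫ x in unitCube ι, f x = ∫ x in {x : ι → ℝ | ∀ i, x i ∈ Set.Ioc (0 : ℝ) (0 + 1)},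
      f (WithLp.toLp 2 x) := by
  rw [setIntegral_unitCube]
  refine setIntegral_congr_set ?_
  have h1 : (Set.univ.pi fun _ : ι => Set.Ico (0 : ℝ) 1) =ᵐ[volume] Set.Icc (fun _ => 0) fun _ => 1 :=
    Measure.univ_pi_Ico_ae_eq_Icc
  have h2 : (Set.univ.pi fun _ : ι => Set.Ioc (0 : ℝ) 1) =ᵐ[volume] Set.Icc (fun _ => 0) fun _ => 1 :=
    Measure.univ_pi_Ioc_ae_eq_Icc
  have h3 : {x : ι → ℝ | ∀ i, x i ∈ Set.Ioc (0 : ℝ) (0 + 1)} =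
      Set.univ.pi fun _ : ι => Set.Ioc (0 : ℝ) 1 := by
    ext x; simp
  rw [h3]
  exact h1.trans h2.symm

/-- The Fourier coefficients of a periodic function. -/
def cubeCoeff (F : EuclideanSpace ℝ ι → ℂ) (n : ι → ℤ) : ℂ :=
  ∫ x in unitCube ι, ec (-inner ℝ (latVec n) x) * F x

lemma mFourier_coe (n : ι → ℤ) (x : ι → ℝ) :
    UnitAddTorus.mFourier n (fun i => (x i : UnitAddCircle)) =
      ec (inner ℝ (latVec n) (WithLp.toLp 2 x)) := by
  rw [inner_latVec, ec_sum, UnitAddTorus.mFourier]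
  simp only [ContinuousMap.coe_mk]
  refine Finset.prod_congr rfl fun i _ => ?_
  rw [fourier_coe_apply, ec]
  congr 1
  push_cast
  ring

/-- Orthogonality of the characters on the unit cube. -/
lemma integral_unitCube_ec (n : ι → ℤ) :
    ∫ x in unitCube ι, ec (inner ℝ (latVec n) x) = if n = 0 then 1 else 0 := by
  have h := orthonormal_iff_ite.mp (UnitAddTorus.orthonormal_mFourier (d := ι)) 0 n
  simp only [UnitAddTorus.mFourierLp, ContinuousMap.inner_toLp, UnitAddTorus.mFourier_zero] at h
  rw [setIntegral_unitCube_Ioc, if_congr eq_comm rfl rfl, ← h]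
  refine Eq.trans ?_ (UnitAddTorus.integral_preimage _ fun _ => 0).symm
  refine integral_congr_ae (Eventually.of_forall fun x => ?_)
  simp [← mFourier_coe]

/-- A continuous periodic function with summable Fourier coefficients is the sum of its Fourier
series. -/
theorem hasSum_cubeCoeff {F : EuclideanSpace ℝ ι → ℂ} (hF : Continuous F)
    (hper : ∀ x m, F (x + latVec m) = F x) (hs : Summable (cubeCoeff F))
    (x : EuclideanSpace ℝ ι) :
    HasSum (fun n => cubeCoeff F n * ec (inner ℝ (latVec n) x)) (F x) := by
  -- F descends to the torus through representatives in [0, 1); continuity is checked after pulling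
  -- back along the open quotient map.
  let f₀ : UnitAddTorus ι → ℂ := fun t =>
    F (WithLp.toLp 2 fun i => ((AddCircle.equivIco 1 0 (t i) : ℝ)))
  have hf₀ (x : ι → ℝ) : f₀ (fun i => (x i : UnitAddCircle)) = F (WithLp.toLp 2 x) := by
    have : ∀ i, ∃ m : ℤ, x i = (AddCircle.equivIco 1 0 (x i : UnitAddCircle) : ℝ) + m := by
      intro i
      refine ⟨⌊x i⌋, ?_⟩
      rw [AddCircle.coe_equivIco_mk_apply]
      simp [Int.fract_add_floor]
    choose m hm using this
    have e : (WithLp.toLp 2 x : EuclideanSpace ℝ ι) =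
        (WithLp.toLp 2 fun i => ((AddCircle.equivIco 1 0 (x i : UnitAddCircle) : ℝ))) + latVec m := by
      ext i
      simpa using hm i
    rw [e, hper]
  have hcont : Continuous f₀ := by
    have hq : IsOpenQuotientMap (fun (x : ι → ℝ) (i : ι) => (x i : UnitAddCircle)) :=
      IsOpenQuotientMap.piMap fun _ => QuotientAddGroup.isOpenQuotientMap_mk
    rw [hq.isQuotientMap.continuous_iff]
    have : f₀ ∘ (fun (x : ι → ℝ) (i : ι) => (x i : UnitAddCircle)) =
        F ∘ WithLp.toLp 2 := funext hf₀
    rw [this]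
    exact hF.comp (PiLp.continuous_toLp 2 _)
  let f : C(UnitAddTorus ι, ℂ) := ⟨f₀, hcont⟩
  have hcoef : UnitAddTorus.mFourierCoeff f = cubeCoeff F := by
    funext n
    rw [UnitAddTorus.mFourierCoeff_eq_integral _ n fun _ => 0, cubeCoeff, setIntegral_unitCube_Ioc]
    refine integral_congr_ae (Eventually.of_forall fun x => ?_)
    simp only [smul_eq_mul]
    rw [mFourier_coe, latVec_neg, inner_neg_left]
    congr 1
    exact hf₀ x
  have := UnitAddTorus.hasSum_mFourier_series_apply_of_summable (f := f) (hcoef ▸ hs)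
    (fun i => (x i : UnitAddCircle))
  rw [hcoef] at this
  simp only [smul_eq_mul, mFourier_coe] at this
  convert this using 1
  exact (hf₀ x).symm

/-- The integral over `ℝ^ι` is the sum over the lattice of integrals over the unit cube. -/
theorem hasSum_integral_unitCube {F : EuclideanSpace ℝ ι → ℂ} (hF : Integrable F) :
    HasSum (fun m : ι → ℤ => ∫ x in unitCube ι, F (x + latVec m)) (∫ x, F x) := by
  classical
  let s : (ι → ℤ) → Set (EuclideanSpace ℝ ι) := fun m => (fun x => x + latVec (-m)) ⁻¹' unitCube ι
  -- The translated cubes are the fibres of the integer part, hence they partition the space.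
  have hmem (m : ι → ℤ) (x : EuclideanSpace ℝ ι) : x ∈ s m ↔ m = fun i => ⌊x i⌋ := by
    simp only [s, unitCube, Set.mem_preimage, Set.mem_ofPred_eq]
    constructor
    · intro h
      funext i
      have := h i
      simp at this
      symm
      rw [Int.floor_eq_iff]
      constructor <;> linarith [this.1, this.2]
    · rintro rfl j
      simp only [PiLp.add_apply, latVec_apply, Pi.neg_apply, Int.cast_neg, ← sub_eq_add_neg]
      exact ⟨Int.fract_nonneg (x j), Int.fract_lt_one (x j)⟩
  have hm : ∀ m, MeasurableSet (s m) := fun m =>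
    measurableSet_unitCube.preimage (measurable_add_const _)
  have hd : Pairwise (Function.onFun Disjoint s) := by
    intro m n hmn
    refine Set.disjoint_left.mpr fun x hx hx' => hmn ?_
    rw [(hmem m x).mp hx, (hmem n x).mp hx']
  have hU : ⋃ m, s m = Set.univ := by
    ext x
    simp only [Set.mem_iUnion, Set.mem_univ, iff_true]
    exact ⟨_, (hmem _ x).mpr rfl⟩
  have h := hasSum_integral_iUnion (μ := volume) hm hd (f := F) (hF.integrableOn)
  rw [hU, Measure.restrict_univ] at h
  refine h.congr_fun fun m => ?_
  have := (measurePreserving_add_right (volume : Measure (EuclideanSpace ℝ ι))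
    (latVec (-m))).setIntegral_preimage_emb
    (measurableEmbedding_addRight _) (fun x => F (x + latVec m)) (unitCube ι)
  rw [← this]
  refine integral_congr_ae (Eventually.of_forall fun x => ?_)
  simp [latVec_neg]

lemma hasSum_integral_of_bound {α X : Type*} [Countable α] [MeasurableSpace X] {μ : Measure X}
    [IsFiniteMeasure μ] {f : α → X → ℂ} {v : α → ℝ} (hv : Summable v)
    (hm : ∀ i, AEStronglyMeasurable (f i) μ) (hf : ∀ i, ∀ᵐ x ∂μ, ‖f i x‖ ≤ v i) :
    HasSum (fun i => ∫ x, f i x ∂μ) (∫ x, ∑' i, f i x ∂μ) := by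
  have hint (i : α) : Integrable (f i) μ :=
    Integrable.of_bound (hm i) (v i) (hf i)
  refine hasSum_integral_of_summable_integral_norm hint ?_
  refine Summable.of_nonneg_of_le (fun i => integral_nonneg fun _ => norm_nonneg _)
    (fun i => ?_) (hv.mul_left (μ.real Set.univ))
  calc ∫ x, ‖f i x‖ ∂μ ≤ ∫ _x, v i ∂μ :=
        integral_mono_ae (hint i).norm (integrable_const _) (hf i)
    _ = _ := by simp

/-- One summable majorant for a whole ball: it justifies both the interchange of sum and integral
over the cube and the continuity of periodizations. -/
lemma exists_translate_bound (φ : 𝓢(EuclideanSpace ℝ ι, ℂ)) (R : ℝ) :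
    ∃ v : (ι → ℤ) → ℝ, Summable v ∧ ∀ x, ‖x‖ ≤ R → ∀ m, ‖φ (x + latVec m)‖ ≤ v m := by
  obtain ⟨M, hM⟩ := exists_summable_weight ι
  obtain ⟨A, hA, hφ⟩ := exists_decay φ M 0
  refine ⟨fun m => A * (1 + R) ^ M * weight M m, hM.mul_left _, fun x hx m => ?_⟩
  have h1 := hφ 0 le_rfl (x + latVec m)
  rw [norm_iteratedFDeriv_zero] at h1
  refine h1.trans ?_
  simp only [mul_assoc]
  gcongr
  rw [add_comm x]
  refine (inv_le_mul_weight M m x).trans ?_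
  have := weight_nonneg M m
  gcongr

lemma summable_translate (φ : 𝓢(EuclideanSpace ℝ ι, ℂ)) (x : EuclideanSpace ℝ ι) :
    Summable fun m : ι → ℤ => φ (x + latVec m) := by
  obtain ⟨v, hv, hb⟩ := exists_translate_bound φ ‖x‖
  exact Summable.of_norm_bounded hv fun m => hb x le_rfl m

/-- `∫ exp (-2 π i n · x) φ(x) dx` as a value of the Fourier transform. -/
lemma fourier_latVec (φ : 𝓢(EuclideanSpace ℝ ι, ℂ)) (y : EuclideanSpace ℝ ι) :
    FourierTransform.fourier φ y = ∫ x, ec (-inner ℝ y x) * φ x := by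
  rw [SchwartzMap.fourier_coe, Real.fourier_eq]
  refine integral_congr_ae (Eventually.of_forall fun x => ?_)
  simp only [ec_eq_fourierChar, real_inner_comm y x]
  rfl

lemma integrable_ec_mul (φ : 𝓢(EuclideanSpace ℝ ι, ℂ)) (y : EuclideanSpace ℝ ι) :
    Integrable fun x => ec (-inner ℝ y x) * φ x := by
  refine φ.integrable.norm.mono' (by fun_prop) (Eventually.of_forall fun x => ?_)
  simp

/-- The Fourier coefficients of the periodization of a Schwartz function. -/
lemma cubeCoeff_periodization (φ : 𝓢(EuclideanSpace ℝ ι, ℂ)) (n : ι → ℤ) :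
    cubeCoeff (fun x => ∑' m, φ (x + latVec m)) n = FourierTransform.fourier φ (latVec n) := by
  rw [fourier_latVec]
  have h1 := hasSum_integral_unitCube (integrable_ec_mul φ (latVec n))
  obtain ⟨v, hv, hb⟩ := exists_translate_bound φ √(Fintype.card ι)
  have h2 := hasSum_integral_of_bound (μ := volume.restrict (unitCube ι))
    (f := fun m x => ec (-inner ℝ (latVec n) (x + latVec m)) * φ (x + latVec m)) hv
    (fun m => by fun_prop) (fun m => by
      filter_upwards [ae_restrict_mem measurableSet_unitCube] with x hx
      simpa using hb x (norm_le_of_mem_unitCube hx) m)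
  rw [← h2.unique h1, cubeCoeff]
  refine integral_congr_ae (Eventually.of_forall fun x => ?_)
  simp only
  rw [← tsum_mul_left]
  refine tsum_congr fun m => ?_
  congr 1
  rw [← inner_neg_left, ← inner_neg_left, ← latVec_neg, ec_inner_add_latVec]

/-- The Poisson summation formula for Schwartz functions. -/
theorem hasSum_poisson (φ : 𝓢(EuclideanSpace ℝ ι, ℂ)) (x : EuclideanSpace ℝ ι) :
    HasSum (fun n : ι → ℤ => FourierTransform.fourier φ (latVec n) * ec (inner ℝ (latVec n) x))
      (∑' m : ι → ℤ, φ (x + latVec m)) := by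
  have hco := funext (cubeCoeff_periodization φ)
  have hcont : Continuous fun x => ∑' m : ι → ℤ, φ (x + latVec m) := by
    rw [continuous_iff_continuousAt]
    intro x
    obtain ⟨v, hv, hb⟩ := exists_translate_bound φ (‖x‖ + 1)
    have : ContinuousOn (fun x => ∑' m : ι → ℤ, φ (x + latVec m)) (Metric.ball x 1) := by
      refine continuousOn_tsum (fun m => by fun_prop) hv fun m y hy => hb y ?_ m
      have := norm_sub_norm_le y x
      rw [Metric.mem_ball, dist_eq_norm] at hy
      linarith
    exact this.continuousAt (Metric.ball_mem_nhds x one_pos)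
  have hper : ∀ x m, (∑' k : ι → ℤ, φ (x + latVec m + latVec k)) = ∑' k, φ (x + latVec k) := by
    intro x m
    rw [← (Equiv.addLeft m).tsum_eq fun k => φ (x + latVec k)]
    simp [latVec_add, add_assoc]
  have hs : Summable (cubeCoeff fun x => ∑' m : ι → ℤ, φ (x + latVec m)) := by
    rw [hco]
    simpa using summable_translate (FourierTransform.fourier φ) 0
  have := hasSum_cubeCoeff hcont hper hs x
  rwa [hco] at this

end Periodic

/-! ### A smooth partition of unity along the lattice -/

/-- A smooth function on `ℝ`, supported in `[-1, 1]`, whose integer translates sum to `1`. -/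
def stepBump (s : ℝ) : ℝ := Real.smoothTransition (s + 1) - Real.smoothTransition s

lemma stepBump_eq_zero {s : ℝ} (h : s ≤ -1 ∨ 1 ≤ s) : stepBump s = 0 := by
  rcases h with h | h
  · rw [stepBump, Real.smoothTransition.zero_of_nonpos (by linarith),
      Real.smoothTransition.zero_of_nonpos (by linarith), sub_zero]
  · rw [stepBump, Real.smoothTransition.one_of_one_le (by linarith),
      Real.smoothTransition.one_of_one_le h, sub_self]

/-- The sum telescopes to the difference of the transition function at s + 1 and s - 1, that is 1 -
0. -/
lemma stepBump_add_stepBump {s : ℝ} (h0 : 0 ≤ s) (h1 : s < 1) :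
    stepBump (s - 1) + stepBump s = 1 := by
  have e1 := Real.smoothTransition.zero_of_nonpos (x := s - 1) (by linarith)
  have e2 := Real.smoothTransition.one_of_one_le (x := s + 1) (by linarith)
  simp only [stepBump, e1, e2, sub_add_cancel]
  ring

lemma contDiff_stepBump : ContDiff ℝ ∞ stepBump :=
  (Real.smoothTransition.contDiff.comp (contDiff_id.add contDiff_const)).sub
    Real.smoothTransition.contDiff

section Partition

variable (ι : Type*) [Fintype ι]

/-- A smooth compactly supported function on `ℝ^ι` whose lattice translates sum to `1`. -/
def latticeBump (x : EuclideanSpace ℝ ι) : ℂ := ((∏ i, stepBump (x i) : ℝ) : ℂ)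

variable {ι}

lemma hasSum_latticeBump (x : EuclideanSpace ℝ ι) :
    HasSum (fun m : ι → ℤ => latticeBump ι (x + latVec m)) 1 := by
  classical
  -- Only two integer shifts per coordinate meet the support, so the lattice sum is a finite sum
  -- over a product set and factorizes.
  let t : ι → Finset ℤ := fun i => {-⌊x i⌋ - 1, -⌊x i⌋}
  have hz : ∀ m ∉ Fintype.piFinset t, latticeBump ι (x + latVec m) = 0 := by
    intro m hm
    simp only [Fintype.mem_piFinset, not_forall] at hm
    obtain ⟨i, hi⟩ := hm
    simp only [t, Finset.mem_insert, Finset.mem_singleton, not_or] at hi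
    rw [latticeBump, Finset.prod_eq_zero (Finset.mem_univ i), Complex.ofReal_zero]
    refine stepBump_eq_zero ?_
    simp only [PiLp.add_apply, latVec_apply]
    have h1 := Int.floor_le (x i)
    have h2 := Int.lt_floor_add_one (x i)
    rcases lt_or_ge (m i) (-⌊x i⌋) with h | h
    · left
      have : m i ≤ -⌊x i⌋ - 2 := by omega
      have : (m i : ℝ) ≤ -⌊x i⌋ - 2 := by exact_mod_cast this
      linarith
    · right
      have : -⌊x i⌋ + 1 ≤ m i := by omega
      have : (-⌊x i⌋ + 1 : ℝ) ≤ m i := by exact_mod_cast this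
      linarith
  suffices h0 : ∑ m ∈ Fintype.piFinset t, latticeBump ι (x + latVec m) = 1 by
    rw [← h0]
    exact hasSum_sum_of_ne_finset_zero hz
  have h1 : ∀ i, ∑ k ∈ t i, stepBump (x i + k) = 1 := by
    intro i
    rw [Finset.sum_pair (by omega)]
    have := stepBump_add_stepBump (Int.fract_nonneg (x i)) (Int.fract_lt_one (x i))
    rw [← this]
    simp only [Int.fract]
    push_cast
    congr 2 <;> ring
  have h2 := Finset.prod_univ_sum t fun i k => stepBump (x i + k)
  simp only [h1, Finset.prod_const_one] at h2
  simp only [latticeBump, PiLp.add_apply, latVec_apply]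
  rw [← Complex.ofReal_sum, ← h2, Complex.ofReal_one]

lemma contDiff_latticeBump : ContDiff ℝ ∞ (latticeBump ι) := by
  refine Complex.ofRealCLM.contDiff.comp ?_
  refine contDiff_prod fun i _ => contDiff_stepBump.comp ?_
  exact (EuclideanSpace.proj i : EuclideanSpace ℝ ι →L[ℝ] ℝ).contDiff

lemma hasCompactSupport_latticeBump : HasCompactSupport (latticeBump ι) := by
  refine HasCompactSupport.intro (isCompact_closedBall (0 : EuclideanSpace ℝ ι)
    √(Fintype.card ι)) fun x hx => ?_
  by_contra hne
  apply hx
  rw [mem_closedBall_zero_iff, EuclideanSpace.norm_eq]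
  refine Real.sqrt_le_sqrt ?_
  calc ∑ i, ‖x i‖ ^ 2 ≤ ∑ _i : ι, (1 : ℝ) := Finset.sum_le_sum fun i _ => by
        refine pow_le_one₀ (norm_nonneg _) ?_
        by_contra h
        apply hne
        rw [latticeBump, Finset.prod_eq_zero (Finset.mem_univ i), Complex.ofReal_zero]
        refine stepBump_eq_zero ?_
        rw [Real.norm_eq_abs, not_le, lt_abs] at h
        rcases h with h | h
        · exact Or.inr h.le
        · left; linarith
    _ = _ := by simp

/-- The Fourier coefficients of a smooth periodic function are summable. -/
lemma summable_cubeCoeff {F : EuclideanSpace ℝ ι → ℂ} (hF : ContDiff ℝ ∞ F)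
    (hper : ∀ x m, F (x + latVec m) = F x) : Summable (cubeCoeff F) := by
  have hc : HasCompactSupport fun x => latticeBump ι x * F x :=
    hasCompactSupport_latticeBump.mul_right
  -- F is the periodization of this compactly supported function, so its Fourier coefficients are
  -- lattice values of a Schwartz function.
  let φ : 𝓢(EuclideanSpace ℝ ι, ℂ) := hc.toSchwartzMap (contDiff_latticeBump.mul hF)
  have hφ : (fun x => ∑' m : ι → ℤ, φ (x + latVec m)) = F := by
    funext x
    have h := (hasSum_latticeBump x).mul_right (F x)
    rw [one_mul] at h
    rw [← h.tsum_eq]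
    refine tsum_congr fun m => ?_
    change latticeBump ι (x + latVec m) * F (x + latVec m) = _
    rw [hper]
  have := funext (cubeCoeff_periodization φ)
  rw [hφ] at this
  rw [this]
  simpa using summable_translate (FourierTransform.fourier φ) 0

end Partition

/-! ### Fourier series on phase space -/

section PhaseFourier

variable {d : ℕ}

lemma intVec_eq_latVec (n : Fin d → ℤ) : intVec n = latVec n := rfl

lemma cube_eq_prod : cube d = unitCube (Fin d) ×ˢ unitCube (Fin d) := by
  ext x
  simp only [cube, unitCube, Set.mem_prod, Set.mem_ofPred_eq]
  exact forall_and

/-- `ℝ^{2d}` with its Euclidean structure, as phase space. -/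
def toPhase (y : EuclideanSpace ℝ (Fin d ⊕ Fin d)) : Phase d :=
  (WithLp.toLp 2 fun j => y (Sum.inl j), WithLp.toLp 2 fun j => y (Sum.inr j))

lemma contDiff_toPhase : ContDiff ℝ ∞ (toPhase (d := d)) := by
  refine ContDiff.prodMk ?_ ?_ <;>
  · rw [contDiff_piLp 2]
    intro i
    exact (EuclideanSpace.proj _ : EuclideanSpace ℝ (Fin d ⊕ Fin d) →L[ℝ] ℝ).contDiff

/-- The coordinate change `toPhase` as a measurable equivalence. -/
def phaseEquiv (d : ℕ) : EuclideanSpace ℝ (Fin d ⊕ Fin d) ≃ᵐ Phase d :=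
  ((MeasurableEquiv.toLp 2 (Fin d ⊕ Fin d → ℝ)).symm.trans
    (MeasurableEquiv.sumPiEquivProdPi fun _ => ℝ)).trans
    ((MeasurableEquiv.toLp 2 (Fin d → ℝ)).prodCongr (MeasurableEquiv.toLp 2 (Fin d → ℝ)))

lemma coe_phaseEquiv : ⇑(phaseEquiv d) = toPhase := rfl

lemma measurePreserving_phaseEquiv : MeasurePreserving (phaseEquiv d) volume volume := by
  have h1 := PiLp.volume_preserving_ofLp (Fin d ⊕ Fin d)
  have h2 := volume_measurePreserving_sumPiEquivProdPi (fun _ : Fin d ⊕ Fin d => ℝ)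
  have h3 := (PiLp.volume_preserving_toLp (Fin d)).prod (PiLp.volume_preserving_toLp (Fin d))
  exact h3.comp (h2.comp h1)

/-- The frequency `(n_p, -n_q)` that pairs with `x` as `-ω(n, x)`. -/
def freqEquiv (d : ℕ) : ((Fin d → ℤ) × (Fin d → ℤ)) ≃ (Fin d ⊕ Fin d → ℤ) :=
  ((Equiv.prodComm _ _).trans ((Equiv.refl _).prodCongr (Equiv.neg _))).trans
    (Equiv.sumArrowEquivProdArrow _ _ _).symm

lemma inner_freqEquiv (n : (Fin d → ℤ) × (Fin d → ℤ)) (y : EuclideanSpace ℝ (Fin d ⊕ Fin d)) :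
    inner ℝ (latVec (freqEquiv d n)) y = -symp (intPhase n) (toPhase y) := by
  rw [inner_latVec, Fintype.sum_sum_type, symp, intPhase, intVec_eq_latVec, intVec_eq_latVec,
    inner_latVec, inner_latVec]
  have e1 (j : Fin d) : freqEquiv d n (Sum.inl j) = n.2 j := rfl
  have e2 (j : Fin d) : freqEquiv d n (Sum.inr j) = -n.1 j := rfl
  simp only [e1, e2, toPhase, Int.cast_neg, neg_mul, Finset.sum_neg_distrib]
  ring

lemma exp_symp_eq_ec (n : (Fin d → ℤ) × (Fin d → ℤ)) (x : Phase d) :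
    Complex.exp (Complex.I * (symp ((2 * Real.pi) • intPhase n) x : ℝ)) =
      ec (symp (intPhase n) x) := by
  rw [ec]
  congr 1
  simp only [symp, Prod.smul_fst, Prod.smul_snd, inner_smul_left]
  push_cast
  simp
  ring

lemma sympFourier_eq_cubeCoeff (f : Phase d → ℂ) (n : (Fin d → ℤ) × (Fin d → ℤ)) :
    sympFourier f ((2 * Real.pi) • intPhase n) = cubeCoeff (f ∘ toPhase) (freqEquiv d n) := by
  rw [sympFourier, cubeCoeff, ← measurePreserving_phaseEquiv.setIntegral_preimage_emb
    (phaseEquiv d).measurableEmbedding]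
  have : phaseEquiv d ⁻¹' cube d = unitCube (Fin d ⊕ Fin d) := by
    ext y
    simp only [coe_phaseEquiv, cube, unitCube, toPhase, Set.mem_preimage, Set.mem_ofPred_eq,
      Sum.forall, forall_and]
  rw [this]
  refine integral_congr_ae (Eventually.of_forall fun y => ?_)
  simp only [exp_symp_eq_ec, inner_freqEquiv, neg_neg, coe_phaseEquiv, Function.comp_apply]

lemma TorusSmooth.periodic_toPhase {f : Phase d → ℂ} (hf : TorusSmooth f)
    (x : EuclideanSpace ℝ (Fin d ⊕ Fin d)) (m : Fin d ⊕ Fin d → ℤ) :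
    (f ∘ toPhase) (x + latVec m) = (f ∘ toPhase) x := by
  have : toPhase (x + latVec m) = toPhase x + intPhase (m ∘ Sum.inl, m ∘ Sum.inr) := by
    rfl
  rw [Function.comp_apply, this, hf.2]
  rfl

/-- The symplectic Fourier coefficients of a smooth function on the torus are summable. -/
theorem TorusSmooth.summable_sympFourier {f : Phase d → ℂ} (hf : TorusSmooth f) :
    Summable fun n : (Fin d → ℤ) × (Fin d → ℤ) =>
      sympFourier f ((2 * Real.pi) • intPhase n) := by
  have h := summable_cubeCoeff (hf.1.comp contDiff_toPhase) hf.periodic_toPhase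
  simpa only [sympFourier_eq_cubeCoeff] using! h.comp_injective (freqEquiv d).injective

/-- A smooth function on the torus is the sum of its symplectic Fourier series. -/
theorem TorusSmooth.hasSum_sympFourier {f : Phase d → ℂ} (hf : TorusSmooth f) (x : Phase d) :
    HasSum (fun n : (Fin d → ℤ) × (Fin d → ℤ) =>
      sympFourier f ((2 * Real.pi) • intPhase n) * ec (-symp (intPhase n) x)) (f x) := by
  have h := hasSum_cubeCoeff (hf.1.comp contDiff_toPhase).continuous hf.periodic_toPhase
    (summable_cubeCoeff (hf.1.comp contDiff_toPhase) hf.periodic_toPhase) ((phaseEquiv d).symm x)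
  have h2 := (freqEquiv d).hasSum_iff.mpr h
  have hx : toPhase ((phaseEquiv d).symm x) = x := (phaseEquiv d).apply_symm_apply x
  simpa only [Function.comp_def, inner_freqEquiv, hx, sympFourier_eq_cubeCoeff] using h2

end PhaseFourier

/-! ### Quasi-periodic sequences -/

/-- The coordinate space of `𝓗_ħ(κ)`. -/
abbrev Coord (d : ℕ) (N : ℕ+) := EuclideanSpace ℂ (Fin d → Fin (N : ℕ))

section Sequences

variable {d : ℕ} (N : ℕ+) (κ : Phase d)

/-- A residue as an integer vector. -/
def rep {N : ℕ+} (r : Fin d → Fin (N : ℕ)) : Fin d → ℤ := fun j => ((r j : ℕ) : ℤ)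

/-- Division with remainder in `ℤ^d`: `(k, r) ↦ r + N k`. -/
def divEquiv : (Fin d → ℤ) ≃ (Fin d → ℤ) × (Fin d → Fin (N : ℕ)) :=
  (Equiv.piCongrRight fun _ => Int.divModEquiv (N : ℕ)).trans (Equiv.arrowProdEquivProdArrow _ _ _)

lemma divEquiv_symm_apply (k : Fin d → ℤ) (r : Fin d → Fin (N : ℕ)) :
    (divEquiv N).symm (k, r) = rep r + (N : ℤ) • k := by
  funext j
  change k j * ((N : ℕ) : ℤ) + ((r j : ℕ) : ℤ) = _
  simp [rep, mul_comm, add_comm]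

lemma divEquiv_rep_add (k : Fin d → ℤ) (r : Fin d → Fin (N : ℕ)) :
    divEquiv N (rep r + (N : ℤ) • k) = (k, r) := by
  rw [← divEquiv_symm_apply, Equiv.apply_symm_apply]

lemma eq_rep_add (j : Fin d → ℤ) : ∃ k r, j = rep (N := N) r + (N : ℤ) • k :=
  ⟨(divEquiv N j).1, (divEquiv N j).2, by rw [← divEquiv_symm_apply]; simp⟩

/-- The phase `exp (i κ_p · k)`. -/
def pChar (k : Fin d → ℤ) : ℂ := ec (inner ℝ κ.2 (intVec k) / (2 * Real.pi))

lemma exp_I_mul (t : ℝ) : Complex.exp (Complex.I * (t : ℝ)) = ec (t / (2 * Real.pi)) := by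
  rw [ec, mul_div_cancel₀ _ (by positivity), mul_comm]

lemma exp_neg_I_mul (t : ℝ) : Complex.exp (-Complex.I * (t : ℝ)) = ec (-(t / (2 * Real.pi))) := by
  rw [← neg_div, ← exp_I_mul]
  congr 1
  push_cast
  ring

lemma pChar_add (k l : Fin d → ℤ) : pChar κ (k + l) = pChar κ k * pChar κ l := by
  simp only [pChar, intVec_eq_latVec, latVec_add, inner_add_right, add_div, ec_add]

@[simp] lemma pChar_zero : pChar κ 0 = 1 := by
  simp [pChar, intVec_eq_latVec]

lemma pChar_neg (k : Fin d → ℤ) : pChar κ (-k) = (starRingEnd ℂ) (pChar κ k) := by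
  simp only [pChar, intVec_eq_latVec, latVec_neg, inner_neg_right, neg_div, conj_ec]

@[simp] lemma norm_pChar (k : Fin d → ℤ) : ‖pChar κ k‖ = 1 := norm_ec _

/-- Quasi-periodicity `b (j + N k) = exp (i κ_p · k) b j`. -/
def QuasiPeriodic (b : (Fin d → ℤ) → ℂ) : Prop :=
  ∀ j k, b (j + (N : ℤ) • k) = pChar κ k * b j

/-- The quasi-periodic extension of a coordinate vector. -/
def extend (c : Coord d N) (j : Fin d → ℤ) : ℂ :=
  pChar κ (divEquiv N j).1 * c (divEquiv N j).2

/-- The coordinate vector of a sequence. -/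
def restr (b : (Fin d → ℤ) → ℂ) : Coord d N := WithLp.toLp 2 fun r => b (rep r)

variable {N κ}

@[simp] lemma restr_apply (b : (Fin d → ℤ) → ℂ) (r : Fin d → Fin (N : ℕ)) :
    restr N b r = b (rep r) := rfl

lemma extend_rep_add (c : Coord d N) (k : Fin d → ℤ) (r : Fin d → Fin (N : ℕ)) :
    extend N κ c (rep r + (N : ℤ) • k) = pChar κ k * c r := by
  rw [extend, divEquiv_rep_add]

lemma extend_rep (c : Coord d N) (r : Fin d → Fin (N : ℕ)) : extend N κ c (rep r) = c r := by
  simpa using extend_rep_add (κ := κ) c 0 r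

lemma quasiPeriodic_extend (c : Coord d N) : QuasiPeriodic N κ (extend N κ c) := by
  intro j k
  obtain ⟨l, r, rfl⟩ := eq_rep_add N j
  rw [add_assoc, ← smul_add, extend_rep_add, extend_rep_add, add_comm, pChar_add, mul_assoc]

lemma QuasiPeriodic.extend_restr {b : (Fin d → ℤ) → ℂ} (hb : QuasiPeriodic N κ b) :
    extend N κ (restr N b) = b := by
  funext j
  obtain ⟨l, r, rfl⟩ := eq_rep_add N j
  rw [extend_rep_add, hb, restr_apply]

lemma restr_extend (c : Coord d N) : restr N (extend N κ c) = c := by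
  ext r
  rw [restr_apply, extend_rep]

lemma extend_smul (a : ℂ) (c : Coord d N) : extend N κ (a • c) = a • extend N κ c := by
  funext j; simp [extend]; ring

lemma norm_extend_le (c : Coord d N) (j : Fin d → ℤ) : ‖extend N κ c j‖ ≤ ‖c‖ := by
  rw [extend, norm_mul, norm_pChar, one_mul]
  exact PiLp.norm_apply_le c _

/-- Sums of periodic functions over a period are shift invariant. -/
lemma sum_rep_add {F : Type*} [AddCommMonoid F] {h : (Fin d → ℤ) → F}
    (hh : ∀ j k, h (j + (N : ℤ) • k) = h j) (n : Fin d → ℤ) :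
    ∑ r : Fin d → Fin (N : ℕ), h (rep r + n) = ∑ r : Fin d → Fin (N : ℕ), h (rep r) := by
  -- Translation by n permutes the residues, with inverse translation by -n.
  let σ (n : Fin d → ℤ) (r : Fin d → Fin (N : ℕ)) : Fin d → Fin (N : ℕ) :=
    (divEquiv N (rep r + n)).2
  have hσ (n : Fin d → ℤ) (r) : ∃ k, rep r + n = rep (σ n r) + (N : ℤ) • k :=
    ⟨(divEquiv N (rep r + n)).1, by rw [← divEquiv_symm_apply]; simp [σ]⟩
  have hinv (n : Fin d → ℤ) (r) : σ (-n) (σ n r) = r := by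
    obtain ⟨k, hk⟩ := hσ n r
    have : rep (σ n r) + -n = rep r + (N : ℤ) • (-k) := by
      rw [smul_neg, ← sub_eq_add_neg, ← sub_eq_add_neg, sub_eq_sub_iff_add_eq_add, hk.symm.trans rfl]
    change (divEquiv N (rep (σ n r) + -n)).2 = r
    rw [this, divEquiv_rep_add]
  let e : (Fin d → Fin (N : ℕ)) ≃ (Fin d → Fin (N : ℕ)) :=
    ⟨σ n, σ (-n), hinv n, fun r => by simpa using hinv (-n) r⟩
  rw [← e.sum_comp fun r => h (rep r)]
  refine Finset.sum_congr rfl fun r _ => ?_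
  obtain ⟨k, hk⟩ := hσ n r
  rw [hk, hh]
  rfl

end Sequences

/-! ### Combinations of the basis vectors -/

section Synthesis

variable {d : ℕ} (N : ℕ+) (κ : Phase d)

/-- The points `(j + κ_q / (2π)) / N`. -/
def node (j : Fin d → ℤ) : Config d :=
  (N : ℝ)⁻¹ • intVec j + (2 * Real.pi * (N : ℝ))⁻¹ • κ.1

lemma natCast_pos : (0 : ℝ) < ((N : ℕ) : ℝ) := by exact_mod_cast N.pos

variable {N κ}

lemma node_add (j n : Fin d → ℤ) : node N κ (j + n) = node N κ j + (N : ℝ)⁻¹ • intVec n := by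
  simp only [node, intVec_eq_latVec, latVec_add, smul_add]
  abel

lemma node_add_smul (j k : Fin d → ℤ) : node N κ (j + (N : ℤ) • k) = node N κ j + intVec k := by
  rw [node_add]
  congr 1
  ext i
  have := (natCast_pos N).ne'
  simp [intVec]

variable (N κ) in
-- The lattice vector j is N times a fixed translate of `node N κ j`, so the nodes grow linearly in
-- j and Schwartz decay is summable along them.
lemma exists_node_bound : ∃ (v : (Fin d → ℤ) → ℝ) (s : Finset (ℕ × ℕ)), Summable v ∧
    (∀ j, 0 ≤ v j) ∧ ∀ (φ : 𝓢(Config d, ℂ)) j,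
      ‖φ (node N κ j)‖ ≤ v j * s.sup (schwartzSeminormFamily ℂ (Config d) ℂ) φ := by
  obtain ⟨M, hM⟩ := exists_summable_weight (Fin d)
  have hN := natCast_pos N
  have hN1 : (1 : ℝ) ≤ ((N : ℕ) : ℝ) := by exact_mod_cast N.pos
  set a : Config d := (2 * Real.pi * (N : ℝ))⁻¹ • κ.1
  refine ⟨fun j => 2 ^ M * ((N : ℕ) * (1 + ‖a‖)) ^ M * weight M j, Finset.Iic (M, 0),
    hM.mul_left _, fun j => ?_, fun φ j => ?_⟩
  · have := weight_nonneg M j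
    positivity
  refine (norm_le_sup_seminorm_mul φ M _).trans ?_
  have h1 : ((1 + ‖node N κ j‖) ^ M)⁻¹ ≤ ((N : ℕ) * (1 + ‖a‖)) ^ M * weight M j := by
    have h : 1 + ‖latVec j‖ ≤ ((N : ℕ) * (1 + ‖a‖)) * (1 + ‖node N κ j‖) := by
      have e : latVec j = (N : ℝ) • (node N κ j - a) := by
        simp only [node, a, add_sub_cancel_right, smul_smul]
        rw [mul_inv_cancel₀ hN.ne', one_smul]
        rfl
      have h2 : ‖latVec j‖ ≤ (N : ℕ) * (‖node N κ j‖ + ‖a‖) := by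
        rw [e, norm_smul, Real.norm_of_nonneg hN.le]
        gcongr
        exact norm_sub_le _ _
      have h3 : 0 ≤ ((N : ℕ) : ℝ) * (‖a‖ * ‖node N κ j‖) := by positivity
      nlinarith
    unfold weight
    rw [inv_le_iff_one_le_mul₀ (by positivity), mul_right_comm, ← mul_pow]
    rw [← div_eq_mul_inv, one_le_div (by positivity)]
    gcongr
  calc _ ≤ 2 ^ M * (Finset.Iic (M, 0)).sup (schwartzSeminormFamily ℂ (Config d) ℂ) φ *
        (((N : ℕ) * (1 + ‖a‖)) ^ M * weight M j) := by gcongr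
    _ = _ := by ring

variable (N κ) in
/-- The vector of `𝓗_ħ(κ)` with given coordinates, as a tempered distribution. -/
def synth (c : Coord d N) : 𝓢'(Config d, ℂ) := ∑ r, c r • basisVec N κ r

variable (N d) in
/-- The normalisation `N^{-d/2}` of the basis. -/
def normConst : ℝ := (N : ℝ) ^ (-(d : ℝ) / 2)

lemma normConst_pos : 0 < normConst d N := Real.rpow_pos_of_pos (natCast_pos N) _

lemma normConst_sq : normConst d N ^ 2 = ((N : ℝ) ^ d)⁻¹ := by
  rw [normConst, ← Real.rpow_natCast, ← Real.rpow_mul (natCast_pos N).le]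
  rw [← Real.rpow_natCast, ← Real.rpow_neg (natCast_pos N).le]
  congr 1
  push_cast
  ring

lemma summable_node {b : (Fin d → ℤ) → ℂ} {C : ℝ} (hb : ∀ j, ‖b j‖ ≤ C) (φ : 𝓢(Config d, ℂ)) :
    Summable fun j => b j * φ (node N κ j) := by
  obtain ⟨v, s, hv, hv0, hφ⟩ := exists_node_bound N κ
  refine Summable.of_norm_bounded ((hv.mul_right
    (s.sup (schwartzSeminormFamily ℂ (Config d) ℂ) φ)).mul_left C) fun j => ?_
  rw [norm_mul]
  exact mul_le_mul (hb j) (hφ φ j) (norm_nonneg _) ((norm_nonneg _).trans (hb j))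

lemma basisVec_apply (r : Fin d → Fin (N : ℕ)) (φ : 𝓢(Config d, ℂ)) :
    HasSum (fun k => (normConst d N : ℂ) * (pChar κ k * φ (node N κ (rep r + (N : ℤ) • k))))
      (basisVec N κ r φ) := by
  obtain ⟨v, s, hv, hv0, hφ⟩ := exists_node_bound N κ
  have hinj : Function.Injective fun k : Fin d → ℤ => rep (N := N) r + (N : ℤ) • k := by
    intro k l h
    have := congrArg (fun j => (divEquiv N j).1) h
    simpa only [divEquiv_rep_add] using this
  have hpt (k : Fin d → ℤ) : intVec k + (N : ℝ)⁻¹ • intVec (fun j => ((r j : ℕ) : ℤ))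
      + (2 * Real.pi * (N : ℝ))⁻¹ • κ.1 = node N κ (rep r + (N : ℤ) • k) := by
    rw [node_add_smul, node]
    change _ = (N : ℝ)⁻¹ • intVec (fun j => ((r j : ℕ) : ℤ)) + _ + _
    abel
  obtain ⟨S, hS⟩ := exists_tempered_of_bound (fun k : Fin d → ℤ =>
    Complex.exp (Complex.I * (inner ℝ κ.2 (intVec k) : ℝ)) •
      TemperedDistribution.delta (intVec k + (N : ℝ)⁻¹ • intVec (fun j => ((r j : ℕ) : ℤ))
          + (2 * Real.pi * (N : ℝ))⁻¹ • κ.1)) _ (hv.comp_injective hinj) s (by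
    intro k φ
    rw [hpt, exp_I_mul]
    change ‖ec _ * φ (node N κ _)‖ ≤ _
    rw [norm_mul, norm_ec, one_mul]
    exact hφ φ _)
  rw [basisVec, hS.tsum_eq]
  have h := (hasSum_tempered.mp hS φ).mul_left (normConst d N : ℂ)
  refine h.congr_fun fun k => ?_
  rw [hpt, exp_I_mul]
  rfl

lemma synth_apply_eq_sum (c : Coord d N) (φ : 𝓢(Config d, ℂ)) :
    synth N κ c φ = ∑ r, c r * basisVec N κ r φ := by
  rw [synth]
  change (PointwiseConvergenceCLM.evalCLM (RingHom.id ℂ) ℂ φ) _ = _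
  rw [map_sum]
  rfl

/-- Division with remainder merges the N^d combs into one comb over ℤ^d, with quasi-periodic
weights; operators can then be computed on the sequence of weights. -/
lemma synth_apply (c : Coord d N) (φ : 𝓢(Config d, ℂ)) :
    HasSum (fun j => (normConst d N : ℂ) * (extend N κ c j * φ (node N κ j)))
      (synth N κ c φ) := by
  have hs := (summable_node (N := N) (κ := κ) (norm_extend_le (κ := κ) c) φ).mul_left (normConst d N : ℂ)
  have h1 := (divEquiv N).symm.summable_iff.mpr hs
  rw [← (divEquiv N).symm.hasSum_iff]
  refine h1.hasSum_iff.mpr ?_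
  rw [h1.tsum_prod' fun k => (hasSum_fintype _).summable]
  simp only [Function.comp_apply, divEquiv_symm_apply, tsum_fintype]
  rw [Summable.tsum_finsetSum]
  · rw [synth_apply_eq_sum]
    refine Finset.sum_congr rfl fun r _ => ?_
    have := (basisVec_apply (κ := κ) r φ).mul_left (c r)
    refine (tsum_congr fun k => ?_).trans this.tsum_eq
    rw [extend_rep_add]
    ring
  · intro r _
    have := (basisVec_apply (κ := κ) r φ).mul_left (c r)
    refine this.summable.congr fun k => ?_
    rw [extend_rep_add]
    ring

lemma synth_eq_of_forall {c : Coord d N} {T : 𝓢'(Config d, ℂ)}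
    (h : ∀ φ, HasSum (fun j => (normConst d N : ℂ) * (extend N κ c j * φ (node N κ j))) (T φ)) :
    T = synth N κ c := by
  ext φ
  exact (h φ).unique (synth_apply c φ)

variable (N κ) in
/-- `synth` as a continuous linear map. -/
def synthCLM : Coord d N →L[ℂ] 𝓢'(Config d, ℂ) where
  toFun := synth N κ
  map_add' c c' := by
    ext φ
    change _ = synth N κ c φ + synth N κ c' φ
    simp only [synth_apply_eq_sum, PiLp.add_apply, add_mul, Finset.sum_add_distrib]
  map_smul' a c := by
    ext φ
    change _ = a * synth N κ c φ
    simp only [synth_apply_eq_sum, PiLp.smul_apply, smul_eq_mul, Finset.mul_sum, mul_assoc]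
  cont := by
    refine PointwiseConvergenceCLM.continuous_of_continuous_eval fun φ => ?_
    change Continuous fun c => synth N κ c φ
    simp only [synth_apply_eq_sum]
    fun_prop

@[simp] lemma synthCLM_apply (c : Coord d N) : synthCLM N κ c = synth N κ c := rfl

/-- A Schwartz function that separates a given node from the others. -/
lemma exists_separating (j₀ : Fin d → ℤ) : ∃ φ : 𝓢(Config d, ℂ), φ (node N κ j₀) = 1 ∧
    ∀ j, j ≠ j₀ → φ (node N κ j) = 0 := by
  have hN := natCast_pos N
  -- Distinct nodes are at distance at least 1/N, so outer radius 1/(2N) isolates one of them.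
  let B : ContDiffBump (node N κ j₀) := ⟨(4 * (N : ℝ))⁻¹, (2 * (N : ℝ))⁻¹, by positivity, by
    gcongr; norm_num⟩
  have h1 : HasCompactSupport fun x => ((B x : ℝ) : ℂ) :=
    B.hasCompactSupport.comp_left Complex.ofReal_zero
  have h2 : ContDiff ℝ ∞ fun x => ((B x : ℝ) : ℂ) := Complex.ofRealCLM.contDiff.comp B.contDiff
  refine ⟨h1.toSchwartzMap h2, ?_, fun j hj => ?_⟩
  · change ((B (node N κ j₀) : ℝ) : ℂ) = 1
    rw [B.one_of_mem_closedBall (Metric.mem_closedBall_self B.rIn_pos.le), Complex.ofReal_one]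
  · change ((B (node N κ j) : ℝ) : ℂ) = 0
    rw [B.zero_of_le_dist, Complex.ofReal_zero]
    obtain ⟨i, hi⟩ := Function.ne_iff.mp hj
    have e : node N κ j - node N κ j₀ = (N : ℝ)⁻¹ • latVec (j - j₀) := by
      simp only [node, intVec_eq_latVec, latVec_sub, smul_sub]
      abel
    have h3 : (1 : ℝ) ≤ ‖latVec (j - j₀)‖ := by
      refine le_trans ?_ (PiLp.norm_apply_le (latVec (j - j₀)) i)
      rw [latVec_apply, Real.norm_eq_abs]
      have : 1 ≤ |(j - j₀) i| := Int.one_le_abs (by simpa [sub_eq_zero] using hi)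
      exact_mod_cast this
    rw [dist_eq_norm, e, norm_smul, norm_inv, Real.norm_of_nonneg hN.le]
    change (2 * (N : ℝ))⁻¹ ≤ _
    rw [mul_inv, mul_comm]
    gcongr
    linarith

lemma synth_injective : Function.Injective (synth N κ) := by
  intro c c' h
  ext r
  obtain ⟨φ, h1, h2⟩ := exists_separating (N := N) (κ := κ) (rep r)
  have key (c : Coord d N) : synth N κ c φ = (normConst d N : ℂ) * c r := by
    refine (synth_apply c φ).unique ?_
    have := hasSum_single (f := fun j => (normConst d N : ℂ) * (extend N κ c j * φ (node N κ j)))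
      (rep r) fun j hj => by rw [h2 j hj]; simp
    simpa [h1, extend_rep] using this
  have hne : (normConst d N : ℂ) ≠ 0 := by exact_mod_cast normConst_pos.ne'
  refine mul_left_cancel₀ hne ?_
  rw [← key, ← key, h]

/-- Since `synth` is injective, the arbitrary right inverse in the definition of `coords` is a
genuine left inverse here. -/
lemma coords_synth (c : Coord d N) : coords N κ (synth N κ c) = c :=
  Function.leftInverse_invFun synth_injective c

end Synthesis

/-! ### Translations on quasi-periodic sequences -/

section Translations

variable {d : ℕ} {N : ℕ+} {κ : Phase d}

lemma phaseFactor_eq_ec (ξ : Phase d) (q : Config d) :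
    phaseFactor (hbar N) ξ q = ec (N * (inner ℝ ξ.2 q - inner ℝ ξ.1 ξ.2 / 2)) := by
  rw [phaseFactor, exp_I_mul]
  congr 1
  have := natCast_pos N
  rw [hbar]
  field_simp

variable (N κ) in
/-- The action of `U_ħ(n / N)` on quasi-periodic sequences. -/
def shiftSeq (n : (Fin d → ℤ) × (Fin d → ℤ)) (b : (Fin d → ℤ) → ℂ) (j : Fin d → ℤ) : ℂ :=
  ec (inner ℝ (intVec n.2) (node N κ j) - inner ℝ (intVec n.1) (intVec n.2) / (2 * N)) *
    b (j - n.1)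

lemma QuasiPeriodic.shiftSeq {b : (Fin d → ℤ) → ℂ} (hb : QuasiPeriodic N κ b)
    (n : (Fin d → ℤ) × (Fin d → ℤ)) : QuasiPeriodic N κ (shiftSeq N κ n b) := by
  intro j k
  simp only [TorusQuantum.shiftSeq]
  rw [show j + (N : ℤ) • k - n.1 = j - n.1 + (N : ℤ) • k by abel, hb, node_add_smul, ec_sub,
    intVec_eq_latVec, intVec_eq_latVec k, ec_inner_add_latVec, ec_sub]
  ring

variable (N κ) in
/-- The action of `U_ħ(n / N)` on coordinates. -/
def shiftCoord (n : (Fin d → ℤ) × (Fin d → ℤ)) (c : Coord d N) : Coord d N :=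
  restr N (shiftSeq N κ n (extend N κ c))

lemma extend_shiftCoord (n : (Fin d → ℤ) × (Fin d → ℤ)) (c : Coord d N) :
    extend N κ (shiftCoord N κ n c) = shiftSeq N κ n (extend N κ c) :=
  ((quasiPeriodic_extend c).shiftSeq n).extend_restr

/-- Unitarity: the phase has modulus 1, and |extend c|² is N-periodic, so its sum over a period does
not see the shift. -/
lemma norm_shiftCoord (n : (Fin d → ℤ) × (Fin d → ℤ)) (c : Coord d N) :
    ‖shiftCoord N κ n c‖ = ‖c‖ := by
  rw [EuclideanSpace.norm_eq, EuclideanSpace.norm_eq]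
  congr 1
  have h := sum_rep_add (N := N) (h := fun j => ‖extend N κ c j‖ ^ 2) (fun j k => by
    rw [quasiPeriodic_extend, norm_mul, norm_pChar, one_mul]) (-n.1)
  simp only [extend_rep] at h
  rw [← h]
  refine Finset.sum_congr rfl fun r _ => ?_
  rw [shiftCoord, restr_apply, shiftSeq, norm_mul, norm_ec, one_mul, sub_eq_add_neg]

/-- `U_ħ(n / N)` acts on `𝓗_ħ(κ)` by `shiftCoord`. -/
lemma transl_synth (n : (Fin d → ℤ) × (Fin d → ℤ)) (c : Coord d N) :
    transl (hbar N) ((N : ℝ)⁻¹ • intPhase n) (synth N κ c) = synth N κ (shiftCoord N κ n c) := by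
  refine synth_eq_of_forall fun φ => ?_
  rw [extend_shiftCoord, transl_apply]
  have h := synth_apply (κ := κ) c
    (translS (hbar N) (-((N : ℝ)⁻¹ • intPhase n).1, ((N : ℝ)⁻¹ • intPhase n).2) φ)
  -- Reindexing by j - n_q undoes the translation of the test function: the node of j - n_q moved by
  -- n_q/N is the node of j.
  rw [← (Equiv.subRight n.1).hasSum_iff] at h
  refine h.congr_fun fun j => ?_
  simp only [Function.comp_apply, Equiv.subRight_apply, shiftSeq, translS_apply, sub_neg_eq_add]
  have hN := (natCast_pos N).ne'
  have e1 : node N κ (j - n.1) + ((N : ℝ)⁻¹ • intPhase n).1 = node N κ j := by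
    have := node_add (N := N) (κ := κ) (j - n.1) n.1
    rw [sub_add_cancel] at this
    exact this.symm
  have e2 : node N κ (j - n.1) = node N κ j - (N : ℝ)⁻¹ • intVec n.1 := by
    rw [eq_sub_iff_add_eq]; exact e1
  rw [e1, phaseFactor_eq_ec, e2]
  have e3 : (N : ℝ) * (inner ℝ ((N : ℝ)⁻¹ • intPhase n).2 (node N κ j - (N : ℝ)⁻¹ • intVec n.1) -
      inner ℝ (-((N : ℝ)⁻¹ • intPhase n).1) ((N : ℝ)⁻¹ • intPhase n).2 / 2) =
      inner ℝ (intVec n.2) (node N κ j) - inner ℝ (intVec n.1) (intVec n.2) / (2 * N) := by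
    simp only [Prod.smul_fst, Prod.smul_snd, intPhase, inner_smul_left, inner_smul_right,
      inner_sub_right, inner_neg_left, real_inner_comm (intVec n.1) (intVec n.2)]
    simp
    field_simp
    ring
  rw [e3]
  ring

lemma hbar_smul (n : (Fin d → ℤ) × (Fin d → ℤ)) :
    hbar N • ((2 * Real.pi) • intPhase n) = (N : ℝ)⁻¹ • intPhase n := by
  rw [smul_smul, hbar]
  congr 1
  have := natCast_pos N
  field_simp

/-- The Weyl quantization in coordinates. -/
lemma opW_synth {f : Phase d → ℂ} (hf : TorusSmooth f) (c : Coord d N) :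
    HasSum (fun n => sympFourier f ((2 * Real.pi) • intPhase n) • shiftCoord N κ n c)
      (coords N κ (opW N f (synth N κ c))) := by
  -- Absolute convergence holds in the finite-dimensional coordinate space; continuity of `synthCLM`
  -- carries the sum to the distributions, where `opW` is defined.
  have hs : Summable fun n => sympFourier f ((2 * Real.pi) • intPhase n) • shiftCoord N κ n c := by
    refine Summable.of_norm ?_
    simp only [norm_smul, norm_shiftCoord]
    exact hf.summable_sympFourier.norm.mul_right _
  have h := (synthCLM N κ).hasSum hs.hasSum
  have e : opW N f (synth N κ c) = synth N κ (∑' n, sympFourier f ((2 * Real.pi) • intPhase n) •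
      shiftCoord N κ n c) := by
    rw [opW, ← synthCLM_apply (∑' n, _), ← h.tsum_eq]
    refine tsum_congr fun n => ?_
    rw [hbar_smul, transl_synth, map_smul, synthCLM_apply]
  rw [e, coords_synth]
  exact hs.hasSum

/-- The combinations of the basis vectors lie in `𝓗_ħ(κ)`. -/
lemma synth_mem_hilb (c : Coord d N) : synth N κ c ∈ hilb N κ := by
  intro n
  -- A lattice translation is the translation by (N n)/N; it shifts sequences by a multiple of N, so
  -- quasi-periodicity makes it a scalar.
  have e : intPhase n = (N : ℝ)⁻¹ • intPhase ((N : ℤ) • n) := by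
    have := (natCast_pos N).ne'
    ext i <;> simp [intPhase, intVec]
  have hN := (natCast_pos N).ne'
  conv_lhs => rw [e]
  rw [transl_synth, ← synthCLM_apply, ← synthCLM_apply, ← map_smul]
  congr 1
  rw [exp_I_mul, shiftCoord]
  have : shiftSeq N κ ((N : ℤ) • n) (extend N κ c) =
      extend N κ (ec ((symp κ (intPhase n) + inner ℝ (intVec n.1) (intVec n.2) / (2 * hbar N)) /
        (2 * Real.pi)) • c) := by
    rw [extend_smul]
    funext j
    simp only [shiftSeq, Pi.smul_apply, smul_eq_mul]
    have h1 := quasiPeriodic_extend (κ := κ) c j (-n.1)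
    have h2 : j + (N : ℤ) • -n.1 = j - ((N : ℤ) • n).1 := by simp [sub_eq_add_neg]
    rw [h2] at h1
    rw [h1, ← mul_assoc, pChar, ← ec_add]
    congr 1
    -- The two phases differ by n_p · j - N n_q · n_p: the first term comes from N n_p · `node`, the
    -- second from the opposite signs of N n_q · n_p / 2.
    refine ec_eq_of_sub_int (∑ i, n.2 i * j i - N * ∑ i, n.1 i * n.2 i) ?_
    have h3 (m : Fin d → ℤ) : intVec ((N : ℤ) • m) = (N : ℝ) • intVec m := by
      ext i; simp [intVec]
    have h4 : (((∑ i, n.2 i * j i : ℤ)) : ℝ) = inner ℝ (intVec n.2) (intVec j) := by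
      rw [intVec_eq_latVec, inner_latVec]; push_cast; rfl
    have h5 : (((∑ i, n.1 i * n.2 i : ℤ)) : ℝ) = inner ℝ (intVec n.1) (intVec n.2) := by
      rw [intVec_eq_latVec, inner_latVec]; push_cast; rfl
    have h6 : intVec (-n.1) = - intVec n.1 := latVec_neg _
    push_cast [Int.cast_sub, Int.cast_mul]
    push_cast at h4 h5
    rw [h4, h5]
    simp only [Prod.smul_fst, Prod.smul_snd, h3, h6, node, symp, intPhase, hbar, inner_add_right,
      inner_smul_left, inner_smul_right, inner_neg_right, real_inner_comm κ.1 (intVec n.2)]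
    simp
    field_simp
    ring
  rw [this, restr_extend]

end Translations

/-! ### The basis vectors span `𝓗_ħ(κ)` -/

section Characters

variable {E : Type*} [NormedAddCommGroup E] [InnerProductSpace ℝ E]

lemma ec_eq_cexp_mul (t : ℝ) : ec t = Complex.exp ((2 * Real.pi * Complex.I) * t) := by
  rw [ec]; congr 1; push_cast; ring

lemma contDiff_ec : ContDiff ℝ ∞ ec := by
  simp only [funext ec_eq_cexp_mul]
  exact (contDiff_const.mul Complex.ofRealCLM.contDiff).cexp

lemma norm_iteratedFDeriv_ec (n : ℕ) (t : ℝ) :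
    ‖iteratedFDeriv ℝ n ec t‖ = (2 * Real.pi) ^ n := by
  rw [norm_iteratedFDeriv_eq_norm_iteratedDeriv, funext ec_eq_cexp_mul, iteratedDeriv_cexp_mul]
  simp only [← ec_eq_cexp_mul, norm_mul, norm_ec, norm_pow]
  simp [abs_of_pos Real.pi_pos]

lemma norm_iteratedFDeriv_ec_inner_le (y x : E) (n : ℕ) :
    ‖iteratedFDeriv ℝ n (fun x => ec (inner ℝ y x)) x‖ ≤ (2 * Real.pi * ‖y‖) ^ n := by
  have h := ContinuousLinearMap.iteratedFDeriv_comp_right (innerSL ℝ y) contDiff_ec x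
    (i := n) (mod_cast le_top)
  have h' : iteratedFDeriv ℝ n (fun x => ec (inner ℝ y x)) x = _ := h
  rw [h', mul_pow, ← norm_iteratedFDeriv_ec n (innerSL ℝ y x)]
  refine (ContinuousMultilinearMap.norm_compContinuousLinearMap_le _ _).trans ?_
  simp

lemma hasTemperateGrowth_ec_inner (y : E) : (fun x => ec (inner ℝ y x)).HasTemperateGrowth := by
  simp only [ec_eq_cexp_mul]
  exact hasTemperateGrowth_cexp _ (f := fun x => inner ℝ y x) (by fun_prop) (by simp)

/-- Multiplication of a Schwartz function by a character. -/
def charMul (y : E) : 𝓢(E, ℂ) →L[ℂ] 𝓢(E, ℂ) :=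
  SchwartzMap.smulLeftCLM ℂ fun x => ec (inner ℝ y x)

lemma charMul_apply (y : E) (φ : 𝓢(E, ℂ)) (x : E) : charMul y φ x = ec (inner ℝ y x) * φ x := by
  simp [charMul, SchwartzMap.smulLeftCLM_apply_apply (hasTemperateGrowth_ec_inner y)]

/-- Modulation costs only polynomial growth in the frequency, which rapidly decreasing Fourier
coefficients will absorb. -/
lemma seminorm_charMul_le (φ : 𝓢(E, ℂ)) (k n : ℕ) :
    ∃ C, 0 ≤ C ∧ ∀ y, SchwartzMap.seminorm ℂ k n (charMul y φ) ≤
      C * (1 + 2 * Real.pi * ‖y‖) ^ n := by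
  obtain ⟨A, hA, hφ⟩ := exists_decay φ k n
  refine ⟨∑ i ∈ Finset.range (n + 1), n.choose i * A, by positivity, fun y => ?_⟩
  refine SchwartzMap.seminorm_le_bound ℂ k n _ (by positivity) fun x => ?_
  have hfun : (⇑(charMul y φ) : E → ℂ) = fun x => ec (inner ℝ y x) * φ x :=
    funext (charMul_apply y φ)
  rw [hfun]
  have hmul := norm_iteratedFDeriv_mul_le (𝕜 := ℝ) (n := n) (N := n)
    (f := fun x => ec (inner ℝ y x)) (g := φ)
    ((contDiff_ec.comp (innerSL ℝ y).contDiff).of_le (mod_cast le_top)) (φ.smooth n) x le_rfl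
  refine (mul_le_mul_of_nonneg_left hmul (by positivity)).trans ?_
  rw [Finset.mul_sum, Finset.sum_mul]
  refine Finset.sum_le_sum fun i hi => ?_
  have hi' : i ≤ n := Nat.lt_succ_iff.mp (Finset.mem_range.mp hi)
  have h1 := norm_iteratedFDeriv_ec_inner_le y x i
  have h2 := hφ (n - i) (Nat.sub_le _ _) x
  have hy : 0 ≤ 2 * Real.pi * ‖y‖ := by positivity
  have h3 : (2 * Real.pi * ‖y‖) ^ i ≤ (1 + 2 * Real.pi * ‖y‖) ^ n :=
    (pow_le_pow_left₀ hy (by linarith) i).trans (pow_le_pow_right₀ (by linarith) hi')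
  have h4 : ‖x‖ ^ k ≤ (1 + ‖x‖) ^ k := by gcongr; linarith [norm_nonneg x]
  calc ‖x‖ ^ k * (↑(n.choose i) * ‖iteratedFDeriv ℝ i (fun x => ec (inner ℝ y x)) x‖ *
          ‖iteratedFDeriv ℝ (n - i) (⇑φ) x‖)
      ≤ (1 + ‖x‖) ^ k * (↑(n.choose i) * (1 + 2 * Real.pi * ‖y‖) ^ n *
          (A * ((1 + ‖x‖) ^ k)⁻¹)) := by
        gcongr
        exact h1.trans h3
    _ = _ := by
        have : (1 + ‖x‖) ≠ 0 := by positivity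
        field_simp

end Characters

/-! ### Elements of the Hilbert space are determined by N^d numbers -/

section Span

variable {d : ℕ} {N : ℕ+} {κ : Phase d}

/-- The defining relation at (-m, 0); passing to the transpose reverses the sign of the translation.
-/
lemma hilb_translate {T : 𝓢'(Config d, ℂ)} (hT : T ∈ hilb N κ) (m : Fin d → ℤ)
    (φ : 𝓢(Config d, ℂ)) :
    T (SchwartzMap.compSubConstCLM ℂ (latVec m) φ) = pChar κ m * T φ := by
  have h := congrArg (fun S : 𝓢'(Config d, ℂ) => S φ) (hT (-m, 0))
  have e : translS (hbar N) (-(intPhase (-m, (0 : Fin d → ℤ))).1, (intPhase (-m, 0)).2) φ =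
      SchwartzMap.compSubConstCLM ℂ (latVec m) φ := by
    ext q
    have : intVec (-m) = -latVec m := latVec_neg m
    rw [translS_apply, phaseFactor_eq_ec]
    simp [intPhase, this, intVec_eq_latVec]
  simp only [transl_apply, e] at h
  rw [h, exp_I_mul, pChar]
  change ec _ * T φ = _
  congr 2
  have h0 : intVec (0 : Fin d → ℤ) = 0 := latVec_zero
  have h1 : intVec (-m) = -intVec m := latVec_neg m
  simp [symp, intPhase, h0, h1]

lemma hilb_modulate {T : 𝓢'(Config d, ℂ)} (hT : T ∈ hilb N κ) (k : Fin d → ℤ)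
    (φ : 𝓢(Config d, ℂ)) :
    T (charMul ((N : ℝ) • latVec k) φ) = ec (inner ℝ κ.1 (intVec k) / (2 * Real.pi)) * T φ := by
  have h := congrArg (fun S : 𝓢'(Config d, ℂ) => S φ) (hT (0, k))
  have h0 : intVec (0 : Fin d → ℤ) = 0 := latVec_zero
  have e : translS (hbar N) (-(intPhase ((0 : Fin d → ℤ), k)).1, (intPhase (0, k)).2) φ =
      charMul ((N : ℝ) • latVec k) φ := by
    ext q
    rw [translS_apply, phaseFactor_eq_ec, charMul_apply]
    simp [intPhase, h0, intVec_eq_latVec, inner_smul_left]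
  simp only [transl_apply, e] at h
  rw [h, exp_I_mul]
  change ec _ * T φ = _
  congr 2
  simp [symp, intPhase, h0]

variable (d) in
/-- The partition function `latticeBump` as a Schwartz function. -/
def latticeBumpS : 𝓢(Config d, ℂ) :=
  hasCompactSupport_latticeBump.toSchwartzMap contDiff_latticeBump

lemma latticeBumpS_apply (x : Config d) : latticeBumpS d x = latticeBump (Fin d) x := rfl

variable (κ) in
/-- The localized exponentials `exp (i (2 π l - κ_p) · x) θ(x)`, dual to the Fourier coefficients
of quasi-periodic functions. -/
def localExp (l : Fin d → ℤ) : 𝓢(Config d, ℂ) :=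
  charMul (latVec l - (2 * Real.pi)⁻¹ • κ.2) (latticeBumpS d)

lemma hasSum_apply_tempered {α : Type*} {f : α → 𝓢(Config d, ℂ)} {G : 𝓢(Config d, ℂ)}
    (h : HasSum f G) (T : 𝓢'(Config d, ℂ)) : HasSum (fun i => T (f i)) (T G) :=
  h.map T.toLinearMap.toAddMonoidHom T.cont

/-- A quasi-periodic distribution is determined by its values on the localized exponentials. -/
lemma hilb_hasSum {T : 𝓢'(Config d, ℂ)} (hT : T ∈ hilb N κ) (φ : 𝓢(Config d, ℂ)) :
    ∃ a : (Fin d → ℤ) → ℂ, HasSum (fun l => a l * T (localExp κ l)) (T φ) := by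
  let θ := latticeBumpS d
  let α : Config d := (2 * Real.pi)⁻¹ • κ.2
  have hα (m : Fin d → ℤ) : pChar κ m = ec (inner ℝ α (latVec m)) := by
    rw [pChar, inner_smul_left, intVec_eq_latVec]
    congr 1
    simp [div_eq_inv_mul]
  -- Cut φ by the partition of unity, then move every piece to the support of θ by quasi-periodicity
  -- of T. This replaces φ by G₂, which is θ times the quasi-periodization of φ.
  obtain ⟨G₁, hG₁, hG₁'⟩ := exists_hasSum_translates θ φ (fun _ => 1) (by simp)
  have e₁ : G₁ = φ := by
    ext x
    refine (hG₁' x).unique ?_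
    have h := (Equiv.neg _).hasSum_iff.mpr ((hasSum_latticeBump x).mul_right (φ x))
    rw [one_mul] at h
    refine h.congr_fun fun m => ?_
    simp [latVec_neg, ← sub_eq_add_neg, θ, latticeBumpS_apply]
  obtain ⟨G₂, hG₂, hG₂'⟩ := exists_hasSum_translates φ θ (fun m => pChar κ (-m)) (by simp)
  have h₁ : HasSum (fun m => T (mulS (SchwartzMap.compSubConstCLM ℂ (latVec m) θ) φ)) (T φ) := by
    simpa only [one_smul, e₁] using hasSum_apply_tempered hG₁ T
  have h₂ : HasSum (fun m => T (pChar κ (-m) •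
      mulS (SchwartzMap.compSubConstCLM ℂ (latVec m) φ) θ)) (T G₂) :=
    hasSum_apply_tempered hG₂ T
  have e₂ : T φ = T G₂ := by
    refine h₁.unique ?_
    rw [← (Equiv.neg _).hasSum_iff] at h₂
    refine h₂.congr_fun fun m => ?_
    have : mulS (SchwartzMap.compSubConstCLM ℂ (latVec m) θ) φ =
        SchwartzMap.compSubConstCLM ℂ (latVec m)
          (mulS (SchwartzMap.compSubConstCLM ℂ (latVec (-m)) φ) θ) := by
      ext x
      simp [mulS_apply, latVec_neg, mul_comm]
    rw [this, hilb_translate hT, Function.comp_apply, map_smul, smul_eq_mul]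
    simp
  -- Multiplying by this character makes the quasi-periodization periodic; Poisson summation then
  -- expands G₂ in the localized exponentials.
  let φ' := charMul α φ
  let a : (Fin d → ℤ) → ℂ := fun l => FourierTransform.fourier φ' (latVec l)
  refine ⟨a, ?_⟩
  have hsum : ∀ k n, Summable fun l => SchwartzMap.seminorm ℂ k n (a l • localExp κ l) := by
    intro k n
    obtain ⟨C, hC, hb⟩ := seminorm_charMul_le θ k n
    obtain ⟨M, hM⟩ := exists_summable_weight (Fin d)
    -- The extra n orders absorb the growth of the seminorms of the modulated bump; M orders remain
    -- for summability.
    obtain ⟨A, hA, hF⟩ := exists_decay (FourierTransform.fourier φ') (M + n) 0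
    refine Summable.of_nonneg_of_le (fun _ => apply_nonneg _ _) (fun l => ?_)
      (hM.mul_left (A * (C * (1 + 2 * Real.pi * (1 + ‖α‖)) ^ n)))
    rw [map_smul_eq_mul]
    have h1 := hF 0 le_rfl (latVec l)
    rw [norm_iteratedFDeriv_zero] at h1
    have h2 := hb (latVec l - α)
    have h3 : 1 + 2 * Real.pi * ‖latVec l - α‖ ≤
        (1 + 2 * Real.pi * (1 + ‖α‖)) * (1 + ‖latVec l‖) := by
      have h4 := norm_sub_le (latVec l) α
      have h5 : 0 ≤ 2 * Real.pi * (‖α‖ * ‖latVec l‖) := by positivity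
      have h6 : 2 * Real.pi * ‖latVec l - α‖ ≤ 2 * Real.pi * (‖latVec l‖ + ‖α‖) := by gcongr
      have h7 : 0 ≤ 2 * Real.pi := by positivity
      nlinarith [norm_nonneg (latVec l)]
    calc ‖a l‖ * SchwartzMap.seminorm ℂ k n (localExp κ l)
        ≤ (A * ((1 + ‖latVec l‖) ^ (M + n))⁻¹) *
          (C * ((1 + 2 * Real.pi * (1 + ‖α‖)) * (1 + ‖latVec l‖)) ^ n) := by
          refine mul_le_mul h1 (h2.trans ?_) (apply_nonneg _ _) (by positivity)
          gcongr
      _ = _ := by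
          have : 1 + ‖latVec l‖ ≠ 0 := by positivity
          rw [weight, pow_add, mul_pow]
          field_simp
  obtain ⟨G₃, hG₃, hG₃'⟩ := exists_hasSum_schwartz _ hsum
  have e₃ : G₂ = G₃ := by
    ext x
    refine HasSum.unique ?_ (hG₃' x)
    have hp := (hasSum_poisson φ' x).mul_left (ec (-inner ℝ α x) * θ x)
    have hval : G₂ x = ec (-inner ℝ α x) * θ x * ∑' m, φ' (x + latVec m) := by
      rw [← tsum_mul_left]
      refine ((Equiv.neg _).hasSum_iff.mpr (hG₂' x)).tsum_eq.symm.trans (tsum_congr fun m => ?_)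
      simp only [Function.comp_apply, Equiv.neg_apply, neg_neg, latVec_neg, sub_neg_eq_add, φ',
        charMul_apply, inner_add_right, ec_add, hα]
      rw [ec_neg]
      have := ec_ne_zero (inner ℝ α x)
      field_simp
    rw [hval]
    refine hp.congr_fun fun l => ?_
    rw [smul_apply, localExp, charMul_apply, inner_sub_left, ec_sub, smul_eq_mul]
    ring
  rw [e₂, e₃]
  refine (hasSum_apply_tempered hG₃ T).congr_fun fun l => ?_
  exact (map_smul T (a l) (localExp κ l)).symm

/-- Changing l by N k multiplies the test function by a character that T turns into a scalar, so
only the residues of l modulo N matter. -/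
lemma hilb_localExp {T : 𝓢'(Config d, ℂ)} (hT : T ∈ hilb N κ) (l k : Fin d → ℤ) :
    T (localExp κ (l + (N : ℤ) • k)) =
      ec (inner ℝ κ.1 (intVec k) / (2 * Real.pi)) * T (localExp κ l) := by
  rw [← hilb_modulate hT]
  congr 1
  ext x
  rw [charMul_apply, localExp, localExp, charMul_apply, charMul_apply, ← mul_assoc, ← ec_add,
    ← inner_add_left]
  congr 3
  have : latVec ((N : ℤ) • k) = (N : ℝ) • latVec k := by ext i; simp
  rw [latVec_add, this]
  abel

/-- Every element of `𝓗_ħ(κ)` is a combination of the basis vectors. -/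
theorem exists_eq_synth {T : 𝓢'(Config d, ℂ)} (hT : T ∈ hilb N κ) : ∃ c, T = synth N κ c := by
  -- J is injective on the Hilbert space, so J composed with `synth` is an injective endomorphism of
  -- a finite-dimensional space, hence onto; T and a suitable combination of basis vectors then have
  -- the same image under J.
  let J : 𝓢'(Config d, ℂ) → Coord d N := fun T => WithLp.toLp 2 fun r => T (localExp κ (rep r))
  have hJ {S : 𝓢'(Config d, ℂ)} (hS : S ∈ hilb N κ) (h0 : J S = 0) : S = 0 := by
    ext φ
    obtain ⟨a, ha⟩ := hilb_hasSum hS φ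
    refine ha.unique ?_
    have : (fun l => a l * S (localExp κ l)) = fun _ => 0 := by
      funext l
      obtain ⟨k, r, rfl⟩ := eq_rep_add N l
      have h1 : S (localExp κ (rep r)) = 0 := congrArg (fun v : Coord d N => v r) h0
      rw [hilb_localExp hS, h1, mul_zero, mul_zero]
    rw [this]
    exact hasSum_zero
  let L : Coord d N →ₗ[ℂ] Coord d N :=
    { toFun := fun c => J (synthCLM N κ c)
      map_add' := fun c c' => by rw [map_add]; rfl
      map_smul' := fun a c => by rw [map_smul]; rfl }
  have hL : Function.Injective L := by
    rw [← LinearMap.ker_eq_bot, LinearMap.ker_eq_bot']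
    intro c hc
    have h1 : synth N κ c = 0 := hJ (synth_mem_hilb c) hc
    have h2 : synth N κ 0 = 0 := (synthCLM N κ).map_zero
    exact synth_injective (h1.trans h2.symm)
  obtain ⟨c, hc⟩ := (LinearMap.injective_iff_surjective.mp hL) (J T)
  refine ⟨c, ?_⟩
  rw [← sub_eq_zero]
  refine hJ (Submodule.sub_mem _ hT (synth_mem_hilb c)) ?_
  have h1 : J (T - synth N κ c) = J T - J (synth N κ c) := rfl
  rw [h1, sub_eq_zero]
  exact hc.symm

end Span

/-! ### Gaussians are Schwartz functions -/

section Gaussian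

variable {E : Type*} [NormedAddCommGroup E] [InnerProductSpace ℝ E]

lemma pow_mul_exp_neg_sq_le {c : ℝ} (hc : 0 < c) (m : ℕ) :
    ∃ C, 0 ≤ C ∧ ∀ r : ℝ, 0 ≤ r → (1 + r) ^ m * Real.exp (-c * r ^ 2) ≤ C := by
  refine ⟨Real.exp c * (m.factorial * (2 / c) ^ m), by positivity, fun r hr => ?_⟩
  -- With s = c(1 + r)²/2, the exponential loses at most a factor e^c, and s^m / m! ≤ e^s dominates
  -- the power.
  have h1 : -c * r ^ 2 ≤ c + -(c * (1 + r) ^ 2 / 2) := by nlinarith [mul_nonneg hc.le (sq_nonneg (r - 1))]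
  have h2 := Real.pow_div_factorial_le_exp (x := c * (1 + r) ^ 2 / 2) (by positivity) m
  have h3 : (1 + r) ^ m ≤ (2 / c) ^ m * (c * (1 + r) ^ 2 / 2) ^ m := by
    rw [← mul_pow]
    refine pow_le_pow_left₀ (by positivity) ?_ m
    have : 2 / c * (c * (1 + r) ^ 2 / 2) = (1 + r) ^ 2 := by field_simp
    rw [this]
    nlinarith
  rw [div_le_iff₀ (by positivity)] at h2
  calc (1 + r) ^ m * Real.exp (-c * r ^ 2)
      ≤ ((2 / c) ^ m * (Real.exp (c * (1 + r) ^ 2 / 2) * m.factorial)) *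
        Real.exp (c + -(c * (1 + r) ^ 2 / 2)) := by
        gcongr
        exact h3.trans (by gcongr)
    _ = _ := by
        rw [Real.exp_add, Real.exp_neg]
        have := (Real.exp_pos (c * (1 + r) ^ 2 / 2)).ne'
        field_simp

/-- The composition bound for derivatives gives a polynomial in |x| times the Gaussian, because
every derivative of s ↦ exp(-cs) keeps the exponential factor. -/
lemma decay_cexp_neg_mul_sq_norm {c : ℝ} (hc : 0 < c) (k n : ℕ) :
    ∃ C, ∀ x : E, ‖x‖ ^ k * ‖iteratedFDeriv ℝ n
      (fun x : E => Complex.exp (((-c : ℝ) : ℂ) * ((‖x‖ ^ 2 : ℝ) : ℂ))) x‖ ≤ C := by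
  obtain ⟨p, D, hD0, hD⟩ :=
    (Function.hasTemperateGrowth_norm_sq E).norm_iteratedFDeriv_le_uniform n
  obtain ⟨B, hB0, hB⟩ := pow_mul_exp_neg_sq_le hc (k + p * n)
  refine ⟨n.factorial * (1 + c) ^ n * (1 + D) ^ n * B, fun x => ?_⟩
  have hg : ContDiff ℝ ∞ (fun s : ℝ => Complex.exp (((-c : ℝ) : ℂ) * s)) :=
    (contDiff_const.mul Complex.ofRealCLM.contDiff).cexp
  have hf : ContDiff ℝ ∞ (fun x : E => ‖x‖ ^ 2) := contDiff_norm_sq ℝ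
  have hx : 1 ≤ (1 + ‖x‖) ^ p := one_le_pow₀ (by linarith [norm_nonneg x])
  have h := norm_iteratedFDeriv_comp_le hg hf (n := n) (mod_cast le_top) x
    (C := (1 + c) ^ n * Real.exp (-c * ‖x‖ ^ 2)) (D := (1 + D) * (1 + ‖x‖) ^ p)
    (fun i hi => by
      rw [norm_iteratedFDeriv_eq_norm_iteratedDeriv, iteratedDeriv_cexp_mul, norm_mul, norm_pow,
        Complex.norm_exp]
      have e1 : ‖((-c : ℝ) : ℂ)‖ = c := by simp [abs_of_pos hc]
      rw [e1]
      have e2 : (((-c : ℝ) : ℂ) * ((‖x‖ ^ 2 : ℝ) : ℂ)).re = -c * ‖x‖ ^ 2 := by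
        rw [← Complex.ofReal_mul, Complex.ofReal_re]
      rw [e2]
      gcongr
      exact (pow_le_pow_left₀ hc.le (by linarith) i).trans
        (pow_le_pow_right₀ (by linarith) hi))
    (fun i hi1 hi => by
      refine (hD i hi x).trans ?_
      -- The composition bound wants the i-th derivative below an i-th power; a base at least 1 only
      -- grows under powers i ≥ 1.
      have h1 : 1 ≤ (1 + D) * (1 + ‖x‖) ^ p := by nlinarith
      refine le_trans ?_ (le_self_pow₀ h1 (by omega))
      gcongr
      linarith)
  have hfun : (fun x : E => Complex.exp (((-c : ℝ) : ℂ) * ((‖x‖ ^ 2 : ℝ) : ℂ))) =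
    (fun s : ℝ => Complex.exp (((-c : ℝ) : ℂ) * s)) ∘ fun x : E => ‖x‖ ^ 2 := rfl
  rw [hfun]
  have h4 : ‖x‖ ^ k ≤ (1 + ‖x‖) ^ k := by gcongr; linarith [norm_nonneg x]
  calc _ ≤ (1 + ‖x‖) ^ k * (n.factorial * ((1 + c) ^ n * Real.exp (-c * ‖x‖ ^ 2)) *
        ((1 + D) * (1 + ‖x‖) ^ p) ^ n) := by gcongr
    _ = n.factorial * (1 + c) ^ n * (1 + D) ^ n *
        ((1 + ‖x‖) ^ (k + p * n) * Real.exp (-c * ‖x‖ ^ 2)) := by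
        rw [pow_add, pow_mul, mul_pow]; ring
    _ ≤ _ := by
        gcongr
        exact hB _ (norm_nonneg x)

variable (d : ℕ) (N : ℕ+)

/-- The Gaussian `η_ħ` as a Schwartz function. -/
def gaussianS : 𝓢(Config d, ℂ) where
  toFun := gaussian d N
  smooth' := (hasTemperateGrowth_gaussian d N).1
  decay' := by
    intro k n
    have hc : 0 < 1 / (2 * hbar N) := by have := hbar_pos N; positivity
    obtain ⟨C, hC⟩ := decay_cexp_neg_mul_sq_norm (E := Config d) hc k n
    refine ⟨‖((((Real.pi * hbar N) ^ (-(d : ℝ) / 4) : ℝ)) : ℂ)‖ * C, fun x => ?_⟩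
    have hsm : ContDiff ℝ n (fun x : Config d =>
        Complex.exp (((-(1 / (2 * hbar N)) : ℝ) : ℂ) * ((‖x‖ ^ 2 : ℝ) : ℂ))) :=
      (contDiff_const.mul (Complex.ofRealCLM.contDiff.comp (contDiff_norm_sq ℝ))).cexp
    have h4 : gaussian d N = ((((Real.pi * hbar N) ^ (-(d : ℝ) / 4) : ℝ)) : ℂ) •
        fun q : Config d =>
          Complex.exp (((-(1 / (2 * hbar N)) : ℝ) : ℂ) * ((‖q‖ ^ 2 : ℝ) : ℂ)) := by
      funext q
      simp only [gaussian, Pi.smul_apply, smul_eq_mul, Complex.ofReal_mul, Complex.ofReal_exp]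
      congr 2
      push_cast
      ring
    rw [h4, iteratedFDeriv_const_smul_apply hsm.contDiffAt, norm_smul, mul_left_comm]
    gcongr
    exact hC x

lemma gaussianS_apply (q : Config d) : gaussianS d N q = gaussian d N q := rfl

lemma gaussianDist_eq : gaussianDist d N = (gaussianS d N : 𝓢'(Config d, ℂ)) := by
  ext φ
  rw [SchwartzMap.coe_apply]
  exact Function.HasTemperateGrowth.toTemperedDistribution_apply volume
    (hasTemperateGrowth_gaussian d N) φ

end Gaussian

/-! ### Projection of Schwartz functions to `𝓗_ħ(κ)` -/

section Project

variable {d : ℕ} {N : ℕ+} {κ : Phase d}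

variable (N κ) in
/-- The quasi-periodization of a Schwartz function, sampled at the nodes. -/
def projSeq (ψ : 𝓢(Config d, ℂ)) (j : Fin d → ℤ) : ℂ :=
  normConst d N * ∑' m : Fin d → ℤ, pChar κ m * ψ (node N κ j - intVec m)

lemma summable_pChar_mul (ψ : 𝓢(Config d, ℂ)) (x : Config d) :
    Summable fun m : Fin d → ℤ => pChar κ m * ψ (x - intVec m) := by
  refine Summable.of_norm ?_
  simp only [norm_mul, norm_pChar, one_mul]
  have := (Equiv.neg _).summable_iff.mpr (summable_translate ψ x).norm
  refine this.congr fun m => ?_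
  simp [latVec_neg, intVec_eq_latVec, sub_eq_add_neg]

lemma quasiPeriodic_projSeq (ψ : 𝓢(Config d, ℂ)) : QuasiPeriodic N κ (projSeq N κ ψ) := by
  intro j k
  rw [projSeq, ← (Equiv.addRight k).tsum_eq fun m => pChar κ m *
    ψ (node N κ (j + (N : ℤ) • k) - intVec m), projSeq, mul_left_comm,
    ← tsum_mul_left (a := pChar κ k)]
  refine congrArg _ ?_
  refine tsum_congr fun m => ?_
  rw [Equiv.coe_addRight, pChar_add, node_add_smul]
  have : node N κ j + intVec k - intVec (m + k) = node N κ j - intVec m := by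
    simp only [intVec_eq_latVec, latVec_add]
    abel
  rw [this]
  ring

variable (N κ) in
/-- The coordinates of the projection of a Schwartz function. -/
def projCoord (ψ : 𝓢(Config d, ℂ)) : Coord d N := restr N (projSeq N κ ψ)

lemma transl_config (m : Fin d → ℤ) (ψ : 𝓢(Config d, ℂ)) :
    transl (hbar N) (intVec m, 0) (ψ : 𝓢'(Config d, ℂ)) =
      (SchwartzMap.compSubConstCLM ℂ (latVec m) ψ : 𝓢(Config d, ℂ)) := by
  rw [transl_coe]
  congr 1
  ext q
  rw [translS_apply, phaseFactor_eq_ec]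
  simp [intVec_eq_latVec]

lemma transl_momentum (n : Fin d → ℤ) (T : 𝓢'(Config d, ℂ)) (φ : 𝓢(Config d, ℂ)) :
    transl (hbar N) (0, intVec n) T φ = T (charMul ((N : ℝ) • latVec n) φ) := by
  rw [transl_apply]
  congr 1
  ext q
  rw [translS_apply, phaseFactor_eq_ec, charMul_apply]
  simp [intVec_eq_latVec, inner_smul_left]

/-- Proves convergence of the inner series in `project`, whose `tsum` would otherwise be a default
value. Of the decay of ψ, M orders are spent on Peetre's inequality and K orders on integrability.
-/
lemma exists_inner_sum (ψ : 𝓢(Config d, ℂ)) :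
    ∃ S : 𝓢'(Config d, ℂ), HasSum (fun m : Fin d → ℤ => pChar κ m •
      transl (hbar N) (intVec m, 0) (ψ : 𝓢'(Config d, ℂ))) S := by
  obtain ⟨M, hM⟩ := exists_summable_weight (Fin d)
  set K := (volume : Measure (Config d)).integrablePower
  obtain ⟨A, hA, hψ⟩ := exists_decay ψ (M + K) 0
  have hint := Measure.integrable_pow_neg_integrablePower (volume : Measure (Config d))
  set I := ∫ q : Config d, (1 + ‖q‖) ^ (-(K : ℝ)) with hI
  have hI0 : 0 ≤ I := integral_nonneg fun q => by positivity
  refine exists_tempered_of_bound _ (fun m => 2 ^ M * (A * I) * weight M m) (hM.mul_left _)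
    (Finset.Iic (M, 0)) fun m φ => ?_
  rw [transl_config]
  set p := (Finset.Iic (M, 0)).sup (schwartzSeminormFamily ℂ (Config d) ℂ) φ
  have hp : 0 ≤ p := apply_nonneg _ _
  have hw := weight_nonneg M m
  change ‖pChar κ m * ((SchwartzMap.compSubConstCLM ℂ (latVec m) ψ : 𝓢(Config d, ℂ)) :
      𝓢'(Config d, ℂ)) φ‖ ≤ _
  rw [norm_mul, norm_pChar, one_mul, SchwartzMap.coe_apply]
  have hb (q : Config d) : ‖φ q • (SchwartzMap.compSubConstCLM ℂ (latVec m) ψ) q‖ ≤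
      2 ^ M * p * A * weight M m * (1 + ‖q - latVec m‖) ^ (-(K : ℝ)) := by
    rw [norm_smul, SchwartzMap.compSubConstCLM_apply]
    have h1 := norm_le_sup_seminorm_mul φ M q
    have h2 := hψ 0 le_rfl (q - latVec m)
    rw [norm_iteratedFDeriv_zero] at h2
    have h3 : ((1 + ‖q‖) ^ M)⁻¹ ≤ (1 + ‖q - latVec m‖) ^ M * weight M m := by
      have := inv_le_mul_weight M m (q - latVec m)
      rwa [add_sub_cancel] at this
    have hne : 1 + ‖q - latVec m‖ ≠ 0 := by positivity
    calc _ ≤ (2 ^ M * p * ((1 + ‖q - latVec m‖) ^ M * weight M m)) *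
          (A * ((1 + ‖q - latVec m‖) ^ (M + K))⁻¹) := by
          refine mul_le_mul (h1.trans ?_) h2 (norm_nonneg _) (by positivity)
          gcongr
      _ = _ := by
          rw [Real.rpow_neg (by positivity), Real.rpow_natCast, pow_add]
          field_simp
  have h1 : ∫ q : Config d, (1 + ‖q - latVec m‖) ^ (-(K : ℝ)) = I :=
    integral_sub_right_eq_self (fun q : Config d => (1 + ‖q‖) ^ (-(K : ℝ))) (latVec m)
  calc _ ≤ ∫ q, 2 ^ M * p * A * weight M m * (1 + ‖q - latVec m‖) ^ (-(K : ℝ)) :=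
        norm_integral_le_of_norm_le ((hint.comp_sub_right (latVec m)).const_mul _)
          (Eventually.of_forall hb)
    _ = _ := by rw [integral_const_mul, h1]; ring

/-- Poisson summation on the nodes. -/
lemma hasSum_poisson_node (G : 𝓢(Config d, ℂ)) :
    HasSum (fun n : Fin d → ℤ =>
      ec (-(inner ℝ κ.1 (intVec n) / (2 * Real.pi))) * ∫ q, charMul ((N : ℝ) • latVec n) G q)
      (((N : ℝ) ^ d : ℝ)⁻¹ * ∑' j, G (node N κ j)) := by
  have hN := natCast_pos N
  set a : Config d := (2 * Real.pi * (N : ℝ))⁻¹ • κ.1 with ha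
  let e : Config d ≃L[ℝ] Config d :=
    ContinuousLinearEquiv.smulLeft (Units.mk0 ((N : ℝ)⁻¹) (inv_ne_zero hN.ne'))
  have he (y : Config d) : e y = (N : ℝ)⁻¹ • y := rfl
  -- Rescaled so that its value at the lattice point j is G at the j-th node; the dilation yields
  -- N^d and the offset a yields the κ_q phase.
  let H : 𝓢(Config d, ℂ) := SchwartzMap.compCLMOfContinuousLinearEquiv ℂ e
    (SchwartzMap.compSubConstCLM ℂ (-a) G)
  have hH (y : Config d) : H y = G ((N : ℝ)⁻¹ • y + a) := by
    simp [H, he]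
  have hF (n : Fin d → ℤ) : FourierTransform.fourier H (latVec (-n)) = ((N : ℝ) ^ d : ℝ) *
      (ec (-(inner ℝ κ.1 (intVec n) / (2 * Real.pi))) *
        ∫ q, charMul ((N : ℝ) • latVec n) G q) := by
    rw [fourier_latVec]
    let f : Config d → ℂ := fun q => ec (-(inner ℝ κ.1 (intVec n) / (2 * Real.pi))) *
      charMul ((N : ℝ) • latVec n) G (q + a)
    have hf (y : Config d) : ec (-inner ℝ (latVec (-n)) y) * H y = f ((N : ℝ)⁻¹ • y) := by
      simp only [f, hH, charMul_apply, ← mul_assoc, ← ec_add]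
      congr 2
      have hne : (N : ℝ) ≠ 0 := hN.ne'
      simp only [latVec_neg, inner_neg_left, neg_neg, inner_add_right, inner_smul_left,
        inner_smul_right, ha, intVec_eq_latVec, real_inner_comm κ.1 (latVec n)]
      simp
      field_simp
      ring
    simp only [hf]
    rw [Measure.integral_comp_inv_smul_of_nonneg _ _ hN.le, finrank_euclideanSpace,
      Fintype.card_fin]
    simp only [f]
    rw [integral_const_mul, integral_add_right_eq_self (fun q => charMul ((N : ℝ) • latVec n) G q)]
    simp
  have hp := hasSum_poisson H 0
  simp only [inner_zero_right, ec_zero, mul_one, zero_add] at hp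
  rw [← (Equiv.neg _).hasSum_iff] at hp
  have hp' := hp.mul_left ((((N : ℝ) ^ d : ℝ)⁻¹ : ℝ) : ℂ)
  have hsum : ∑' j, G (node N κ j) = ∑' m, H (latVec m) := by
    refine tsum_congr fun j => ?_
    rw [hH]; rfl
  rw [hsum]
  refine hp'.congr_fun fun n => ?_
  simp only [Function.comp_apply, Equiv.neg_apply]
  rw [hF, ← mul_assoc, ← Complex.ofReal_mul, inv_mul_cancel₀ (by positivity), Complex.ofReal_one,
    one_mul]

/-- The projection of a Schwartz function to `𝓗_ħ(κ)`. -/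
theorem project_coe (ψ : 𝓢(Config d, ℂ)) :
    project N κ (ψ : 𝓢'(Config d, ℂ)) = synth N κ (projCoord N κ ψ) := by
  obtain ⟨S, hS⟩ := exists_inner_sum (N := N) (κ := κ) ψ
  have hpre (m : Fin d → ℤ) :
      Complex.exp (Complex.I * (inner ℝ κ.2 (intVec m) : ℝ)) = pChar κ m := exp_I_mul _
  -- The inner sum is the quasi-periodization of ψ as a function; G is its product with φ, which is
  -- Schwartz.
  have hG (φ : 𝓢(Config d, ℂ)) : ∃ G : 𝓢(Config d, ℂ), (S φ = ∫ q, G q) ∧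
      ∀ x, HasSum (fun m => pChar κ m * (ψ (x - latVec m) * φ x)) (G x) := by
    obtain ⟨G, hG, hG'⟩ := exists_hasSum_translates ψ φ (pChar κ) fun m => (norm_pChar κ m).le
    refine ⟨G, ?_, hG'⟩
    have h1 := hasSum_tempered.mp hS φ
    have h2 := (SchwartzMap.integralCLM ℂ (volume : Measure (Config d))).hasSum hG
    refine h1.unique ?_
    rw [← SchwartzMap.integralCLM_apply (𝕜 := ℂ)]
    refine h2.congr_fun fun m => ?_
    rw [transl_config, map_smul, SchwartzMap.integralCLM_apply]
    change pChar κ m * ((SchwartzMap.compSubConstCLM ℂ (latVec m) ψ : 𝓢(Config d, ℂ)) :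
      𝓢'(Config d, ℂ)) φ = pChar κ m * _
    rw [SchwartzMap.coe_apply]
    congr 1
    refine integral_congr_ae (Eventually.of_forall fun x => ?_)
    simp [mulS_apply, mul_comm]
  -- Modulating φ modulates G, so the outer sum is a Fourier series that Poisson summation collapses
  -- to Dirac masses at the nodes.
  have hproj : HasSum (fun n : Fin d → ℤ =>
      Complex.exp (-Complex.I * (inner ℝ κ.1 (intVec n) : ℝ)) •
        transl (hbar N) (0, intVec n) S) (synth N κ (projCoord N κ ψ)) := by
    rw [hasSum_tempered]
    intro φ
    obtain ⟨G, hGS, hGx⟩ := hG φ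
    have hE (n : Fin d → ℤ) : S (charMul ((N : ℝ) • latVec n) φ) =
        ∫ q, charMul ((N : ℝ) • latVec n) G q := by
      obtain ⟨G', hGS', hGx'⟩ := hG (charMul ((N : ℝ) • latVec n) φ)
      rw [hGS']
      congr 1
      funext x
      refine (hGx' x).unique ?_
      rw [charMul_apply, charMul_apply]
      refine ((hGx x).mul_left (ec (inner ℝ ((N : ℝ) • latVec n) x))).congr_fun fun m => ?_
      ring
    have hval : synth N κ (projCoord N κ ψ) φ = ((N : ℝ) ^ d : ℝ)⁻¹ * ∑' j, G (node N κ j) := by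
      have h := synth_apply (κ := κ) (projCoord N κ ψ) φ
      rw [projCoord, (quasiPeriodic_projSeq ψ).extend_restr] at h
      rw [projCoord, ← h.tsum_eq, ← tsum_mul_left]
      refine tsum_congr fun j => ?_
      -- The N^{-d} from Poisson splits into two factors `normConst`: one inside `projSeq`, one
      -- inside `synth`.
      rw [← (hGx (node N κ j)).tsum_eq, projSeq, ← normConst_sq]
      simp only [← mul_assoc]
      rw [tsum_mul_right]
      push_cast
      simp only [intVec_eq_latVec]
      ring
    rw [hval]
    refine (hasSum_poisson_node G).congr_fun fun n => ?_
    rw [exp_neg_I_mul]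
    change ec _ * transl (hbar N) (0, intVec n) S φ = _
    rw [transl_momentum, hE]
  rw [project]
  simp only [hpre, hS.tsum_eq]
  exact hproj.tsum_eq

/-- The scalar product of a projected Schwartz function with an element of `𝓗_ħ(κ)`. -/
theorem inner_projCoord (ψ : 𝓢(Config d, ℂ)) (c : Coord d N) :
    HasSum (fun j => (normConst d N : ℂ) *
      (extend N κ c j * (starRingEnd ℂ) (ψ (node N κ j)))) (inner ℂ (projCoord N κ ψ) c) := by
  have hs : Summable fun j => (normConst d N : ℂ) *
      (extend N κ c j * (starRingEnd ℂ) (ψ (node N κ j))) := by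
    refine Summable.mul_left _ (Summable.of_norm ?_)
    simpa only [norm_mul, RCLike.norm_conj] using
      (summable_node (N := N) (κ := κ) (norm_extend_le (κ := κ) c) ψ).norm
  have h1 := (divEquiv N).symm.summable_iff.mpr hs
  -- Unfolding: the periodization in `projSeq` joins the finite sum over residues to give a sum over
  -- all of ℤ^d.
  have hrow (r : Fin d → Fin (N : ℕ)) : HasSum (fun k => (normConst d N : ℂ) *
      (extend N κ c (rep r + (N : ℤ) • k) *
        (starRingEnd ℂ) (ψ (node N κ (rep r + (N : ℤ) • k)))))
      (c r * (starRingEnd ℂ) (projCoord N κ ψ r)) := by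
    have h := (summable_pChar_mul (κ := κ) ψ (node N κ (rep r))).hasSum.mul_left
      (normConst d N : ℂ)
    have h' := ((Complex.hasSum_conj' (f := _) (x := _)).mpr h).mul_left (c r)
    rw [← (Equiv.neg _).hasSum_iff] at h'
    have e : projCoord N κ ψ r = projSeq N κ ψ (rep r) := rfl
    rw [e, projSeq]
    refine h'.congr_fun fun k => ?_
    rw [extend_rep_add, node_add_smul]
    have : intVec (-k) = -intVec k := latVec_neg k
    simp only [Function.comp_apply, Equiv.neg_apply, pChar_neg, map_mul, Complex.conj_conj, this,
      sub_neg_eq_add, Complex.conj_ofReal]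
    ring
  rw [← (divEquiv N).symm.hasSum_iff]
  refine h1.hasSum_iff.mpr ?_
  rw [h1.tsum_prod' fun k => (hasSum_fintype _).summable]
  simp only [Function.comp_apply, divEquiv_symm_apply, tsum_fintype]
  rw [Summable.tsum_finsetSum fun r _ => (hrow r).summable, PiLp.inner_apply]
  refine Finset.sum_congr rfl fun r _ => ?_
  rw [(hrow r).tsum_eq]
  simp [RCLike.inner_apply]

end Project

/-! ### Coherent states and the anti-Wick symbol of the translations -/

section AntiWick

variable {d : ℕ} {N : ℕ+} {κ : Phase d}

variable (N) in
/-- The translated Gaussian `U_ħ(a) η_ħ`. -/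
def wave (a : Phase d) : 𝓢(Config d, ℂ) := translS (hbar N) a (gaussianS d N)

lemma wave_apply (a : Phase d) (q : Config d) :
    wave N a q = ec (N * (inner ℝ a.2 q - inner ℝ a.1 a.2 / 2)) * gaussian d N (q - a.1) := by
  rw [wave, translS_apply, phaseFactor_eq_ec, gaussianS_apply]

variable (N κ) in
/-- The coordinates of the coherent state. -/
def cohCoord (a : Phase d) : Coord d N := projCoord N κ (wave N a)

lemma coherent_eq (a : Phase d) : coherent N κ a = synth N κ (cohCoord N κ a) := by
  rw [coherent, gaussianDist_eq, transl_coe, project_coe]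
  rfl

lemma coords_coherent (a : Phase d) : coords N κ (coherent N κ a) = cohCoord N κ a := by
  rw [coherent_eq, coords_synth]

lemma conj_gaussian (q : Config d) : (starRingEnd ℂ) (gaussian d N q) = gaussian d N q :=
  Complex.conj_ofReal _

variable (N κ) in
-- After dilation by N the nodes become lattice translates of N(a - y), so the bound for translates
-- on a ball applies.
lemma exists_gaussian_node_bound (R : ℝ) : ∃ v : (Fin d → ℤ) → ℝ, Summable v ∧
    ∀ y : Config d, ‖y‖ ≤ R → ∀ j, ‖gaussian d N (node N κ j - y)‖ ≤ v j := by
  have hN := natCast_pos N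
  set a : Config d := (2 * Real.pi * (N : ℝ))⁻¹ • κ.1 with ha
  let e : Config d ≃L[ℝ] Config d :=
    ContinuousLinearEquiv.smulLeft (Units.mk0 ((N : ℝ)⁻¹) (inv_ne_zero hN.ne'))
  have he (y : Config d) : e y = (N : ℝ)⁻¹ • y := rfl
  obtain ⟨v, hv, hb⟩ := exists_translate_bound
    (SchwartzMap.compCLMOfContinuousLinearEquiv ℂ e (gaussianS d N)) (N * (‖a‖ + R))
  refine ⟨v, hv, fun y hy j => ?_⟩
  have h := hb ((N : ℝ) • (a - y)) (by
    rw [norm_smul, Real.norm_of_nonneg hN.le]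
    have := norm_sub_le a y
    gcongr
    linarith) j
  rw [SchwartzMap.compCLMOfContinuousLinearEquiv_apply, Function.comp_apply, he, smul_add,
    smul_smul, inv_mul_cancel₀ hN.ne', one_smul, gaussianS_apply] at h
  convert h using 3
  simp only [node, intVec_eq_latVec, ← ha]
  abel

variable (N κ) in
/-- The position part of the terms of `⟨η^a, c⟩`. -/
def overlapTerm (c : Coord d N) (j : Fin d → ℤ) (y : Config d) : ℂ :=
  normConst d N * (extend N κ c j * gaussian d N (node N κ j - y))

lemma continuous_gaussian : Continuous (gaussian d N) := (gaussianS d N).continuous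

@[fun_prop] lemma continuous_overlapTerm (c : Coord d N) (j : Fin d → ℤ) :
    Continuous (overlapTerm N κ c j) :=
  continuous_const.mul (continuous_const.mul
    (continuous_gaussian.comp (continuous_const.sub continuous_id)))

variable (κ) in
lemma exists_overlapTerm_bound (c : Coord d N) (R : ℝ) : ∃ v : (Fin d → ℤ) → ℝ, Summable v ∧
    (∀ j, 0 ≤ v j) ∧ ∀ y : Config d, ‖y‖ ≤ R → ∀ j, ‖overlapTerm N κ c j y‖ ≤ v j := by
  obtain ⟨v, hv, hb⟩ := exists_gaussian_node_bound N κ R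
  refine ⟨fun j => normConst d N * (‖c‖ * |v j|), (hv.abs.mul_left _).mul_left _, fun j => ?_,
    fun y hy j => ?_⟩
  · have := normConst_pos (d := d) (N := N)
    positivity
  · rw [overlapTerm, norm_mul, norm_mul, Complex.norm_real, Real.norm_of_nonneg normConst_pos.le]
    exact mul_le_mul_of_nonneg_left (mul_le_mul (norm_extend_le c j)
      ((hb y hy j).trans (le_abs_self _)) (norm_nonneg _) (norm_nonneg _)) normConst_pos.le

/-- The overlap `⟨η^a, c⟩` as a Fourier series in `a_p`. -/
lemma hasSum_overlap (a : Phase d) (c : Coord d N) :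
    HasSum (fun j => ec (N * (inner ℝ a.1 a.2 / 2)) *
      (overlapTerm N κ c j a.1 * ec (-(N * inner ℝ a.2 (node N κ j)))))
      (inner ℂ (cohCoord N κ a) c) := by
  refine (inner_projCoord (wave N a) c).congr_fun fun j => ?_
  rw [wave_apply, map_mul, conj_gaussian, conj_ec, overlapTerm]
  have : -((N : ℝ) * (inner ℝ a.2 (node N κ j) - inner ℝ a.1 a.2 / 2)) =
    N * (inner ℝ a.1 a.2 / 2) + -(N * inner ℝ a.2 (node N κ j)) := by ring
  rw [this, ec_add]
  ring

lemma continuous_overlap (c : Coord d N) :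
    Continuous fun a : Phase d => inner ℂ (cohCoord N κ a) c := by
  rw [continuous_iff_continuousAt]
  intro a
  obtain ⟨v, hv, -, hb⟩ := exists_overlapTerm_bound κ c (‖a‖ + 1)
  have : ContinuousOn (fun a : Phase d => inner ℂ (cohCoord N κ a) c) (Metric.ball a 1) := by
    simp only [fun a : Phase d => (hasSum_overlap (κ := κ) a c).tsum_eq.symm]
    refine continuousOn_tsum (fun j => by fun_prop) hv fun j y hy => ?_
    rw [norm_mul, norm_ec, one_mul, norm_mul, norm_ec, mul_one]
    refine hb _ ?_ j
    have h1 := norm_sub_norm_le y a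
    rw [Metric.mem_ball, dist_eq_norm] at hy
    have h2 : ‖y.1‖ ≤ ‖y‖ := norm_fst_le y
    linarith
  exact this.continuousAt (Metric.ball_mem_nhds a one_pos)

lemma continuous_cohCoord : Continuous (cohCoord N κ) := by
  have h (r : Fin d → Fin (N : ℕ)) : Continuous fun a => cohCoord N κ a r := by
    have := Complex.continuous_conj.comp
      (continuous_overlap (κ := κ) (EuclideanSpace.single r (1 : ℂ)))
    refine this.congr fun a => ?_
    simp [EuclideanSpace.inner_single_right]
  exact (PiLp.continuous_toLp 2 _).comp (continuous_pi h)

lemma natCast_mul_node_sub (y : Config d) (j k : Fin d → ℤ) :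
    (N : ℝ) * inner ℝ y (node N κ k) - N * inner ℝ y (node N κ j) =
      inner ℝ (latVec (k - j)) y := by
  have hN := (natCast_pos N).ne'
  rw [real_inner_comm _ (latVec (k - j)), latVec_sub, inner_sub_right]
  simp only [node, inner_add_right, inner_smul_right, intVec_eq_latVec]
  field_simp
  ring

variable (N κ) in
/-- The integrand obtained after integrating out the momentum. -/
def positionTerm (n : (Fin d → ℤ) × (Fin d → ℤ)) (x y : Config d) : ℂ :=
  ec (inner ℝ (latVec n.2) y) *
    (gaussian d N (x - y) * gaussian d N (x + (N : ℝ)⁻¹ • latVec n.1 - y))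

lemma gaussian_mul_gaussian (x y : Config d) :
    gaussian d N x * gaussian d N y = ((Real.pi * hbar N) ^ (-(d : ℝ) / 2) : ℝ) *
      Complex.exp ((-(‖x‖ ^ 2 + ‖y‖ ^ 2) / (2 * hbar N) : ℝ)) := by
  have h := mul_pos Real.pi_pos (hbar_pos N)
  rw [gaussian, gaussian, ← Complex.ofReal_exp, ← Complex.ofReal_mul, ← Complex.ofReal_mul]
  congr 1
  rw [mul_mul_mul_comm, ← Real.rpow_add h, ← Real.exp_add]
  congr 2
  · ring
  · ring

/-- Centring at the midpoint x + n_q/(2N) of the two Gaussians, the parallelogram law separates the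
width in u from the overlap factor exp(-π|n_q|²/(2N)). -/
lemma positionTerm_shift (n : (Fin d → ℤ) × (Fin d → ℤ)) (x u : Config d) :
    positionTerm N n x (u + (x + (2 * (N : ℝ))⁻¹ • latVec n.1)) =
      ec (inner ℝ (latVec n.2) x + inner ℝ (latVec n.1) (latVec n.2) / (2 * N)) *
      (((Real.pi * hbar N) ^ (-(d : ℝ) / 2) : ℝ) *
        Complex.exp ((-(Real.pi * ‖latVec n.1‖ ^ 2 / (2 * N)) : ℝ))) *
      Complex.exp (-((hbar N : ℝ)⁻¹ : ℂ) * ‖u‖ ^ 2 +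
        (2 * Real.pi * Complex.I) * (inner ℝ (latVec n.2) u : ℝ)) := by
  have hN := (natCast_pos N).ne'
  have hh := (hbar_pos N).ne'
  set w := (2 * (N : ℝ))⁻¹ • latVec n.1 with hw
  have e1 : x - (u + (x + w)) = -(u + w) := by abel
  have e2 : x + (N : ℝ)⁻¹ • latVec n.1 - (u + (x + w)) = w - u := by
    have : (N : ℝ)⁻¹ • latVec n.1 = w + w := by
      rw [hw, ← add_smul]
      congr 1
      field_simp
      norm_num
    rw [this]
    abel
  have e3 : ‖-(u + w)‖ ^ 2 + ‖w - u‖ ^ 2 = 2 * (‖u‖ ^ 2 + ‖w‖ ^ 2) := by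
    have := parallelogram_law_with_norm ℝ w u
    rw [norm_neg, add_comm u w, this]
    ring
  have e4 : ‖w‖ ^ 2 = ‖latVec n.1‖ ^ 2 / (4 * N ^ 2) := by
    rw [hw, norm_smul, mul_pow, norm_inv, Real.norm_of_nonneg (by positivity)]
    field_simp
    norm_num
    ring
  rw [positionTerm, e1, e2, gaussian_mul_gaussian, e3, e4]
  have e5 : (inner ℝ (latVec n.2) (u + (x + w)) : ℝ) = (inner ℝ (latVec n.2) x +
      inner ℝ (latVec n.1) (latVec n.2) / (2 * N)) + inner ℝ (latVec n.2) u := by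
    rw [hw, inner_add_right, inner_add_right, inner_smul_right,
      real_inner_comm (latVec n.2) (latVec n.1)]
    field_simp
    ring
  rw [e5, ec_add, ec_eq_cexp_mul (inner ℝ (latVec n.2) u), Complex.exp_add]
  have e6 : Complex.exp ((-(2 * (‖u‖ ^ 2 + ‖latVec n.1‖ ^ 2 / (4 * N ^ 2))) / (2 * hbar N) : ℝ)) =
      Complex.exp ((-(Real.pi * ‖latVec n.1‖ ^ 2 / (2 * N)) : ℝ)) *
      Complex.exp (-((hbar N : ℝ)⁻¹ : ℂ) * ‖u‖ ^ 2) := by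
    rw [← Complex.exp_add]
    congr 1
    rw [← Complex.ofReal_inv, ← Complex.ofReal_pow, ← Complex.ofReal_neg, ← Complex.ofReal_mul,
      ← Complex.ofReal_add]
    congr 1
    rw [hbar]
    field_simp
    ring
  rw [e6]
  ring

/-- The Gaussian integral behind the anti-Wick symbol. -/
lemma integral_positionTerm (n : (Fin d → ℤ) × (Fin d → ℤ)) (x : Config d) :
    Integrable (positionTerm N n x) ∧ ∫ y, positionTerm N n x y =
      ec (inner ℝ (latVec n.2) x + inner ℝ (latVec n.1) (latVec n.2) / (2 * N)) *
      Real.exp (-(Real.pi * (‖latVec n.1‖ ^ 2 + ‖latVec n.2‖ ^ 2) / (2 * N))) := by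
  have hN := (natCast_pos N).ne'
  have hh := hbar_pos N
  have hb : 0 < (((hbar N : ℝ)⁻¹ : ℂ)).re := by
    rw [← Complex.ofReal_inv, Complex.ofReal_re]; positivity
  have hint := GaussianFourier.integrable_cexp_neg_mul_sq_norm_add hb (2 * Real.pi * Complex.I)
    (latVec n.2)
  constructor
  · have := (hint.const_mul (ec (inner ℝ (latVec n.2) x + inner ℝ (latVec n.1) (latVec n.2) / (2 * N)) *
      (((Real.pi * hbar N) ^ (-(d : ℝ) / 2) : ℝ) *
        Complex.exp ((-(Real.pi * ‖latVec n.1‖ ^ 2 / (2 * N)) : ℝ))))).comp_sub_right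
      (x + (2 * (N : ℝ))⁻¹ • latVec n.1)
    refine this.congr (Eventually.of_forall fun y => ?_)
    simp only
    rw [← positionTerm_shift, sub_add_cancel]
  · rw [← integral_add_right_eq_self _ (x + (2 * (N : ℝ))⁻¹ • latVec n.1)]
    simp only [positionTerm_shift]
    rw [integral_const_mul, GaussianFourier.integral_cexp_neg_mul_sq_norm_add hb,
      finrank_euclideanSpace, Fintype.card_fin, mul_assoc]
    congr 1
    have e1 : (Real.pi / ((hbar N : ℝ)⁻¹ : ℂ)) ^ ((d : ℂ) / 2) =
        (((Real.pi * hbar N) ^ ((d : ℝ) / 2) : ℝ) : ℂ) := by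
      rw [Complex.ofReal_cpow (by positivity)]
      congr 1
      · push_cast; rw [div_inv_eq_mul]
      · push_cast; rfl
    have e2 : (2 * Real.pi * Complex.I) ^ 2 * (‖latVec n.2‖ : ℂ) ^ 2 / (4 * ((hbar N : ℝ)⁻¹ : ℂ)) =
        ((-(Real.pi * ‖latVec n.2‖ ^ 2 / (2 * N)) : ℝ) : ℂ) := by
      rw [mul_pow, Complex.I_sq, hbar]
      have : (Real.pi : ℂ) ≠ 0 := by exact_mod_cast Real.pi_ne_zero
      have : ((N : ℕ) : ℂ) ≠ 0 := by exact_mod_cast hN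
      push_cast
      field_simp
      norm_num
      ring
    rw [e1, e2]
    have e3 : (((Real.pi * hbar N) ^ (-(d : ℝ) / 2) : ℝ) : ℂ) *
        (((Real.pi * hbar N) ^ ((d : ℝ) / 2) : ℝ) : ℂ) = 1 := by
      rw [← Complex.ofReal_mul, ← Real.rpow_add (by positivity)]
      simp [neg_div]
    rw [← Complex.ofReal_exp, ← Complex.ofReal_exp]
    have e4 : Real.exp (-(Real.pi * (‖latVec n.1‖ ^ 2 + ‖latVec n.2‖ ^ 2) / (2 * N))) =
        Real.exp (-(Real.pi * ‖latVec n.1‖ ^ 2 / (2 * N))) *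
        Real.exp (-(Real.pi * ‖latVec n.2‖ ^ 2 / (2 * N))) := by
      rw [← Real.exp_add]
      congr 1
      ring
    rw [e4]
    push_cast at e3 ⊢
    linear_combination (Complex.exp (-(Real.pi * ‖latVec n.1‖ ^ 2 / (2 * N))) *
      Complex.exp (-(Real.pi * ‖latVec n.2‖ ^ 2 / (2 * N)))) * e3

end AntiWick

/-! ### Fourier coefficients of the squared overlap -/

section Husimi

variable {d : ℕ} {N : ℕ+} {κ : Phase d}

/-- The squared overlap as a double Fourier series in `a_p`. -/
lemma hasSum_normSq_overlap (n : (Fin d → ℤ) × (Fin d → ℤ)) (a : Phase d) (c : Coord d N) :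
    HasSum (fun p : (Fin d → ℤ) × (Fin d → ℤ) =>
      ec (inner ℝ (latVec n.2) a.1) *
        (overlapTerm N κ c p.1 a.1 * (starRingEnd ℂ) (overlapTerm N κ c p.2 a.1)) *
        ec (inner ℝ (latVec (p.2 - p.1 - n.1)) a.2))
      (ec (-symp (intPhase n) a) * ((‖inner ℂ (cohCoord N κ a) c‖ ^ 2 : ℝ) : ℂ)) := by
  have h := hasSum_overlap (κ := κ) a c
  have h' := Complex.hasSum_conj'.mpr h
  have hs := summable_mul_of_summable_norm h.summable.norm h'.summable.norm
  have hp := (h.mul h' hs).mul_left (ec (-symp (intPhase n) a))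
  rw [Complex.mul_conj, Complex.normSq_eq_norm_sq] at hp
  refine hp.congr_fun fun p => ?_
  rw [map_mul, map_mul, conj_ec, conj_ec]
  have e : ec (inner ℝ (latVec n.2) a.1) * ec (inner ℝ (latVec (p.2 - p.1 - n.1)) a.2) =
      ec (-symp (intPhase n) a) * (ec (N * (inner ℝ a.1 a.2 / 2)) *
        ec (-(N * inner ℝ a.2 (node N κ p.1))) * ec (-(N * (inner ℝ a.1 a.2 / 2))) *
        ec (- -(N * inner ℝ a.2 (node N κ p.2)))) := by
    simp only [← ec_add]
    congr 1
    rw [latVec_sub, inner_sub_left, ← natCast_mul_node_sub (κ := κ)]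
    simp only [symp, intPhase, intVec_eq_latVec]
    ring
  linear_combination (overlapTerm N κ c p.1 a.1 *
    (starRingEnd ℂ) (overlapTerm N κ c p.2 a.1)) * e

lemma integral_cube_mul (f g : Config d → ℂ) :
    ∫ a in cube d, f a.1 * g a.2 =
      (∫ y in unitCube (Fin d), f y) * ∫ y in unitCube (Fin d), g y := by
  rw [cube_eq_prod]
  exact setIntegral_prod_mul f g _ _

instance : IsProbabilityMeasure (volume.restrict (cube d)) := by
  rw [cube_eq_prod, Measure.volume_eq_prod, ← Measure.prod_restrict]
  infer_instance

lemma measurableSet_cube : MeasurableSet (cube d) := by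
  rw [cube_eq_prod]
  exact measurableSet_unitCube.prod measurableSet_unitCube

lemma norm_fst_le_of_mem_cube {a : Phase d} (ha : a ∈ cube d) : ‖a.1‖ ≤ √(Fintype.card (Fin d)) := by
  rw [cube_eq_prod] at ha
  exact norm_le_of_mem_unitCube ha.1

/-- Orthogonality of characters in a_p keeps only the pairs (j, j + n_q) of the double series. -/
lemma hasSum_integral_overlap (n : (Fin d → ℤ) × (Fin d → ℤ)) (c : Coord d N) :
    HasSum (fun j => ∫ y in unitCube (Fin d), ec (inner ℝ (latVec n.2) y) *
        (overlapTerm N κ c j y * (starRingEnd ℂ) (overlapTerm N κ c (j + n.1) y)))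
      (∫ a in cube d,
        ec (-symp (intPhase n) a) * ((‖inner ℂ (cohCoord N κ a) c‖ ^ 2 : ℝ) : ℂ)) := by
  obtain ⟨v, hv, hv0, hb⟩ := exists_overlapTerm_bound κ c (√(Fintype.card (Fin d)))
  have hvv : Summable fun p : (Fin d → ℤ) × (Fin d → ℤ) => v p.1 * v p.2 :=
    hv.mul_of_nonneg hv hv0 hv0
  have h := hasSum_integral_of_bound (μ := volume.restrict (cube d))
    (f := fun (p : (Fin d → ℤ) × (Fin d → ℤ)) (a : Phase d) =>
      ec (inner ℝ (latVec n.2) a.1) *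
        (overlapTerm N κ c p.1 a.1 * (starRingEnd ℂ) (overlapTerm N κ c p.2 a.1)) *
        ec (inner ℝ (latVec (p.2 - p.1 - n.1)) a.2)) hvv
    (fun p => by
      refine Continuous.aestronglyMeasurable ?_
      have := fun j => (continuous_overlapTerm (κ := κ) c j).comp continuous_fst (X := Phase d)
      have h2 := fun j => Complex.continuous_conj.comp (this j)
      have h1 := this
      exact ((by fun_prop : Continuous fun a : Phase d => ec (inner ℝ (latVec n.2) a.1)).mul
        ((h1 p.1).mul (h2 p.2))).mul (by fun_prop))
    (fun p => by
      refine (ae_restrict_iff' measurableSet_cube).mpr (Eventually.of_forall fun a ha => ?_)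
      rw [norm_mul, norm_mul, norm_ec, norm_ec, one_mul, mul_one, norm_mul, RCLike.norm_conj]
      exact mul_le_mul (hb _ (norm_fst_le_of_mem_cube ha) _) (hb _ (norm_fst_le_of_mem_cube ha) _)
        (norm_nonneg _) (hv0 _))
  simp only [(hasSum_normSq_overlap n _ c).tsum_eq] at h
  have hinj : Function.Injective fun j : Fin d → ℤ => (j, j + n.1) := fun j k hjk =>
    congrArg Prod.fst hjk
  rw [← hinj.hasSum_iff] at h
  · refine h.congr_fun fun j => ?_
    simp only [Function.comp_apply]
    rw [integral_cube_mul (fun y => ec (inner ℝ (latVec n.2) y) *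
        (overlapTerm N κ c j y * (starRingEnd ℂ) (overlapTerm N κ c (j + n.1) y)))
        (fun y => ec (inner ℝ (latVec (j + n.1 - j - n.1)) y)), integral_unitCube_ec]
    simp
  · rintro ⟨j, k⟩ hjk
    simp only
    rw [integral_cube_mul (fun y => ec (inner ℝ (latVec n.2) y) *
        (overlapTerm N κ c j y * (starRingEnd ℂ) (overlapTerm N κ c k y)))
        (fun y => ec (inner ℝ (latVec (k - j - n.1)) y)), integral_unitCube_ec, if_neg, mul_zero]
    intro h0
    refine hjk ⟨j, ?_⟩
    simp only [Prod.mk.injEq, true_and]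
    rw [sub_sub, sub_eq_zero] at h0
    exact h0.symm

lemma overlapTerm_mul_conj (n : (Fin d → ℤ) × (Fin d → ℤ)) (c : Coord d N) (j : Fin d → ℤ)
    (y : Config d) :
    ec (inner ℝ (latVec n.2) y) *
        (overlapTerm N κ c j y * (starRingEnd ℂ) (overlapTerm N κ c (j + n.1) y)) =
      ((((N : ℝ) ^ d : ℝ) : ℂ)⁻¹ * (extend N κ c j * (starRingEnd ℂ) (extend N κ c (j + n.1)))) *
        positionTerm N n (node N κ j) y := by
  have h : (((N : ℝ) ^ d : ℝ) : ℂ)⁻¹ = (normConst d N : ℂ) ^ 2 := by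
    rw [← Complex.ofReal_inv, ← normConst_sq, Complex.ofReal_pow]
  rw [h, overlapTerm, overlapTerm, map_mul, map_mul, conj_gaussian, Complex.conj_ofReal,
    positionTerm, node_add, intVec_eq_latVec]
  ring

/-- Lets the sum over nodes in one residue class be read as a sum over translates of the unit cube.
-/
lemma positionTerm_add_intVec (n : (Fin d → ℤ) × (Fin d → ℤ)) (x y : Config d) (k : Fin d → ℤ) :
    positionTerm N n (x + intVec k) y = positionTerm N n x (y + latVec (-k)) := by
  rw [positionTerm, positionTerm, ec_inner_add_latVec, latVec_neg, intVec_eq_latVec]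
  have e1 : x + latVec k - y = x - (y + -latVec k) := by abel
  have e2 : x + latVec k + (N : ℝ)⁻¹ • latVec n.1 - y =
    x + (N : ℝ)⁻¹ • latVec n.1 - (y + -latVec k) := by abel
  rw [e1, e2]

/-- The anti-Wick symbol: averaging the projections on coherent states against a character gives
the translation, up to a Gaussian factor. -/
theorem integral_char_mul_normSq_overlap (n : (Fin d → ℤ) × (Fin d → ℤ)) (c : Coord d N) :
    ((N : ℝ) ^ d : ℝ) * ∫ a in cube d,
        ec (-symp (intPhase n) a) * ((‖inner ℂ (cohCoord N κ a) c‖ ^ 2 : ℝ) : ℂ) =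
      Real.exp (-(Real.pi * (‖latVec n.1‖ ^ 2 + ‖latVec n.2‖ ^ 2) / (2 * N))) *
        inner ℂ c (shiftCoord N κ n c) := by
  have hN := natCast_pos N
  set G : ℝ := Real.exp (-(Real.pi * (‖latVec n.1‖ ^ 2 + ‖latVec n.2‖ ^ 2) / (2 * N)))
  set A : ℂ := (((N : ℝ) ^ d : ℝ) : ℂ) with hA
  have hA0 : A ≠ 0 := by
    rw [hA, Complex.ofReal_ne_zero]; positivity
  have h0 := hasSum_integral_overlap (κ := κ) n c
  set I := ∫ a in cube d,
        ec (-symp (intPhase n) a) * ((‖inner ℂ (cohCoord N κ a) c‖ ^ 2 : ℝ) : ℂ)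
  simp only [overlapTerm_mul_conj] at h0
  simp only [integral_const_mul] at h0
  have hb := quasiPeriodic_extend (κ := κ) c
  -- Within a residue class the weights do not depend on k, as the quasi-periodicity phases cancel,
  -- and the cube integrals add up to the Gaussian integral over ℝ^d.
  have hrow (r : Fin d → Fin (N : ℕ)) : HasSum (fun k => (A⁻¹ *
      (extend N κ c (rep r + (N : ℤ) • k) *
        (starRingEnd ℂ) (extend N κ c (rep r + (N : ℤ) • k + n.1)))) *
        ∫ y in unitCube (Fin d), positionTerm N n (node N κ (rep r + (N : ℤ) • k)) y)
      (A⁻¹ * (extend N κ c (rep r) * (starRingEnd ℂ) (extend N κ c (rep r + n.1))) *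
        (ec (inner ℝ (latVec n.2) (node N κ (rep r)) +
          inner ℝ (latVec n.1) (latVec n.2) / (2 * N)) * G)) := by
    obtain ⟨hi, he⟩ := integral_positionTerm (N := N) n (node N κ (rep r))
    have h := hasSum_integral_unitCube hi
    rw [he, ← (Equiv.neg _).hasSum_iff] at h
    refine (h.mul_left (A⁻¹ * (extend N κ c (rep r) *
      (starRingEnd ℂ) (extend N κ c (rep r + n.1))))).congr_fun fun k => ?_
    simp only [Function.comp_apply, Equiv.neg_apply, node_add_smul, positionTerm_add_intVec]
    have e1 : rep r + (N : ℤ) • k + n.1 = rep r + n.1 + (N : ℤ) • k := by abel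
    rw [hb, e1, hb, map_mul]
    have e2 : pChar κ k * (starRingEnd ℂ) (pChar κ k) = 1 := by
      rw [Complex.mul_conj, Complex.normSq_eq_norm_sq, norm_pChar]; simp
    linear_combination (A⁻¹ * extend N κ c (rep r) *
      (starRingEnd ℂ) (extend N κ c (rep r + n.1)) *
      ∫ y in unitCube (Fin d), positionTerm N n (node N κ (rep r)) (y + latVec (-k))) * e2
  have h1 := (divEquiv N).symm.hasSum_iff.mpr h0
  have h2 := h1.summable.tsum_prod' fun k => (hasSum_fintype _).summable
  rw [h1.tsum_eq] at h2
  simp only [Function.comp_apply, divEquiv_symm_apply, tsum_fintype] at h2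
  rw [Summable.tsum_finsetSum fun r _ => (hrow r).summable] at h2
  simp only [(hrow _).tsum_eq] at h2
  rw [h2, Finset.mul_sum, PiLp.inner_apply c, Finset.mul_sum]
  let h (j : Fin d → ℤ) : ℂ := (G : ℂ) * ((starRingEnd ℂ) (extend N κ c j) *
    shiftSeq N κ n (extend N κ c) j)
  have hper (j k : Fin d → ℤ) : h (j + (N : ℤ) • k) = h j := by
    simp only [h]
    rw [hb, hb.shiftSeq, map_mul]
    have e2 : pChar κ k * (starRingEnd ℂ) (pChar κ k) = 1 := by
      rw [Complex.mul_conj, Complex.normSq_eq_norm_sq, norm_pChar]; simp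
    linear_combination ((G : ℂ) * (starRingEnd ℂ) (extend N κ c j) *
      shiftSeq N κ n (extend N κ c) j) * e2
  have e1 : ∑ r, (G : ℂ) * inner ℂ (c r) (shiftCoord N κ n c r) =
      ∑ r : Fin d → Fin (N : ℕ), h (rep r) := by
    refine Finset.sum_congr rfl fun r _ => ?_
    simp only [h, extend_rep, RCLike.inner_apply']
    rfl
  -- Moving the summation index by n_q makes the conjugated entry the one at `rep r + n.1`, as on
  -- the left side.
  rw [e1, ← sum_rep_add hper n.1]
  refine Finset.sum_congr rfl fun r _ => ?_
  simp only [h, shiftSeq, add_sub_cancel_right, node_add]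
  have e3 : (inner ℝ (intVec n.2) (node N κ (rep r) + (N : ℝ)⁻¹ • intVec n.1) -
      inner ℝ (intVec n.1) (intVec n.2) / (2 * N) : ℝ) =
      inner ℝ (latVec n.2) (node N κ (rep r)) + inner ℝ (latVec n.1) (latVec n.2) / (2 * N) := by
    rw [inner_add_right, inner_smul_right, intVec_eq_latVec, intVec_eq_latVec,
      real_inner_comm (latVec n.1) (latVec n.2)]
    field_simp
    ring
  rw [e3]
  linear_combination ((extend N κ c (rep r) * (starRingEnd ℂ) (extend N κ c (rep r + n.1))) *
    (ec (inner ℝ (latVec n.2) (node N κ (rep r)) +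
          inner ℝ (latVec n.1) (latVec n.2) / (2 * N)) * G)) * (mul_inv_cancel₀ hA0)

end Husimi

/-! ### Resolution of the identity, error estimates, Weyl versus anti-Wick -/

section Resolution

variable {d : ℕ} {N : ℕ+} {κ : Phase d}

lemma exists_isCompact_cube_subset (d : ℕ) : ∃ K : Set (Phase d), IsCompact K ∧ cube d ⊆ K := by
  refine ⟨Metric.closedBall 0 (√(Fintype.card (Fin d))), isCompact_closedBall _ _, fun a ha => ?_⟩
  rw [cube_eq_prod] at ha
  rw [mem_closedBall_zero_iff]
  exact norm_prod_le_iff.mpr ⟨norm_le_of_mem_unitCube ha.1, norm_le_of_mem_unitCube ha.2⟩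

lemma integrableOn_cube {E : Type*} [NormedAddCommGroup E] {f : Phase d → E}
    (hf : Continuous f) : IntegrableOn f (cube d) := by
  obtain ⟨K, hK, hs⟩ := exists_isCompact_cube_subset d
  exact (hf.continuousOn.integrableOn_compact hK).mono_set hs

lemma exists_bound_cube {E : Type*} [NormedAddCommGroup E] {f : Phase d → E}
    (hf : Continuous f) : ∃ C, 0 ≤ C ∧ ∀ a ∈ cube d, ‖f a‖ ≤ C := by
  obtain ⟨K, hK, hs⟩ := exists_isCompact_cube_subset d
  obtain ⟨C, hC⟩ := hK.exists_bound_of_continuousOn hf.continuousOn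
  exact ⟨max C 0, le_max_right _ _, fun a ha => (hC a (hs ha)).trans (le_max_left _ _)⟩

lemma ae_cube {p : Phase d → Prop} (h : ∀ a ∈ cube d, p a) :
    ∀ᵐ a ∂(volume.restrict (cube d)), p a :=
  (ae_restrict_iff' measurableSet_cube).mpr (Eventually.of_forall h)

variable (N κ) in
/-- The Husimi density of a vector. -/
def husimi (c : Coord d N) (a : Phase d) : ℝ :=
  (N : ℝ) ^ d * ‖inner ℂ (cohCoord N κ a) c‖ ^ 2

@[fun_prop] lemma continuous_husimi (c : Coord d N) : Continuous (husimi N κ c) :=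
  continuous_const.mul ((continuous_overlap c).norm.pow 2)

lemma husimi_nonneg (c : Coord d N) (a : Phase d) : 0 ≤ husimi N κ c a := by
  unfold husimi; positivity

lemma shiftCoord_zero (c : Coord d N) : shiftCoord N κ 0 c = c := by
  have : shiftSeq N κ 0 (extend N κ c) = extend N κ c := by
    funext j
    simp [shiftSeq, intVec_eq_latVec]
  rw [shiftCoord, this, restr_extend]

lemma integral_char_mul_husimi (n : (Fin d → ℤ) × (Fin d → ℤ)) (c : Coord d N) :
    ∫ a in cube d, ec (-symp (intPhase n) a) * (husimi N κ c a : ℂ) =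
      Real.exp (-(Real.pi * (‖latVec n.1‖ ^ 2 + ‖latVec n.2‖ ^ 2) / (2 * N))) *
        inner ℂ c (shiftCoord N κ n c) := by
  rw [← integral_char_mul_normSq_overlap, ← integral_const_mul]
  congr 1
  funext a
  rw [husimi, Complex.ofReal_mul]
  ring

/-- The Husimi density has total mass `‖c‖²`. -/
lemma integral_husimi (c : Coord d N) : ∫ a in cube d, husimi N κ c a = ‖c‖ ^ 2 := by
  have h := integral_char_mul_husimi (κ := κ) 0 c
  rw [shiftCoord_zero, inner_self_eq_norm_sq_to_K] at h
  simp only [symp, intPhase, intVec_eq_latVec, Prod.fst_zero, Prod.snd_zero, latVec_zero,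
    inner_zero_left, sub_zero, neg_zero, ec_zero, one_mul, norm_zero] at h
  rw [integral_complex_ofReal] at h
  norm_num at h
  exact_mod_cast h

variable (N κ) in
/-- Superposition of coherent states in coordinates. -/
def superpose (χ : Phase d → ℝ) (c : Coord d N) : Coord d N :=
  (N : ℝ) ^ d • ∫ a in cube d,
    ((χ a : ℂ) * inner ℂ (cohCoord N κ a) c) • cohCoord N κ a

lemma superposition_synth (χ : Phase d → ℝ) (c : Coord d N) :
    superposition N κ χ (synth N κ c) = superpose N κ χ c := by
  have h : (2 * Real.pi * hbar N)⁻¹ = (N : ℝ) := by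
    have := (natCast_pos N).ne'
    rw [hbar]
    field_simp
  simp only [superposition, superpose, hInner, coords_coherent, coords_synth]
  rw [← inv_pow, h]

lemma continuous_superpose_integrand {χ : Phase d → ℝ} (hχ : Continuous χ) (c : Coord d N) :
    Continuous fun a => ((χ a : ℂ) * inner ℂ (cohCoord N κ a) c) • cohCoord N κ a :=
  ((Complex.continuous_ofReal.comp hχ).mul (continuous_overlap c)).smul continuous_cohCoord

lemma inner_superpose {χ : Phase d → ℝ} (hχ : Continuous χ) (v c : Coord d N) :
    inner ℂ v (superpose N κ χ c) = ((N : ℝ) ^ d : ℝ) * ∫ a in cube d,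
      (χ a : ℂ) * inner ℂ (cohCoord N κ a) c * inner ℂ v (cohCoord N κ a) := by
  rw [superpose, inner_smul_right_eq_smul, Complex.real_smul,
    ← integral_inner (integrableOn_cube (continuous_superpose_integrand hχ c))]
  simp only [inner_smul_right]

/-- The superposition operator is the anti-Wick quantization of χ: its expectations are Husimi
averages. -/
lemma inner_self_superpose {χ : Phase d → ℝ} (hχ : Continuous χ) (c : Coord d N) :
    inner ℂ c (superpose N κ χ c) = ((∫ a in cube d, χ a * husimi N κ c a : ℝ) : ℂ) := by
  rw [inner_superpose hχ, ← integral_complex_ofReal, ← integral_const_mul]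
  congr 1
  funext a
  rw [husimi, ← inner_conj_symm c, mul_assoc (χ a : ℂ), Complex.mul_conj,
    Complex.normSq_eq_norm_sq]
  push_cast
  ring

lemma superpose_add {χ χ' : Phase d → ℝ} (hχ : Continuous χ) (hχ' : Continuous χ')
    (c : Coord d N) :
    superpose N κ (fun a => χ a + χ' a) c = superpose N κ χ c + superpose N κ χ' c := by
  rw [superpose, superpose, superpose, ← smul_add,
    ← integral_add (integrableOn_cube (continuous_superpose_integrand hχ c))
      (integrableOn_cube (continuous_superpose_integrand hχ' c))]
  congr 2
  funext a
  rw [← add_smul]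
  push_cast
  ring_nf

/-- The resolution of the identity by coherent states. -/
theorem superpose_one (c : Coord d N) : superpose N κ (fun _ => 1) c = c := by
  let A : Coord d N →ₗ[ℂ] Coord d N :=
    { toFun := superpose N κ fun _ => 1
      map_add' := fun c c' => by
        rw [superpose, superpose, superpose, ← smul_add,
          ← integral_add (integrableOn_cube (continuous_superpose_integrand continuous_const c))
            (integrableOn_cube (continuous_superpose_integrand continuous_const c'))]
        simp only [inner_add_right, mul_add, add_smul]
      map_smul' := fun t c => by
        rw [superpose, superpose, RingHom.id_apply, smul_comm t, ← integral_smul t]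
        simp only [inner_smul_right, smul_smul, mul_left_comm] }
  have hA : A = LinearMap.id := by
    -- Over ℂ an operator is determined by its quadratic form, and here that form is the total
    -- Husimi mass ‖c‖².
    rw [← ext_inner_map]
    intro c
    rw [← inner_conj_symm]
    change (starRingEnd ℂ) (inner ℂ c (superpose N κ (fun _ => 1) c)) = _
    rw [inner_self_superpose continuous_const]
    simp only [one_mul]
    rw [integral_husimi, LinearMap.id_apply, inner_self_eq_norm_sq_to_K, Complex.conj_ofReal]
    norm_cast
  exact congrArg (fun A => A c) hA

lemma sub_superpose {χ : Phase d → ℝ} (hχ : Continuous χ) (c : Coord d N) :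
    c - superpose N κ χ c = superpose N κ (fun a => 1 - χ a) c := by
  have h := superpose_add (N := N) (κ := κ) hχ (χ' := fun a => 1 - χ a)
    (continuous_const.sub hχ) c
  simp only [add_sub_cancel] at h
  rw [superpose_one] at h
  rw [sub_eq_iff_eq_add', ← h]

/-- The square of the error of a superposition is bounded by the mass outside the cutoff. -/
theorem norm_sub_superpose_sq_le {χ : Phase d → ℝ} (hχ : Continuous χ) (c : Coord d N) :
    ‖c - superpose N κ χ c‖ ^ 2 ≤ ∫ a in cube d, (1 - χ a) ^ 2 * husimi N κ c a := by
  have hχ1 : Continuous fun a => 1 - χ a := continuous_const.sub hχ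
  set u := c - superpose N κ χ c with hu
  have h : inner ℂ u u = ((N : ℝ) ^ d : ℝ) * ∫ a in cube d,
      ((1 - χ a : ℝ) : ℂ) * inner ℂ (cohCoord N κ a) c * inner ℂ u (cohCoord N κ a) := by
    rw [← inner_superpose hχ1, ← sub_superpose hχ]
  have i1 : IntegrableOn (fun a => (1 - χ a) ^ 2 * husimi N κ c a) (cube d) :=
    integrableOn_cube (by fun_prop)
  have i2 : IntegrableOn (husimi N κ u) (cube d) := integrableOn_cube (by fun_prop)
  -- Write ‖u‖² = ⟨u, u⟩ with one u as the superposition of weight 1 - χ, and apply 2xy ≤ x² + y²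
  -- under the integral; the Husimi mass of u is ‖u‖² and half of it is absorbed.
  have h1 : ‖u‖ ^ 2 ≤ ∫ a in cube d, ((1 - χ a) ^ 2 * husimi N κ c a + husimi N κ u a) / 2 := by
    have : ‖u‖ ^ 2 = ‖(inner ℂ u u : ℂ)‖ := by
      rw [inner_self_eq_norm_sq_to_K]
      simp
    rw [this, h, ← integral_const_mul]
    refine norm_integral_le_of_norm_le ((i1.add i2).div_const 2) (Eventually.of_forall fun a => ?_)
    simp only [norm_mul, Complex.norm_real, husimi]
    rw [← norm_inner_symm (cohCoord N κ a) u, Real.norm_of_nonneg (by positivity), Real.norm_eq_abs]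
    have hs := two_mul_le_add_sq (|1 - χ a| * ‖inner ℂ (cohCoord N κ a) c‖)
      ‖inner ℂ (cohCoord N κ a) u‖
    rw [mul_pow, sq_abs] at hs
    have := mul_le_mul_of_nonneg_left hs (by positivity : (0 : ℝ) ≤ (N : ℝ) ^ d)
    linarith
  rw [integral_div, integral_add i1 i2, integral_husimi] at h1
  linarith

/-- The mass outside the cutoff is bounded by the error of the superposition. -/
theorem integral_one_sub_mul_husimi_le {χ : Phase d → ℝ} (hχ : Continuous χ) (c : Coord d N) :
    ∫ a in cube d, (1 - χ a) * husimi N κ c a ≤ ‖c‖ * ‖c - superpose N κ χ c‖ := by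
  have h := inner_self_superpose (N := N) (κ := κ)
    (χ := fun a => 1 - χ a) (continuous_const.sub hχ) c
  rw [← sub_superpose hχ] at h
  calc _ ≤ ‖((∫ a in cube d, (1 - χ a) * husimi N κ c a : ℝ) : ℂ)‖ := by
        rw [Complex.norm_real]; exact le_abs_self _
    _ ≤ _ := by rw [← h]; exact norm_inner_le_norm _ _

/-- The distance of the Weyl and anti-Wick quantizations of `f`. -/
def quantError (f : Phase d → ℂ) (N : ℕ+) : ℝ :=
  ∑' n : (Fin d → ℤ) × (Fin d → ℤ), ‖sympFourier f ((2 * Real.pi) • intPhase n)‖ *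
    |1 - Real.exp (-(Real.pi * (‖latVec n.1‖ ^ 2 + ‖latVec n.2‖ ^ 2) / (2 * N)))|

lemma abs_one_sub_exp_neg_le {t : ℝ} (ht : 0 ≤ t) : |1 - Real.exp (-t)| ≤ 1 := by
  have h1 := Real.exp_pos (-t)
  have h2 : Real.exp (-t) ≤ 1 := Real.exp_le_one_iff.mpr (by linarith)
  rw [abs_le]
  constructor <;> linarith

lemma tendsto_pnat_cast : Tendsto (fun N : ℕ+ => ((N : ℕ) : ℝ)) atTop atTop :=
  tendsto_natCast_atTop_atTop.comp tendsto_PNat_val_atTop_atTop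

/-- Dominated convergence: each Gaussian factor tends to 1, and the absolutely summable Fourier
coefficients of f dominate. -/
theorem TorusSmooth.tendsto_quantError {f : Phase d → ℂ} (hf : TorusSmooth f) :
    Tendsto (quantError f) atTop (𝓝 0) := by
  have h := tendsto_tsum_of_dominated_convergence (𝓕 := (atTop : Filter ℕ+))
    (f := fun N (n : (Fin d → ℤ) × (Fin d → ℤ)) =>
      ‖sympFourier f ((2 * Real.pi) • intPhase n)‖ *
    |1 - Real.exp (-(Real.pi * (‖latVec n.1‖ ^ 2 + ‖latVec n.2‖ ^ 2) / (2 * (N : ℕ))))|)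
    (g := fun _ => 0) hf.summable_sympFourier.norm (fun n => by
      have h1 : Tendsto (fun N : ℕ+ => -(Real.pi * (‖latVec n.1‖ ^ 2 + ‖latVec n.2‖ ^ 2) /
          (2 * ((N : ℕ) : ℝ)))) atTop (𝓝 (-0)) :=
        (tendsto_const_nhds.div_atTop (tendsto_pnat_cast.const_mul_atTop two_pos)).neg
      have h2 := (((Real.continuous_exp.tendsto _).comp h1).const_sub 1).abs.const_mul
        ‖sympFourier f ((2 * Real.pi) • intPhase n)‖
      simpa using h2)
    (Eventually.of_forall fun N n => by
      rw [norm_mul, norm_norm, Real.norm_eq_abs, abs_abs]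
      exact mul_le_of_le_one_right (norm_nonneg _) (abs_one_sub_exp_neg_le (by positivity)))
  rwa [tsum_zero] at h

lemma TorusSmooth.hasSum_integral_mul_husimi {f : Phase d → ℂ} (hf : TorusSmooth f)
    (c : Coord d N) :
    HasSum (fun n => sympFourier f ((2 * Real.pi) • intPhase n) *
      (Real.exp (-(Real.pi * (‖latVec n.1‖ ^ 2 + ‖latVec n.2‖ ^ 2) / (2 * N))) *
        inner ℂ c (shiftCoord N κ n c)))
      (∫ a in cube d, f a * (husimi N κ c a : ℂ)) := by
  obtain ⟨C, hC0, hC⟩ := exists_bound_cube (continuous_husimi (κ := κ) c)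
  have hsum (a : Phase d) := (hf.hasSum_sympFourier a).mul_right (husimi N κ c a : ℂ)
  have h := hasSum_integral_of_bound (μ := volume.restrict (cube d))
    (f := fun n (a : Phase d) => sympFourier f ((2 * Real.pi) • intPhase n) *
      ec (-symp (intPhase n) a) * (husimi N κ c a : ℂ))
    (hf.summable_sympFourier.norm.mul_right C) (fun n => by
      refine Continuous.aestronglyMeasurable ?_
      unfold symp
      have := Complex.continuous_ofReal.comp (continuous_husimi (κ := κ) c)
      exact (by fun_prop : Continuous fun a : Phase d =>
        sympFourier f ((2 * Real.pi) • intPhase n) *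
          ec (-(inner ℝ (intPhase n).1 a.2 - inner ℝ (intPhase n).2 a.1))).mul this)
    (fun n => ae_cube fun a ha => by
      rw [norm_mul, norm_mul, norm_ec, mul_one, Complex.norm_real]
      exact mul_le_mul_of_nonneg_left (hC a ha) (norm_nonneg _))
  simp only [(hsum _).tsum_eq] at h
  refine h.congr_fun fun n => ?_
  rw [← integral_char_mul_husimi, ← integral_const_mul]
  simp only [mul_assoc]

/-- Weyl expectations are Husimi averages, up to the quantization error. -/
theorem TorusSmooth.norm_inner_opW_sub_le {f : Phase d → ℂ} (hf : TorusSmooth f) (c : Coord d N) :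
    ‖inner ℂ c (coords N κ (opW N f (synth N κ c))) -
      ∫ a in cube d, f a * (husimi N κ c a : ℂ)‖ ≤ ‖c‖ ^ 2 * quantError f N := by
  have h1 := (innerSL ℂ c).hasSum (opW_synth (κ := κ) hf c)
  have h2 := h1.sub (hf.hasSum_integral_mul_husimi (κ := κ) c)
  have hs : Summable fun n : (Fin d → ℤ) × (Fin d → ℤ) =>
      ‖sympFourier f ((2 * Real.pi) • intPhase n)‖ *
    |1 - Real.exp (-(Real.pi * (‖latVec n.1‖ ^ 2 + ‖latVec n.2‖ ^ 2) / (2 * N)))| :=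
    Summable.of_nonneg_of_le (fun n => by positivity) (fun n =>
      mul_le_of_le_one_right (norm_nonneg _) (abs_one_sub_exp_neg_le (by positivity)))
      hf.summable_sympFourier.norm
  rw [innerSL_apply_apply] at h2
  rw [← h2.tsum_eq, quantError, ← tsum_mul_left]
  refine tsum_of_norm_bounded (hs.mul_left _).hasSum fun n => ?_
  set g := Real.exp (-(Real.pi * (‖latVec n.1‖ ^ 2 + ‖latVec n.2‖ ^ 2) / (2 * N)))
  have e : innerSL ℂ c (sympFourier f ((2 * Real.pi) • intPhase n) • shiftCoord N κ n c) -
      sympFourier f ((2 * Real.pi) • intPhase n) * (g * inner ℂ c (shiftCoord N κ n c)) =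
      sympFourier f ((2 * Real.pi) • intPhase n) * ((1 - g : ℝ) : ℂ) *
        inner ℂ c (shiftCoord N κ n c) := by
    rw [innerSL_apply_apply, inner_smul_right]
    push_cast
    ring
  rw [e, norm_mul, norm_mul, Complex.norm_real, Real.norm_eq_abs, mul_comm]
  refine mul_le_mul_of_nonneg_right ?_ (by positivity)
  refine (norm_inner_le_norm _ _).trans ?_
  rw [norm_shiftCoord, sq]

end Resolution

/-! ### Cutoffs near the origin of the torus -/

section Cutoff

variable {d : ℕ}

/-- A smooth periodic function comparable to the squared distance to the lattice. -/
def sinSq (x : Phase d) : ℝ :=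
  ∑ i, (Real.sin (Real.pi * x.1 i) ^ 2 + Real.sin (Real.pi * x.2 i) ^ 2)

lemma contDiff_sinSq : ContDiff ℝ ∞ (sinSq (d := d)) := by
  unfold sinSq
  have h1 (i : Fin d) : ContDiff ℝ ∞ fun x : Phase d => x.1 i :=
    ((EuclideanSpace.proj (𝕜 := ℝ) i).contDiff).comp contDiff_fst
  have h2 (i : Fin d) : ContDiff ℝ ∞ fun x : Phase d => x.2 i :=
    ((EuclideanSpace.proj (𝕜 := ℝ) i).contDiff).comp contDiff_snd
  exact ContDiff.sum fun i _ => (((contDiff_const.mul (h1 i)).sin).pow 2).add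
    (((contDiff_const.mul (h2 i)).sin).pow 2)

lemma sin_sq_add_int (t : ℝ) (n : ℤ) :
    Real.sin (Real.pi * (t + n)) ^ 2 = Real.sin (Real.pi * t) ^ 2 := by
  rw [Real.sin_sq_eq_half_sub, Real.sin_sq_eq_half_sub]
  have : 2 * (Real.pi * (t + n)) = 2 * (Real.pi * t) + n * (2 * Real.pi) := by ring
  rw [this, Real.cos_add_int_mul_two_pi]

lemma sinSq_add (x : Phase d) (n : (Fin d → ℤ) × (Fin d → ℤ)) :
    sinSq (x + intPhase n) = sinSq x := by
  simp [sinSq, intPhase, intVec, sin_sq_add_int]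

/-- Jordan's inequality sin x ≥ 2x/π on [0, π/2], applied at π times the distance to the nearest
integer. -/
lemma four_mul_sub_round_sq_le (t : ℝ) : 4 * (t - round t) ^ 2 ≤ Real.sin (Real.pi * t) ^ 2 := by
  have h0 := abs_sub_round t
  have h := Real.mul_le_sin (x := Real.pi * |t - round t|) (by positivity)
    (by nlinarith [Real.pi_pos])
  have e : 2 / Real.pi * (Real.pi * |t - round t|) = 2 * |t - round t| := by
    have := Real.pi_ne_zero
    field_simp
  rw [e] at h
  have h2 : Real.sin (Real.pi * |t - round t|) ^ 2 = Real.sin (Real.pi * t) ^ 2 := by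
    have h3 : Real.sin (Real.pi * |t - round t|) ^ 2 = Real.sin (Real.pi * (t - round t)) ^ 2 := by
      rcases abs_choice (t - round t) with h | h <;> rw [h]
      rw [mul_neg, Real.sin_neg, neg_sq]
    rw [h3, ← sin_sq_add_int (t - round t) (round t), sub_add_cancel]
  rw [← h2, ← sq_abs (t - round t)]
  nlinarith [abs_nonneg (t - round t)]

/-- The cutoff at distance `δ` from the lattice. -/
def cutoff (δ : ℝ) (x : Phase d) : ℝ := Real.smoothTransition (2 - sinSq x / δ ^ 2)

lemma torusSmooth_cutoff (δ : ℝ) : TorusSmooth (cutoff (d := d) δ) :=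
  ⟨Real.smoothTransition.contDiff.comp (contDiff_const.sub (contDiff_sinSq.div_const _)),
    fun x n => by rw [cutoff, cutoff, sinSq_add]⟩

lemma cutoff_zero (δ : ℝ) : cutoff (d := d) δ 0 = 1 := by
  have : sinSq (0 : Phase d) = 0 := by simp [sinSq]
  rw [cutoff, this]
  exact Real.smoothTransition.one_of_one_le (by norm_num)

/-- The cutoff vanishes once `sinSq` ≥ 2δ², and `sinSq` is at least four times the squared distance
to the lattice, so even δ²/2 bounds that distance squared. -/
lemma exists_near_of_cutoff_ne_zero {δ : ℝ} (hδ : 0 < δ) {x : Phase d} (h : cutoff δ x ≠ 0) :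
    ∃ n : (Fin d → ℤ) × (Fin d → ℤ),
      ‖x.1 - intVec n.1‖ ^ 2 + ‖x.2 - intVec n.2‖ ^ 2 ≤ δ ^ 2 := by
  have h1 : sinSq x < 2 * δ ^ 2 := by
    by_contra! h1
    refine h (Real.smoothTransition.zero_of_nonpos ?_)
    rw [sub_nonpos, le_div_iff₀ (by positivity)]
    exact h1
  refine ⟨(fun i => round (x.1 i), fun i => round (x.2 i)), ?_⟩
  rw [EuclideanSpace.norm_sq_eq, EuclideanSpace.norm_sq_eq, ← Finset.sum_add_distrib]
  have h2 : 4 * ∑ i, (‖(x.1 - intVec fun i => round (x.1 i)) i‖ ^ 2 +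
      ‖(x.2 - intVec fun i => round (x.2 i)) i‖ ^ 2) ≤ sinSq x := by
    rw [Finset.mul_sum]
    refine Finset.sum_le_sum fun i _ => ?_
    have e1 := four_mul_sub_round_sq_le (x.1 i)
    have e2 := four_mul_sub_round_sq_le (x.2 i)
    simp only [intVec, PiLp.sub_apply, Real.norm_eq_abs, sq_abs]
    linarith
  nlinarith [sq_nonneg δ]

end Cutoff

/-- A diagonal argument: countably many null sequences have a common null diagonal. -/
lemma exists_diagonal {F : ℕ → ℕ+ → ℝ} (hF : ∀ k, Tendsto (F k) atTop (𝓝 0)) :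
    ∃ k : ℕ+ → ℕ, Tendsto k atTop atTop ∧ Tendsto (fun N => F (k N) N) atTop (𝓝 0) := by
  classical
  let P (N : ℕ+) (k : ℕ) : Prop := |F k N| ≤ 1 / ((k : ℝ) + 1)
  -- The value 0 is also returned when no index satisfies P, so the bound is used only where k N ≥
  -- 1.
  let k (N : ℕ+) : ℕ := Nat.findGreatest (P N) N
  have hk : Tendsto k atTop atTop := by
    refine tendsto_atTop.mpr fun K => ?_
    have h1 : ∀ᶠ N in atTop, |F K N| < 1 / ((K : ℝ) + 1) := by
      have := (hF K).abs
      rw [abs_zero] at this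
      exact this.eventually_lt_const (by positivity)
    filter_upwards [h1, tendsto_PNat_val_atTop_atTop.eventually_ge_atTop K] with N h1 h2
    exact Nat.le_findGreatest h2 h1.le
  refine ⟨k, hk, squeeze_zero_norm' ?_ (tendsto_one_div_add_atTop_nhds_zero_nat.comp hk)⟩
  filter_upwards [hk.eventually_ge_atTop 1] with N hN
  have : P N (k N) := Nat.findGreatest_of_ne_zero rfl (by omega : k N ≠ 0)
  exact this

/-! ### The two implications in coordinates -/

section Main

variable {d : ℕ} {κ : ℕ+ → Phase d} {c : ∀ N, Coord d N}

/-- For bounded families, Weyl expectations and Husimi averages agree in the limit. -/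
lemma TorusSmooth.tendsto_inner_opW_sub {f : Phase d → ℂ} (hf : TorusSmooth f) {C : ℝ}
    (hc : ∀ᶠ N in atTop, ‖c N‖ ^ 2 ≤ C) :
    Tendsto (fun N => inner ℂ (c N) (coords N (κ N) (opW N f (synth N (κ N) (c N)))) -
      ∫ a in cube d, f a * (husimi N (κ N) (c N) a : ℂ)) atTop (𝓝 0) := by
  have h : Tendsto (fun N => C * |quantError f N|) atTop (𝓝 0) := by
    simpa using hf.tendsto_quantError.abs.const_mul C
  refine squeeze_zero_norm' ?_ h
  filter_upwards [hc] with N hN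
  refine (hf.norm_inner_opW_sub_le (c N)).trans ?_
  exact mul_le_mul hN (le_abs_self _) (by
    exact tsum_nonneg fun n => by positivity) ((sq_nonneg _).trans hN)

lemma torusSmooth_one : TorusSmooth (fun _ : Phase d => (1 : ℂ)) := ⟨contDiff_const, fun _ _ => rfl⟩

/-- A family whose expectations of the constant `1` converge is bounded. -/
lemma eventually_norm_sq_le
    (h : Tendsto (fun N => inner ℂ (c N) (coords N (κ N)
      (opW N (fun _ => 1) (synth N (κ N) (c N))))) atTop (𝓝 1)) :
    ∀ᶠ N in atTop, ‖c N‖ ^ 2 ≤ 4 := by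
  have h1 : ∀ᶠ N in atTop, ‖inner ℂ (c N) (coords N (κ N)
      (opW N (fun _ => 1) (synth N (κ N) (c N))))‖ < 2 := by
    have := h.norm
    rw [norm_one] at this
    exact this.eventually_lt_const one_lt_two
  have h2 : ∀ᶠ N in atTop, quantError (fun _ : Phase d => (1 : ℂ)) N < 1 / 2 :=
    torusSmooth_one.tendsto_quantError.eventually_lt_const (by norm_num)
  filter_upwards [h1, h2] with N h1 h2
  -- The Husimi average of 1 is ‖c‖², so with quantization error below 1/2 one gets ‖c‖² ≤ 2 +
  -- ‖c‖²/2.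
  have h3 := torusSmooth_one.norm_inner_opW_sub_le (κ := κ N) (c N)
  simp only [one_mul] at h3
  rw [integral_complex_ofReal, integral_husimi] at h3
  have h4 := norm_sub_norm_le (((‖c N‖ ^ 2 : ℝ)) : ℂ) (inner ℂ (c N) (coords N (κ N)
      (opW N (fun _ => 1) (synth N (κ N) (c N)))))
  rw [norm_sub_rev, Complex.norm_real, Real.norm_of_nonneg (sq_nonneg _)] at h4
  nlinarith [sq_nonneg ‖c N‖]

/-- Concentration at a point gives a localized superposition of coherent states. -/
theorem exists_cutoff_of_concentrates
    (h : ∀ f : Phase d → ℂ, TorusSmooth f → Tendsto (fun N => inner ℂ (c N) (coords N (κ N)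
      (opW N f (synth N (κ N) (c N))))) atTop (𝓝 (f 0))) :
    ∃ (r : ℕ+ → ℝ) (χ : ℕ+ → Phase d → ℝ), IsCutoffFamily r χ ∧
      Tendsto (fun N => ‖c N - superpose N (κ N) (χ N) (c N)‖) atTop (𝓝 0) := by
  have hb := eventually_norm_sq_le (h _ torusSmooth_one)
  have hδ (k : ℕ) : 0 < 1 / ((k : ℝ) + 1) := by positivity
  -- For fixed k the symbol (1 - χ)² is a smooth test function vanishing at 0, so (A) applies to it.
  have hF (k : ℕ) : Tendsto (fun N => ∫ a in cube d,
      (1 - cutoff (1 / ((k : ℝ) + 1)) a) ^ 2 * husimi N (κ N) (c N) a) atTop (𝓝 0) := by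
    set χ : Phase d → ℝ := cutoff (1 / ((k : ℝ) + 1)) with hχ
    have hs : TorusSmooth χ := torusSmooth_cutoff _
    have hf : TorusSmooth fun a : Phase d => (((1 - χ a) ^ 2 : ℝ) : ℂ) :=
      ⟨Complex.ofRealCLM.contDiff.comp ((contDiff_const.sub hs.1).pow 2), fun x n => by
        simp only [hs.2]⟩
    have h1 := (h _ hf).sub (hf.tendsto_inner_opW_sub (κ := κ) hb)
    have h0 : χ 0 = 1 := cutoff_zero _
    simp only [sub_sub_cancel, h0] at h1
    simp only [← Complex.ofReal_mul] at h1
    simp only [integral_complex_ofReal] at h1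
    simpa [Function.comp_def] using (Complex.continuous_re.tendsto _).comp h1
  -- The cutoff may now vary with N: radii 1/(k N + 1) shrink while the outside mass still vanishes.
  obtain ⟨k, hk, hkF⟩ := exists_diagonal hF
  refine ⟨fun N => 1 / ((k N : ℝ) + 1), fun N => cutoff (1 / ((k N : ℝ) + 1)),
    ⟨fun N => hδ _, tendsto_one_div_add_atTop_nhds_zero_nat.comp hk, fun N => torusSmooth_cutoff _,
      fun N a => Real.smoothTransition.nonneg _, fun N a => Real.smoothTransition.le_one _,
      fun N a ha => exists_near_of_cutoff_ne_zero (hδ _) ha⟩, ?_⟩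
  have h2 : Tendsto (fun N => ‖c N - superpose N (κ N) (cutoff (1 / ((k N : ℝ) + 1))) (c N)‖ ^ 2)
      atTop (𝓝 0) :=
    squeeze_zero (fun N => sq_nonneg _)
      (fun N => norm_sub_superpose_sq_le (torusSmooth_cutoff _).1.continuous (c N)) hkF
  simpa [Real.sqrt_sq_eq_abs] using h2.sqrt

/-- A localized superposition of coherent states concentrates at a point. -/
theorem concentrates_of_cutoff {r : ℕ+ → ℝ} {χ : ℕ+ → Phase d → ℝ} (hχ : IsCutoffFamily r χ)
    (hB : Tendsto (fun N => ‖c N - superpose N (κ N) (χ N) (c N)‖) atTop (𝓝 0))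
    (hc : Tendsto (fun N => ‖c N‖) atTop (𝓝 1)) {f : Phase d → ℂ} (hf : TorusSmooth f) :
    Tendsto (fun N => inner ℂ (c N) (coords N (κ N) (opW N f (synth N (κ N) (c N)))))
      atTop (𝓝 (f 0)) := by
  have hc2 : Tendsto (fun N => ‖c N‖ ^ 2) atTop (𝓝 1) := by simpa using hc.pow 2
  have hb : ∀ᶠ N in atTop, ‖c N‖ ^ 2 ≤ 2 :=
    (hc2.eventually_lt_const one_lt_two).mono fun N h => h.le
  have hout : Tendsto (fun N => ∫ a in cube d, (1 - χ N a) * husimi N (κ N) (c N) a)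
      atTop (𝓝 0) := by
    have h0 := hc.mul hB
    rw [mul_zero] at h0
    refine squeeze_zero (fun N => integral_nonneg fun a => ?_)
      (fun N => integral_one_sub_mul_husimi_le (hχ.smooth N).1.continuous (c N)) h0
    exact mul_nonneg (sub_nonneg.mpr (hχ.le_one N a)) (husimi_nonneg _ _)
  have hfc : Continuous f := hf.1.continuous
  obtain ⟨M, hM0, hM⟩ := exists_bound_cube (hfc.sub (continuous_const (y := f 0)))
  have hmain : Tendsto (fun N => ∫ a in cube d, (f a - f 0) * (husimi N (κ N) (c N) a : ℂ))
      atTop (𝓝 0) := by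
    rw [Metric.tendsto_nhds]
    intro ε hε
    -- ε/4 times a mass of at most 2 uses ε/2; the mass outside the cutoff contributes strictly less
    -- than the other ε/2.
    obtain ⟨ρ, hρ, hρf⟩ := Metric.continuousAt_iff.mp
      (hfc.continuousAt (x := (0 : Phase d))) (ε / 4) (by positivity)
    have hlim : Tendsto (fun N => M * ∫ a in cube d, (1 - χ N a) * husimi N (κ N) (c N) a)
        atTop (𝓝 0) := by simpa using hout.const_mul M
    filter_upwards [hχ.tendsto.eventually_lt_const hρ, hb,
      hlim.eventually_lt_const (by positivity : 0 < ε / 2)] with N hr hcN hl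
    have i1 : IntegrableOn (husimi N (κ N) (c N)) (cube d) := integrableOn_cube (by fun_prop)
    have hχc : Continuous (χ N) := (hχ.smooth N).1.continuous
    have i2 : IntegrableOn (fun a => (1 - χ N a) * husimi N (κ N) (c N) a) (cube d) :=
      integrableOn_cube (by fun_prop)
    -- Where χ vanishes the bound M applies with full weight; elsewhere a is near the lattice, and
    -- periodicity of f brings it near 0.
    have hpt : ∀ a ∈ cube d, ‖(f a - f 0) * (husimi N (κ N) (c N) a : ℂ)‖ ≤
        ε / 4 * husimi N (κ N) (c N) a + M * ((1 - χ N a) * husimi N (κ N) (c N) a) := by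
      intro a ha
      have hh := husimi_nonneg (κ := κ N) (c N) a
      rw [norm_mul, Complex.norm_real, Real.norm_of_nonneg hh, ← mul_assoc, ← add_mul]
      refine mul_le_mul_of_nonneg_right ?_ hh
      by_cases h0 : χ N a = 0
      · rw [h0, sub_zero, mul_one]
        exact (hM a ha).trans (by linarith)
      · obtain ⟨n, hn⟩ := hχ.support N a h0
        have e1 : f a = f (a - intPhase n) := by
          rw [← hf.2 (a - intPhase n) n, sub_add_cancel]
        have e2 : ‖a - intPhase n‖ < ρ := by
          refine lt_of_le_of_lt ?_ hr
          refine norm_prod_le_iff.mpr ⟨?_, ?_⟩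
          · exact abs_le_of_sq_le_sq' (by
              nlinarith [sq_nonneg ‖a.2 - intVec n.2‖] : ‖a.1 - intVec n.1‖ ^ 2 ≤ r N ^ 2)
                (hχ.pos N).le |>.2
          · exact abs_le_of_sq_le_sq' (by
              nlinarith [sq_nonneg ‖a.1 - intVec n.1‖] : ‖a.2 - intVec n.2‖ ^ 2 ≤ r N ^ 2)
                (hχ.pos N).le |>.2
        have e3 := hρf (x := a - intPhase n) (by rwa [dist_zero_right])
        rw [dist_eq_norm, ← e1] at e3
        have := mul_nonneg hM0 (sub_nonneg.mpr (hχ.le_one N a))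
        linarith
    rw [dist_zero_right]
    calc _ ≤ ∫ a in cube d, (ε / 4 * husimi N (κ N) (c N) a +
          M * ((1 - χ N a) * husimi N (κ N) (c N) a)) :=
          norm_integral_le_of_norm_le ((i1.const_mul _).add (i2.const_mul _)) (ae_cube hpt)
      _ = ε / 4 * ‖c N‖ ^ 2 + M * ∫ a in cube d, (1 - χ N a) * husimi N (κ N) (c N) a := by
          rw [integral_add (i1.const_mul _) (i2.const_mul _), integral_const_mul,
            integral_const_mul, integral_husimi]
      _ < ε := by nlinarith
  have hmass : Tendsto (fun N => f 0 * ((‖c N‖ ^ 2 : ℝ) : ℂ)) atTop (𝓝 (f 0)) := by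
    simpa using ((Complex.continuous_ofReal.tendsto _).comp hc2).const_mul (f 0)
  have h := ((hf.tendsto_inner_opW_sub (κ := κ) hb).add hmain).add hmass
  rw [zero_add, zero_add] at h
  refine h.congr fun N => ?_
  have i1 : IntegrableOn (fun a => f a * (husimi N (κ N) (c N) a : ℂ)) (cube d) :=
    integrableOn_cube (hfc.mul (Complex.continuous_ofReal.comp (continuous_husimi _)))
  have i2 : IntegrableOn (fun a => f 0 * (husimi N (κ N) (c N) a : ℂ)) (cube d) :=
    integrableOn_cube (continuous_const.mul (Complex.continuous_ofReal.comp (continuous_husimi _)))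
  simp only [sub_mul]
  rw [integral_sub i1 i2, integral_const_mul, integral_complex_ofReal, integral_husimi]
  ring

end Main

end TorusQuantum

end

open TorusQuantum
theorem lemma3p12 (d : ℕ) (hd : 1 ≤ d) (κ : ℕ+ → Phase d)
    (hκ : ∀ N j, (κ N).1 j ∈ Set.Ico (0 : ℝ) (2 * Real.pi) ∧
      (κ N).2 j ∈ Set.Ico (0 : ℝ) (2 * Real.pi))
    (Ψ : ℕ+ → 𝓢'(Config d, ℂ)) (hΨ : ∀ N, Ψ N ∈ hilb N (κ N)) :
    (ConcentratesAtZero κ Ψ →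
      ∃ (r : ℕ+ → ℝ) (χ : ℕ+ → Phase d → ℝ),
        IsCutoffFamily r χ ∧ ApproxBySuperposition κ Ψ χ) ∧
    (∀ (r : ℕ+ → ℝ) (χ : ℕ+ → Phase d → ℝ),
      IsCutoffFamily r χ → ApproxBySuperposition κ Ψ χ →
      Tendsto (fun N => hNorm N (κ N) (Ψ N)) atTop (𝓝 1) →
      ConcentratesAtZero κ Ψ) := by
  -- Membership in the Hilbert space is used only here, to replace each distribution by its
  -- coordinate vector.
  choose c hc using fun N => exists_eq_synth (hΨ N)
  obtain rfl : Ψ = fun N => synth N (κ N) (c N) := funext hc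
  simp only [ConcentratesAtZero, ApproxBySuperposition, hInner, hNorm, coords_synth,
    superposition_synth]
  exact ⟨exists_cutoff_of_concentrates, fun r χ hχ hB hn f hf => concentrates_of_cutoff hχ hB hn hf⟩
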